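/- **Setting.** Let $\mathfrak H,\mathcal H^A,\mathfrak T$ be Hilbert spaces, $A$ a densely defined symmetric operator in $\mathfrak H$, and $\Pi_A=\{\mathcal H^A,\Gamma_0^A,\Gamma_1^A\}$ a boundary triplet for $A^*$: $\Gamma_0^A,\Gamma_1^A:\operatorname{dom}(A^*)\to\mathcal H^A$ are linear, $(A^*f,g)-(f,A^*g)=(\Gamma_1^Af,\Gamma_0^Ag)-(\Gamma_0^Af,\Gamma_1^Ag)$ for all $f,g\in\operatorname{dom}(A^*)$, and $f\mapsto(\Gamma_0^Af,\Gamma_1^Af)$ maps onto $\mathcal H^A\oplus\mathcal H^A$. For $z\in\mathbb C_\pm$ let $\gamma^A(z)=(\Gamma_0^A\upharpoonright\ker(A^*-z))^{-1}$ be the $\gamma$-field and $M^A(z)=\Gamma_1^A\gamma^A(z)$ the Weyl function; $A_0:=A^*\upharpoonright\ker\Gamma_0^A$. The same notions are used for other operators. A triplet with Weyl function $M$ is called normalized if $M(i)=iI$; for a boundary triplet with maps $\Gamma_0,\Gamma_1$ and Weyl function $M$, the associated normalized triplet has the maps $R\,\Gamma_0$ and $R^{-1}(\Gamma_1-Q\Gamma_0)$,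 where $R=\sqrt{\operatorname{Im}M(i)}$, $Q=\operatorname{Re}M(i)$. Let $T=T^*$ be a bounded operator on $\mathfrak T$ with spectral measure $E_T$, let $\Delta=[a,b]$ be a compact interval containing $\sigma(T)$ (for example the smallest one), and put $\widehat E_T(\delta):=I_{\mathcal H^A}\otimes E_T(\delta)$. For an operator $B$ in $\mathfrak H$, $B\otimes I_{\mathfrak T}+I_{\mathfrak H}\otimes T$ denotes the closure of the operator defined on the linear span of the $g\otimes h$, $g\in\operatorname{dom}B$, $h\in\mathfrak T$, by $g\otimes h\mapsto Bg\otimes h+g\otimes Th$. Let $S:=A\otimes I_{\mathfrak T}+I_{\mathfrak H}\otimes T$. Let $\mathfrak H_+(A^*)$ be $\operatorname{dom}(A^*)$ with the graph norm, $J:\mathfrak H_+(A^*)\to\mathfrak H$ the embedding and $\widehat\Gamma_j^A=\Gamma_j^AJ$, a bounded operator from $\mathfrak H_+(A^*)$ to $\mathcal H^A$. Put $\Gamma_j^A\widehat\otimes I_{\mathfrak T}:=(\widehat\Gamma_j^A\otimes I_{\mathfrak T})(J\otimes I_{\mathfrak T})^{-1}$ on $\operatorname{ran}(J\otimes I_{\mathfrak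 T})$, $j=0,1$, and $\Pi_S:=\Pi_A\widehat\otimes I_{\mathfrak T}:=\{\mathcal H^A\otimes\mathfrak T,\Gamma_0^A\widehat\otimes I_{\mathfrak T},\Gamma_1^A\widehat\otimes I_{\mathfrak T}\}$. The integrals $\int_\Delta\Omega(\lambda)\widehat E_T(d\lambda)$ and $\int_\Delta\widehat E_T(d\lambda)\Omega(\lambda)$ are the limits in operator norm, as the mesh tends to zero, of the sums $\sum_m\Omega(x_m)\widehat E_T(\Delta_m)$ and $\sum_m\widehat E_T(\Delta_m)\Omega(x_m)$ over the partitions of $\Delta$ into consecutive intervals $\Delta_m$, left-closed and right-open except that the last one is closed, with arbitrary $x_m\in\Delta_m$. **Proposition.** $\Pi_S$ is a boundary triplet for $S^*$. Let $M^S$ be its Weyl function. All integrals below exist, and: (i) One has $$R:=\int_\Delta\widehat E_T(d\lambda)\Big(\sqrt{\operatorname{Im}M^A(i-\lambda)}\otimes I_{\mathfrak T}\Big)=\sqrt{\operatorname{Im}M^S(i)},\qquad \int_\Delta\widehat E_T(d\lambda)\Big(\tfrac1{\sqrt{\operatorname{Im}M^A(i-\lambda)}}\otimes I_{\mathfrak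 T}\Big)=R^{-1},$$ $$Q:=\int_\Delta\widehat E_T(d\lambda)\big(\operatorname{Re}M^A(i-\lambda)\otimes I_{\mathfrak T}\big)=\operatorname{Re}M^S(i).$$ The triplet $\widetilde\Pi_S=\{\mathcal H^A\otimes\mathfrak T,\widetilde\Gamma_0^S,\widetilde\Gamma_1^S\}$ with $$\widetilde\Gamma_0^S=R\,(\Gamma_0^A\widehat\otimes I_{\mathfrak T}),\qquad \widetilde\Gamma_1^S=R^{-1}\big(\Gamma_1^A\widehat\otimes I_{\mathfrak T}-Q\,(\Gamma_0^A\widehat\otimes I_{\mathfrak T})\big)$$ is a normalized boundary triplet for $S^*$ (the one associated with $\Pi_S$), and $$S^*\upharpoonright\ker\widetilde\Gamma_0^S=S^*\upharpoonright\ker(\Gamma_0^A\widehat\otimes I_{\mathfrak T})=A_0\otimes I_{\mathfrak T}+I_{\mathfrak H}\otimes T.$$ (ii) For $z\in\mathbb C_\pm$ the $\gamma$-field and the Weyl function of $\widetilde\Pi_S$ are $$\widetilde\gamma^S(z)=\int_\Delta\Big(\gamma^A(z-\lambda)\tfrac1{\sqrt{\operatorname{Im}M^A(i-\lambda)}}\otimes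 I_{\mathfrak T}\Big)\widehat E_T(d\lambda),$$ $$\widetilde M^S(z)=\int_\Delta\big(L^A(z-\lambda,i-\lambda)\otimes I_{\mathfrak T}\big)\widehat E_T(d\lambda)=\int_\Delta\widehat E_T(d\lambda)\big(L^A(z-\lambda,i-\lambda)\otimes I_{\mathfrak T}\big),$$ where $$L^A(z,\zeta):=\tfrac1{\sqrt{\operatorname{Im}M^A(\zeta)}}\big(M^A(z)-\operatorname{Re}M^A(\zeta)\big)\tfrac1{\sqrt{\operatorname{Im}M^A(\zeta)}},\qquad z\in\mathbb C_\pm,\ \zeta\in\mathbb C_+ .$$ (iii) If $M^A$ is of scalar type, i.e. $M^A(z)=m^A(z)I_{\mathcal H^A}$ for $z\in\mathbb C_\pm$ with a scalar Nevanlinna function $m^A$ (holomorphic on $\mathbb C_\pm$, $m^A(\bar z)=\overline{m^A(z)}$, $\operatorname{Im}m^A(z)/\operatorname{Im}z\ge0$), then, in the sense of the functional calculus of $T$, $$\widetilde M^S(z)=I_{\mathcal H^A}\otimes\frac{m^A(z-T)-\operatorname{Re}(m^A(i-T))}{\operatorname{Im}(m^A(i-T))},\qquad z\in\mathbb C_\pm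 .$$ In particular, $M^A$ is of scalar type whenever $\dim\ker(A^*-i)=\dim\ker(A^*+i)=1$. -/

import Mathlib

open scoped TensorProduct InnerProductSpace

noncomputable section

namespace BT

/-! ## Hilbert tensor products -/

section Tensor

variable {E F G H : Type*}
  [NormedAddCommGroup E] [InnerProductSpace ℂ E] [NormedAddCommGroup F] [InnerProductSpace ℂ F]
  [NormedAddCommGroup G] [InnerProductSpace ℂ G] [NormedAddCommGroup H] [InnerProductSpace ℂ H]

variable (E F) in
/-- The Hilbert space tensor product: the completion of the algebraic tensor product for the inner
product `⟪a ⊗ b, c ⊗ d⟫ = ⟪a, c⟫ * ⟪b, d⟫`. -/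
abbrev HTensor := UniformSpace.Completion (E ⊗[ℂ] F)

/-- The bounded operator `f ⊗ g` between Hilbert space tensor products. -/
def tmap (f : E →L[ℂ] F) (g : G →L[ℂ] H) : HTensor E G →L[ℂ] HTensor F H :=
  (TensorProduct.mapL f g).completion

/-- The elementary tensor `x ⊗ y` in the Hilbert space tensor product. -/
def elem (x : E) (y : F) : HTensor E F := ((x ⊗ₜ[ℂ] y : E ⊗[ℂ] F) : HTensor E F)

theorem tmap_elem (f : E →L[ℂ] F) (g : G →L[ℂ] H) (x : E) (y : G) :
    tmap f g (elem x y) = elem (f x) (g y) := by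
  simp [tmap, elem]

theorem inner_elem (x x' : E) (y y' : F) :
    ⟪elem x y, elem x' y'⟫_ℂ = ⟪x, x'⟫_ℂ * ⟪y, y'⟫_ℂ := by
  simp [elem]

/-- A vector of the tensor product that is orthogonal to all elementary tensors vanishes. -/
theorem eq_zero_of_inner_elem {u : HTensor E F} (h : ∀ x y, ⟪u, elem x y⟫_ℂ = 0) : u = 0 := by
  have key : ∀ v : HTensor E F, ⟪u, v⟫_ℂ = 0 := by
    intro v
    induction v using UniformSpace.Completion.induction_on with
    | hp => exact isClosed_eq (by fun_prop) continuous_const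
    | ih a =>
      induction a with
      | zero => rw [UniformSpace.Completion.coe_zero, inner_zero_right]
      | tmul x y => exact h x y
      | add a b ha hb => rw [UniformSpace.Completion.coe_add, inner_add_right, ha, hb, add_zero]
  exact inner_self_eq_zero.1 (key u)

theorem inner_tmap_elem [CompleteSpace E] [CompleteSpace F] [CompleteSpace G] [CompleteSpace H]
    (f : E →L[ℂ] F) (g : G →L[ℂ] H) (u : HTensor E G) (x : F) (y : H) :
    ⟪tmap f g u, elem x y⟫_ℂ
      = ⟪u, elem (ContinuousLinearMap.adjoint f x) (ContinuousLinearMap.adjoint g y)⟫_ℂ := by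
  induction u using UniformSpace.Completion.induction_on with
  | hp => exact isClosed_eq (by fun_prop) (by fun_prop)
  | ih a =>
    induction a with
    | zero => rw [UniformSpace.Completion.coe_zero, map_zero, inner_zero_left, inner_zero_left]
    | tmul a b =>
      change ⟪tmap f g (elem a b), elem x y⟫_ℂ = ⟪elem a b, _⟫_ℂ
      rw [tmap_elem, inner_elem, inner_elem, ContinuousLinearMap.adjoint_inner_right,
        ContinuousLinearMap.adjoint_inner_right]
    | add a b ha hb =>
      rw [UniformSpace.Completion.coe_add, map_add, inner_add_left, inner_add_left, ha, hb]

/-- If `f` is injective, so is `f ⊗ I`. -/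
theorem tmap_id_injective [CompleteSpace E] [CompleteSpace F] [CompleteSpace G]
    {f : E →L[ℂ] F} (hf : Function.Injective f) :
    Function.Injective (tmap f (ContinuousLinearMap.id ℂ G)) := by
  rw [injective_iff_map_eq_zero]
  intro u hu
  refine eq_zero_of_inner_elem fun x y => ?_
  have h0 : ∀ x', ⟪u, elem (ContinuousLinearMap.adjoint f x') y⟫_ℂ = 0 := by
    intro x'
    have := inner_tmap_elem f (ContinuousLinearMap.id ℂ G) u x' y
    rw [hu, inner_zero_left] at this
    have hid : ContinuousLinearMap.adjoint (ContinuousLinearMap.id ℂ G) = .id ℂ G := by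
      ext1 w
      refine ext_inner_left ℂ fun v => ?_
      rw [ContinuousLinearMap.adjoint_inner_right]; rfl
    rw [hid] at this
    exact this.symm
  have hd : Dense (Set.range (ContinuousLinearMap.adjoint f)) := by
    have h1 : (LinearMap.range (ContinuousLinearMap.adjoint f).toLinearMap).topologicalClosure = ⊤ := by
      rw [Submodule.topologicalClosure_eq_top_iff, Submodule.eq_bot_iff]
      intro w hw
      apply hf
      rw [map_zero]
      refine ext_inner_right ℂ fun v => ?_
      rw [inner_zero_left, ← ContinuousLinearMap.adjoint_inner_right]
      exact (Submodule.mem_orthogonal' _ _).1 hw _ ⟨v, rfl⟩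
    exact (Submodule.dense_iff_topologicalClosure_eq_top).2 h1
  have hc : Continuous fun x : E => ⟪u, elem x y⟫_ℂ := by
    have : Continuous fun x : E => (x ⊗ₜ[ℂ] y : E ⊗[ℂ] G) :=
      (TensorProduct.continuous_tmul (𝕜 := ℂ)).comp
        (continuous_id.prodMk continuous_const)
    exact continuous_const.inner ((UniformSpace.Completion.continuous_coe _).comp this)
  have := hd.closure_eq
  have hcl : IsClosed {x : E | ⟪u, elem x y⟫_ℂ = 0} := isClosed_eq hc continuous_const
  exact (hcl.closure_subset_iff.2 (by rintro _ ⟨v, rfl⟩; exact h0 v)) (this ▸ Set.mem_univ x)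

end Tensor

/-! ## The operators `B ⊗ I + I ⊗ T` -/

section TensorSum

variable {E 𝔗 : Type*} [NormedAddCommGroup E] [InnerProductSpace ℂ E]
  [NormedAddCommGroup 𝔗] [InnerProductSpace ℂ 𝔗]

/-- The inclusion of `dom B ⊙ 𝔗` (algebraic tensor product) in `E ⊗ 𝔗`. -/
def domTensorIncl (B : E →ₗ.[ℂ] E) : B.domain ⊗[ℂ] 𝔗 →ₗ[ℂ] HTensor E 𝔗 :=
  UniformSpace.Completion.toComplL.toLinearMap ∘ₗ B.domain.subtype.rTensor 𝔗

theorem domTensorIncl_injective (B : E →ₗ.[ℂ] E) :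
    Function.Injective (domTensorIncl (𝔗 := 𝔗) B) := by
  refine (UniformSpace.Completion.coe_injective _).comp ?_
  exact Module.Flat.rTensor_preserves_injective_linearMap _ Subtype.val_injective

/-- `B ⊙ I + I ⊙ T`, with domain the linear span of the `g ⊗ h`, `g ∈ dom B`, `h ∈ 𝔗`,
and `g ⊗ h ↦ B g ⊗ h + g ⊗ T h`. -/
def algTensorSum (B : E →ₗ.[ℂ] E) (T : 𝔗 →L[ℂ] 𝔗) : HTensor E 𝔗 →ₗ.[ℂ] HTensor E 𝔗 where
  domain := LinearMap.range (domTensorIncl (𝔗 := 𝔗) B)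
  toFun :=
    (UniformSpace.Completion.toComplL.toLinearMap ∘ₗ
        (B.toFun.rTensor 𝔗 + TensorProduct.map B.domain.subtype T.toLinearMap)) ∘ₗ
      (LinearEquiv.ofInjective (domTensorIncl (𝔗 := 𝔗) B)
        (domTensorIncl_injective B)).symm.toLinearMap

/-- `B ⊗ I + I ⊗ T`: the closure of `B ⊙ I + I ⊙ T`. -/
def tensorSum (B : E →ₗ.[ℂ] E) (T : 𝔗 →L[ℂ] 𝔗) : HTensor E 𝔗 →ₗ.[ℂ] HTensor E 𝔗 :=
  (algTensorSum B T).closure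

end TensorSum

/-! ## Boundary triplets, gamma fields and Weyl functions -/

section Triplet

variable {E 𝓗 : Type*} [NormedAddCommGroup E] [InnerProductSpace ℂ E] [CompleteSpace E]
  [NormedAddCommGroup 𝓗] [InnerProductSpace ℂ 𝓗] [CompleteSpace 𝓗]

set_option linter.unusedSectionVars false

/-- A boundary triplet `{𝓗, Γ₀, Γ₁}` for `S*`, where `S` is a densely defined symmetric operator.
(Mathlib's inner product is linear in its second variable; Green's identity is unaffected by the
choice of convention.) -/
structure BoundaryTriplet (S : E →ₗ.[ℂ] E) (𝓗 : Type*) [NormedAddCommGroup 𝓗]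
    [InnerProductSpace ℂ 𝓗] where
  dense : Dense (S.domain : Set E)
  symm : S.IsFormalAdjoint S
  Γ₀ : E →ₗ.[ℂ] 𝓗
  Γ₁ : E →ₗ.[ℂ] 𝓗
  dom₀ : Γ₀.domain = S.adjoint.domain
  dom₁ : Γ₁.domain = S.adjoint.domain
  green : ∀ f g : S.adjoint.domain,
    ⟪S.adjoint f, (g : E)⟫_ℂ - ⟪(f : E), S.adjoint g⟫_ℂ
      = ⟪Γ₁ ⟨f, dom₁.ge f.2⟩, Γ₀ ⟨g, dom₀.ge g.2⟩⟫_ℂ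
        - ⟪Γ₀ ⟨f, dom₀.ge f.2⟩, Γ₁ ⟨g, dom₁.ge g.2⟩⟫_ℂ
  surj : ∀ h₀ h₁ : 𝓗, ∃ f : S.adjoint.domain,
    Γ₀ ⟨f, dom₀.ge f.2⟩ = h₀ ∧ Γ₁ ⟨f, dom₁.ge f.2⟩ = h₁

/-- The defect subspace `𝔑_z = ker (S* - z)`. -/
def defect (S : E →ₗ.[ℂ] E) (z : ℂ) : Submodule ℂ E :=
  S.adjoint.graph.comap (LinearMap.id.prod (z • LinearMap.id))

theorem mem_defect {S : E →ₗ.[ℂ] E} {z : ℂ} {f : E} :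
    f ∈ defect S z ↔ (f, z • f) ∈ S.adjoint.graph := Iff.rfl

/-- The restriction `B ↾ ker Γ` of an operator `B` to the kernel of a (partial) linear map `Γ`. -/
def kerRestrict (B : E →ₗ.[ℂ] E) (Γ : E →ₗ.[ℂ] 𝓗) : E →ₗ.[ℂ] E :=
  B.domRestrict ((LinearMap.ker Γ.toFun).map Γ.domain.subtype)

/-- The space `𝔥₊(B)`: the domain of `B` with the graph norm `(‖f‖² + ‖B f‖²) ^ (1/2)`, realized
as the graph of `B` in the Hilbert space `E ⊕ E`. -/
def graphSpace (B : E →ₗ.[ℂ] E) : Submodule ℂ (WithLp 2 (E × E)) :=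
  B.graph.comap (WithLp.linearEquiv 2 ℂ (E × E)).toLinearMap

theorem mem_graphSpace {B : E →ₗ.[ℂ] E} {p : WithLp 2 (E × E)} :
    p ∈ graphSpace B ↔ (p.fst, p.snd) ∈ B.graph := Iff.rfl

/-- The embedding `J : 𝔥₊(B) → E`. -/
def graphEmb (B : E →ₗ.[ℂ] E) : graphSpace B →L[ℂ] E :=
  (WithLp.fstL 2 ℂ E E).comp (graphSpace B).subtypeL

theorem graphEmb_apply (B : E →ₗ.[ℂ] E) (p : graphSpace B) : graphEmb B p = p.1.fst := rfl

theorem graphEmb_injective (B : E →ₗ.[ℂ] E) : Function.Injective (graphEmb B) := by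
  rw [injective_iff_map_eq_zero]
  rintro ⟨p, hp⟩ h
  rw [graphEmb_apply] at h
  change p.fst = 0 at h
  have h2 : p.snd = 0 := LinearPMap.graph_fst_eq_zero_snd B (mem_graphSpace.1 hp) h
  exact Subtype.ext (WithLp.ofLp_injective 2 (Prod.ext h h2))

theorem graphEmb_mem (B : E →ₗ.[ℂ] E) (p : graphSpace B) : graphEmb B p ∈ B.domain :=
  LinearPMap.mem_domain_of_mem_graph (mem_graphSpace.1 p.2)

theorem graphSpace_apply (B : E →ₗ.[ℂ] E) (p : graphSpace B) :
    B ⟨graphEmb B p, graphEmb_mem B p⟩ = p.1.snd :=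
  ((LinearPMap.image_iff (graphEmb_mem B p)).2 p.2).symm

/-- A linear map `Γ` on `dom B`, regarded as a map `Γ ∘ J` on `𝔥₊(B)`. -/
def hatMap (B : E →ₗ.[ℂ] E) (Γ : E →ₗ.[ℂ] 𝓗) (hΓ : Γ.domain = B.domain) :
    graphSpace B →ₗ[ℂ] 𝓗 :=
  Γ.toFun ∘ₗ LinearMap.codRestrict Γ.domain (graphEmb B).toLinearMap
    (fun p => hΓ.ge (graphEmb_mem B p))

theorem hatMap_mem {B : E →ₗ.[ℂ] E} {Γ : E →ₗ.[ℂ] 𝓗} (hΓ : Γ.domain = B.domain)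
    (p : graphSpace B) : (graphEmb B p, hatMap B Γ hΓ p) ∈ Γ.graph :=
  LinearPMap.mem_graph Γ ⟨graphEmb B p, hΓ.ge (graphEmb_mem B p)⟩

theorem isClosed_graphSpace_adjoint {S : E →ₗ.[ℂ] E} (hS : Dense (S.domain : Set E)) :
    IsClosed (graphSpace S.adjoint : Set (WithLp 2 (E × E))) :=
  IsClosed.preimage (WithLp.prod_continuous_ofLp 2 E E) (LinearPMap.adjoint_isClosed hS)

theorem exists_bounded_inverse {V W : Type*} [NormedAddCommGroup V] [NormedSpace ℂ V]
    [CompleteSpace V] [NormedAddCommGroup W] [NormedSpace ℂ W] [CompleteSpace W]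
    {N : Submodule ℂ V} (hN : IsClosed (N : Set V)) (Q : V →L[ℂ] W)
    (hinj : ∀ v ∈ N, Q v = 0 → v = 0) (hsurj : ∀ w, ∃ v ∈ N, Q v = w) :
    ∃ G : W →L[ℂ] V, ∀ w v, G w = v ↔ v ∈ N ∧ Q v = w := by
  have : CompleteSpace N := hN.completeSpace_coe
  have hk : LinearMap.ker (Q.comp N.subtypeL).toLinearMap = ⊥ := by
    rw [Submodule.eq_bot_iff]
    exact fun v hv => Subtype.ext (hinj v.1 v.2 hv)
  have hr : LinearMap.range (Q.comp N.subtypeL).toLinearMap = ⊤ := by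
    rw [LinearMap.range_eq_top]
    intro w
    obtain ⟨v, hv, h⟩ := hsurj w
    exact ⟨⟨v, hv⟩, h⟩
  let e := ContinuousLinearEquiv.ofBijective (Q.comp N.subtypeL) hk hr
  have he : ∀ p : N, e p = Q p.1 := fun p => rfl
  refine ⟨N.subtypeL.comp e.symm.toContinuousLinearMap, fun w v => ?_⟩
  constructor
  · rintro rfl
    exact ⟨(e.symm w).2, (he _).symm.trans (e.apply_symm_apply w)⟩
  · rintro ⟨hv, h⟩
    have : e.symm w = ⟨v, hv⟩ := by rw [e.symm_apply_eq, he, h]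
    exact congrArg Subtype.val this

namespace BoundaryTriplet

variable {S : E →ₗ.[ℂ] E} (P : BoundaryTriplet S 𝓗)

theorem completeSpace_graphSpace (P : BoundaryTriplet S 𝓗) : CompleteSpace (graphSpace S.adjoint) :=
  (isClosed_graphSpace_adjoint P.dense).completeSpace_coe

/-- `Γ₀ ∘ J` as a linear map on `𝔥₊(S*)`. -/
def pre₀ : graphSpace S.adjoint →ₗ[ℂ] 𝓗 := hatMap S.adjoint P.Γ₀ P.dom₀

/-- `Γ₁ ∘ J` as a linear map on `𝔥₊(S*)`. -/
def pre₁ : graphSpace S.adjoint →ₗ[ℂ] 𝓗 := hatMap S.adjoint P.Γ₁ P.dom₁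

theorem green_pre (p q : graphSpace S.adjoint) :
    ⟪p.1.snd, q.1.fst⟫_ℂ - ⟪p.1.fst, q.1.snd⟫_ℂ
      = ⟪P.pre₁ p, P.pre₀ q⟫_ℂ - ⟪P.pre₀ p, P.pre₁ q⟫_ℂ := by
  have := P.green ⟨graphEmb _ p, graphEmb_mem _ p⟩ ⟨graphEmb _ q, graphEmb_mem _ q⟩
  rw [graphSpace_apply, graphSpace_apply] at this
  exact this

theorem surj_pre (h₀ h₁ : 𝓗) : ∃ p, P.pre₀ p = h₀ ∧ P.pre₁ p = h₁ := by
  obtain ⟨f, hf⟩ := P.surj h₀ h₁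
  exact ⟨⟨WithLp.toLp 2 ((f : E), S.adjoint f), LinearPMap.mem_graph S.adjoint f⟩, hf⟩

theorem continuous_pre : Continuous (P.pre₀.prod P.pre₁) := by
  have := P.completeSpace_graphSpace
  refine LinearMap.continuous_of_seq_closed_graph _ fun u p y hu hy => ?_
  have hy0 : Filter.Tendsto (fun n => P.pre₀ (u n)) .atTop (nhds y.1) :=
    (continuous_fst.tendsto y).comp hy
  have hy1 : Filter.Tendsto (fun n => P.pre₁ (u n)) .atTop (nhds y.2) :=
    (continuous_snd.tendsto y).comp hy
  have hu0 : Filter.Tendsto (fun n => (u n).1.fst) .atTop (nhds p.1.fst) :=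
    ((WithLp.fstL 2 ℂ E E).continuous.comp continuous_subtype_val).tendsto p |>.comp hu
  have hu1 : Filter.Tendsto (fun n => (u n).1.snd) .atTop (nhds p.1.snd) :=
    ((WithLp.sndL 2 ℂ E E).continuous.comp continuous_subtype_val).tendsto p |>.comp hu
  have key : ∀ q, ⟪y.2, P.pre₀ q⟫_ℂ - ⟪y.1, P.pre₁ q⟫_ℂ
      = ⟪P.pre₁ p, P.pre₀ q⟫_ℂ - ⟪P.pre₀ p, P.pre₁ q⟫_ℂ := by
    intro q
    rw [← P.green_pre]
    refine tendsto_nhds_unique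
      ((hy1.inner tendsto_const_nhds).sub (hy0.inner tendsto_const_nhds)) ?_
    simp_rw [← P.green_pre]
    exact (hu1.inner tendsto_const_nhds).sub (hu0.inner tendsto_const_nhds)
  refine Prod.ext (ext_inner_right ℂ fun v => ?_) (ext_inner_right ℂ fun v => ?_)
  · obtain ⟨q, h0, h1⟩ := P.surj_pre 0 v
    have := key q
    rw [h0, h1] at this
    simpa using this
  · obtain ⟨q, h0, h1⟩ := P.surj_pre v 0
    have := key q
    rw [h0, h1] at this
    simpa using this

/-- The bounded operator `Γ̂₀ = Γ₀ J : 𝔥₊(S*) → 𝓗`. -/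
def hat₀ : graphSpace S.adjoint →L[ℂ] 𝓗 where
  toLinearMap := P.pre₀
  cont := continuous_fst.comp P.continuous_pre

/-- The bounded operator `Γ̂₁ = Γ₁ J : 𝔥₊(S*) → 𝓗`. -/
def hat₁ : graphSpace S.adjoint →L[ℂ] 𝓗 where
  toLinearMap := P.pre₁
  cont := continuous_snd.comp P.continuous_pre

/-- `G = (Γ₀ ↾ 𝔑_z)⁻¹`, everywhere defined and bounded. -/
def IsGamma (z : ℂ) (G : 𝓗 →L[ℂ] E) : Prop :=
  ∀ (h : 𝓗) (f : E), G h = f ↔ f ∈ defect S z ∧ (f, h) ∈ P.Γ₀.graph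

theorem defect_ker {z : ℂ} (hz : z.im ≠ 0) {p : graphSpace S.adjoint}
    (hp : p.1.snd = z • p.1.fst) (h0 : P.pre₀ p = 0) : p.1.fst = 0 := by
  have := P.green_pre p p
  rw [h0, hp, inner_smul_left, inner_smul_right] at this
  simp only [inner_zero_left, inner_zero_right, sub_zero] at this
  rw [← sub_mul] at this
  rcases mul_eq_zero.1 this with h | h
  · exfalso
    have := congrArg Complex.im h
    simp at this
    apply hz
    linarith
  · exact inner_self_eq_zero.1 h

/-- For `g ∈ dom S`, the pair `(g, S g)` belongs to the graph of `S*` and `Γ₀ g = 0`. -/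
theorem exists_of_mem_domain (x : S.domain) :
    ∃ p : graphSpace S.adjoint, p.1.fst = x ∧ p.1.snd = S x ∧ P.pre₀ p = 0 := by
  have hle := P.symm.le_adjoint P.dense
  have hg : ((x : E), S x) ∈ S.adjoint.graph := LinearPMap.le_graph_of_le hle (S.mem_graph x)
  refine ⟨⟨WithLp.toLp 2 ((x : E), S x), hg⟩, rfl, rfl, ?_⟩
  set p : graphSpace S.adjoint := ⟨WithLp.toLp 2 ((x : E), S x), hg⟩
  obtain ⟨q, h0, h1⟩ := P.surj_pre 0 (P.pre₀ p)
  have h := P.green_pre p q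
  have hadj : ⟪p.1.snd, q.1.fst⟫_ℂ = ⟪p.1.fst, q.1.snd⟫_ℂ := by
    have h3 := LinearPMap.adjoint_isFormalAdjoint P.dense ⟨graphEmb _ q, graphEmb_mem _ q⟩ x
    rw [graphSpace_apply] at h3
    have h4 := congrArg (starRingEnd ℂ) h3
    rw [inner_conj_symm, inner_conj_symm] at h4
    exact h4.symm
  rw [hadj, sub_self, h0, h1, inner_zero_right, zero_sub, eq_comm, neg_eq_zero] at h
  exact inner_self_eq_zero.1 h

/-- `ran (S₀ - z)` is the whole space for nonreal `z`, where `S₀ = S* ↾ ker Γ₀`. -/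
theorem range_eq_top {z : ℂ} (hz : z.im ≠ 0) (e : E) :
    ∃ p : graphSpace S.adjoint, P.pre₀ p = 0 ∧ p.1.snd - z • p.1.fst = e := by
  have := P.completeSpace_graphSpace
  let K : Submodule ℂ (graphSpace S.adjoint) := LinearMap.ker P.hat₀.toLinearMap
  have hK : IsClosed (K : Set (graphSpace S.adjoint)) := P.hat₀.isClosed_ker
  have : CompleteSpace K := hK.completeSpace_coe
  let D : K →L[ℂ] E := ((WithLp.sndL 2 ℂ E E) - z • (WithLp.fstL 2 ℂ E E)).comp
    ((graphSpace S.adjoint).subtypeL.comp K.subtypeL)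
  have hD : ∀ p : K, D p = p.1.1.snd - z • p.1.1.fst := fun p => rfl
  have hK0 : ∀ p : K, P.pre₀ p.1 = 0 := fun p => p.2
  have hb1 : ∀ p : K, |z.im| * ‖p.1.1.fst‖ ≤ ‖D p‖ := by
    intro p
    have hs := P.green_pre p.1 p.1
    rw [hK0, inner_zero_left, inner_zero_right, sub_zero, sub_eq_zero] at hs
    have hre : (⟪p.1.1.fst, p.1.1.snd⟫_ℂ).im = 0 := by
      have h4 : starRingEnd ℂ ⟪p.1.1.fst, p.1.1.snd⟫_ℂ = ⟪p.1.1.fst, p.1.1.snd⟫_ℂ := by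
        rw [inner_conj_symm]; exact hs
      exact Complex.conj_eq_iff_im.1 h4
    have h5 : (⟪p.1.1.fst, D p⟫_ℂ).im = - (z.im * ‖p.1.1.fst‖ ^ 2) := by
      rw [hD, inner_sub_right, inner_smul_right, Complex.sub_im, hre,
        inner_self_eq_norm_sq_to_K, zero_sub]
      congr 1
      rw [← RCLike.ofReal_pow]
      exact Complex.im_mul_ofReal _ _
    have h6 : |z.im| * ‖p.1.1.fst‖ ^ 2 ≤ ‖p.1.1.fst‖ * ‖D p‖ := by
      have h7 := (Complex.abs_im_le_norm _).trans (norm_inner_le_norm (𝕜 := ℂ) p.1.1.fst (D p))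
      rw [h5, abs_neg, abs_mul, abs_of_nonneg (sq_nonneg ‖p.1.1.fst‖)] at h7
      exact h7
    rcases (norm_nonneg p.1.1.fst).eq_or_lt with h0 | h0
    · rw [← h0, mul_zero]; exact norm_nonneg _
    · nlinarith
  have hzpos : 0 < |z.im| := abs_pos.2 hz
  have hb2 : ∀ p : K, ‖p‖ ≤ ((1 + ‖z‖) / |z.im| + 1) * ‖D p‖ := by
    intro p
    have h1 : ‖p.1.1.fst‖ ≤ ‖D p‖ / |z.im| := by
      rw [le_div_iff₀ hzpos, mul_comm]; exact hb1 p
    have h2 : ‖p.1.1.snd‖ ≤ ‖D p‖ + ‖z‖ * ‖p.1.1.fst‖ := by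
      have : p.1.1.snd = D p + z • p.1.1.fst := by rw [hD]; abel
      rw [this, ← norm_smul]; exact norm_add_le _ _
    have h3 : ‖p‖ ≤ ‖p.1.1.fst‖ + ‖p.1.1.snd‖ := by
      change ‖p.1.1‖ ≤ _
      rw [WithLp.prod_norm_eq_of_L2]
      refine Real.sqrt_le_iff.2 ⟨by positivity, ?_⟩
      nlinarith [norm_nonneg p.1.1.fst, norm_nonneg p.1.1.snd]
    have h4 : ‖z‖ * ‖p.1.1.fst‖ ≤ ‖z‖ * (‖D p‖ / |z.im|) := by gcongr
    calc ‖p‖ ≤ ‖D p‖ / |z.im| + (‖D p‖ + ‖z‖ * (‖D p‖ / |z.im|)) := by linarith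
      _ = _ := by field_simp; ring
  have hcl : IsClosed (Set.range D) := by
    have : AntilipschitzWith ⟨(1 + ‖z‖) / |z.im| + 1, by positivity⟩ D :=
      AddMonoidHomClass.antilipschitz_of_bound D hb2
    exact this.isClosed_range D.uniformContinuous
  have horth : (LinearMap.range D.toLinearMap).topologicalClosure = ⊤ := by
    rw [Submodule.topologicalClosure_eq_top_iff, Submodule.eq_bot_iff]
    intro g hg
    have hg' : ∀ p : K, ⟪g, D p⟫_ℂ = 0 := fun p =>
      (Submodule.mem_orthogonal' _ _).1 hg _ ⟨p, rfl⟩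
    have hS : ∀ x : S.domain, ⟪(starRingEnd ℂ z) • g, (x : E)⟫_ℂ = ⟪g, S x⟫_ℂ := by
      intro x
      obtain ⟨p, h1, h2, h3⟩ := P.exists_of_mem_domain x
      have := hg' ⟨p, h3⟩
      rw [hD, h1, h2, inner_sub_right, inner_smul_right, sub_eq_zero] at this
      rw [this, inner_smul_left, Complex.conj_conj]
    have hdom : g ∈ S.adjoint.domain := LinearPMap.mem_adjoint_domain_of_exists g ⟨_, hS⟩
    have hval : S.adjoint ⟨g, hdom⟩ = (starRingEnd ℂ z) • g :=
      LinearPMap.adjoint_apply_eq P.dense ⟨g, hdom⟩ hS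
    let q : graphSpace S.adjoint :=
      ⟨WithLp.toLp 2 (g, S.adjoint ⟨g, hdom⟩), LinearPMap.mem_graph S.adjoint ⟨g, hdom⟩⟩
    have hq : q.1.snd = (starRingEnd ℂ z) • q.1.fst := hval
    have hq0 : P.pre₀ q = 0 := by
      obtain ⟨p, h0, h1⟩ := P.surj_pre 0 (P.pre₀ q)
      have hgr := P.green_pre q p
      have := hg' ⟨p, h0⟩
      rw [hD, inner_sub_right, inner_smul_right, sub_eq_zero] at this
      change ⟪q.1.fst, p.1.snd⟫_ℂ = z * ⟪q.1.fst, p.1.fst⟫_ℂ at this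
      rw [hq, this, inner_smul_left, Complex.conj_conj, sub_self, h0, h1, inner_zero_right,
        zero_sub, eq_comm, neg_eq_zero] at hgr
      exact inner_self_eq_zero.1 hgr
    exact P.defect_ker (z := starRingEnd ℂ z) (by simpa using hz) hq hq0
  have htop : (LinearMap.range D.toLinearMap : Submodule ℂ E) = ⊤ := by
    rw [← horth, eq_comm]
    exact IsClosed.submodule_topologicalClosure_eq hcl
  obtain ⟨p, hp⟩ := LinearMap.range_eq_top.1 htop e
  exact ⟨p.1, p.2, hp⟩

/-- The gamma field is well defined off the real axis. -/
theorem exists_isGamma {z : ℂ} (hz : z.im ≠ 0) : ∃ G, P.IsGamma z G := by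
  have := P.completeSpace_graphSpace
  let N : Submodule ℂ (graphSpace S.adjoint) := LinearMap.ker
    (((WithLp.sndL 2 ℂ E E) - z • (WithLp.fstL 2 ℂ E E)).comp
      (graphSpace S.adjoint).subtypeL).toLinearMap
  have hN : IsClosed (N : Set (graphSpace S.adjoint)) := ContinuousLinearMap.isClosed_ker _
  have hmem : ∀ p : graphSpace S.adjoint, p ∈ N ↔ p.1.snd = z • p.1.fst := fun p => by
    rw [← sub_eq_zero]; rfl
  obtain ⟨G, hG⟩ := exists_bounded_inverse hN P.hat₀
    (fun p hp h0 => graphEmb_injective _ <| by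
      rw [map_zero]
      exact P.defect_ker hz ((hmem p).1 hp) h0)
    (fun h => by
      obtain ⟨p, hp, -⟩ := P.surj_pre h 0
      obtain ⟨u, hu, hu'⟩ := P.range_eq_top hz (p.1.snd - z • p.1.fst)
      refine ⟨p - u, (hmem _).2 ?_, ?_⟩
      · change p.1.snd - u.1.snd = z • (p.1.fst - u.1.fst)
        rw [smul_sub, sub_eq_sub_iff_sub_eq_sub, ← hu']
      · change P.pre₀ (p - u) = h
        rw [map_sub, hp, hu, sub_zero])
  refine ⟨(graphEmb S.adjoint).comp G, fun h f => ?_⟩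
  constructor
  · rintro rfl
    obtain ⟨h1, h2⟩ := (hG h _).1 rfl
    constructor
    · have := mem_graphSpace.1 (G h).2
      rw [(hmem _).1 h1] at this
      exact this
    · have h3 := hatMap_mem P.dom₀ (G h)
      have h4 : hatMap S.adjoint P.Γ₀ P.dom₀ (G h) = h := h2
      rw [h4] at h3
      exact h3
  · rintro ⟨h1, h2⟩
    let p : graphSpace S.adjoint := ⟨WithLp.toLp 2 (f, z • f), h1⟩
    have h3 : P.hat₀ p = h := LinearPMap.mem_graph_snd_inj P.Γ₀ (hatMap_mem P.dom₀ p) h2 rfl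
    have h4 : G h = p := (hG h p).2 ⟨(hmem _).2 rfl, h3⟩
    change graphEmb S.adjoint (G h) = f
    rw [h4]
    rfl

open Classical in
/-- The gamma field `γ(z) = (Γ₀ ↾ 𝔑_z)⁻¹` (set to zero if this is not an everywhere defined bounded
operator, which does not happen for nonreal `z`). -/
def gammaField (z : ℂ) : 𝓗 →L[ℂ] E := if h : ∃ G, P.IsGamma z G then h.choose else 0

theorem isGamma_gammaField {z : ℂ} (hz : z.im ≠ 0) : P.IsGamma z (P.gammaField z) := by
  rw [gammaField, dif_pos (P.exists_isGamma hz)]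
  exact (P.exists_isGamma hz).choose_spec

/-- `M = Γ₁ γ(z)` as a bounded operator. -/
def IsWeyl (z : ℂ) (M : 𝓗 →L[ℂ] 𝓗) : Prop := ∀ h : 𝓗, (P.gammaField z h, M h) ∈ P.Γ₁.graph

theorem exists_isWeyl {z : ℂ} (hz : z.im ≠ 0) : ∃ M, P.IsWeyl z M := by
  have hG := P.isGamma_gammaField hz
  have hd : ∀ h, P.gammaField z h ∈ defect S z := fun h => ((hG h _).1 rfl).1
  let L : 𝓗 →L[ℂ] graphSpace S.adjoint :=
    ((WithLp.prodContinuousLinearEquiv 2 ℂ E E).symm.toContinuousLinearMap.comp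
      ((P.gammaField z).prod (z • P.gammaField z))).codRestrict _ (fun h => hd h)
  exact ⟨P.hat₁.comp L, fun h => hatMap_mem P.dom₁ (L h)⟩

open Classical in
/-- The Weyl function `M(z) = Γ₁ γ(z)` (with the same convention as for the gamma field). -/
def weyl (z : ℂ) : 𝓗 →L[ℂ] 𝓗 := if h : ∃ M, P.IsWeyl z M then h.choose else 0

theorem isWeyl_weyl {z : ℂ} (hz : z.im ≠ 0) : P.IsWeyl z (P.weyl z) := by
  rw [weyl, dif_pos (P.exists_isWeyl hz)]
  exact (P.exists_isWeyl hz).choose_spec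

/-- A boundary triplet is normalized if `M(i) = i I`. -/
def IsNormalized : Prop := P.weyl Complex.I = Complex.I • ContinuousLinearMap.id ℂ 𝓗

end BoundaryTriplet

/-! ### The maps `Γ ⊗̂ I` -/

variable {𝔗 : Type*} [NormedAddCommGroup 𝔗] [InnerProductSpace ℂ 𝔗]

/-- For a bounded `Γ̂ : 𝔥₊(B) → 𝓗`, the map `(Γ̂ ⊗ I) (J ⊗ I)⁻¹` with domain `ran (J ⊗ I)`. -/
def tensorExt {B : E →ₗ.[ℂ] E} (hB : Function.Injective
      (tmap (graphEmb B) (ContinuousLinearMap.id ℂ 𝔗))) (Γ : graphSpace B →L[ℂ] 𝓗) :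
    HTensor E 𝔗 →ₗ.[ℂ] HTensor 𝓗 𝔗 where
  domain := LinearMap.range (tmap (graphEmb B) (ContinuousLinearMap.id ℂ 𝔗)).toLinearMap
  toFun := (tmap Γ (ContinuousLinearMap.id ℂ 𝔗)).toLinearMap ∘ₗ
    (LinearEquiv.ofInjective _ hB).symm.toLinearMap

namespace BoundaryTriplet

variable [CompleteSpace 𝔗] {S : E →ₗ.[ℂ] E} (P : BoundaryTriplet S 𝓗)

theorem tmap_graphEmb_injective (P : BoundaryTriplet S 𝓗) : Function.Injective
    (tmap (graphEmb S.adjoint) (ContinuousLinearMap.id ℂ 𝔗)) :=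
  have := P.completeSpace_graphSpace
  tmap_id_injective (graphEmb_injective _)

variable (𝔗) in
/-- `Γ₀ ⊗̂ I = (Γ̂₀ ⊗ I) (J ⊗ I)⁻¹`. -/
def tensor₀ : HTensor E 𝔗 →ₗ.[ℂ] HTensor 𝓗 𝔗 := tensorExt P.tmap_graphEmb_injective P.hat₀

variable (𝔗) in
/-- `Γ₁ ⊗̂ I = (Γ̂₁ ⊗ I) (J ⊗ I)⁻¹`. -/
def tensor₁ : HTensor E 𝔗 →ₗ.[ℂ] HTensor 𝓗 𝔗 := tensorExt P.tmap_graphEmb_injective P.hat₁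

end BoundaryTriplet

end Triplet

/-! ## The spectral measure of a bounded self-adjoint operator -/

section Spectral

variable {𝔗 : Type*} [NormedAddCommGroup 𝔗] [InnerProductSpace ℂ 𝔗] [CompleteSpace 𝔗]

/-- The vectors `x` whose spectral support with respect to `T` lies in the closed set `K`:
`f(T) x = 0` for every continuous `f` vanishing on `K`. This is the range of `1_K(T)`. -/
def spectralVectors (T : 𝔗 →L[ℂ] 𝔗) (K : Set ℝ) : Submodule ℂ 𝔗 :=
  ⨅ f ∈ {f : ℝ → ℝ | Continuous f ∧ ∀ t ∈ K, f t = 0}, LinearMap.ker (cfc f T).toLinearMap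

/-- The range of `1_δ(T)` for a Borel set `δ`: by inner regularity, it is the closed span of the
ranges of `1_K(T)` for the closed sets `K ⊆ δ`. -/
def spectralSubspace (T : 𝔗 →L[ℂ] 𝔗) (δ : Set ℝ) : Submodule ℂ 𝔗 :=
  (⨆ K ∈ {K : Set ℝ | IsClosed K ∧ K ⊆ δ}, spectralVectors T K).topologicalClosure

/-- The spectral measure `E_T(δ) = 1_δ(T)` of a bounded self-adjoint operator `T`, for Borel sets
`δ`: the orthogonal projection onto the spectral subspace of `δ`. -/
def spectralMeasure (T : 𝔗 →L[ℂ] 𝔗) (δ : Set ℝ) : 𝔗 →L[ℂ] 𝔗 :=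
  have : CompleteSpace (spectralSubspace T δ) :=
    (Submodule.isClosed_topologicalClosure _).completeSpace_coe
  (spectralSubspace T δ).starProjection

end Spectral

/-! ## Operator-spectral integrals -/

section Integral

/-- A partition `a = λ₀ ≤ λ₁ ≤ … ≤ λₙ₊₁ = b` of `[a, b]` into the cells
`[λ₀, λ₁), …, [λₙ₋₁, λₙ), [λₙ, b]`, with a point chosen in each cell. -/
structure TaggedPartition (a b : ℝ) where
  n : ℕ
  pt : Fin (n + 2) → ℝ
  mono : Monotone pt
  first : pt 0 = a
  last : pt (Fin.last _) = b
  tag : Fin (n + 1) → ℝ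
  tag_mem : ∀ m, tag m ∈ if m = Fin.last n then Set.Icc (pt m.castSucc) (pt m.succ)
    else Set.Ico (pt m.castSucc) (pt m.succ)

namespace TaggedPartition

variable {a b : ℝ}

/-- The cells of the partition. -/
def cell (Z : TaggedPartition a b) (m : Fin (Z.n + 1)) : Set ℝ :=
  if m = Fin.last Z.n then Set.Icc (Z.pt m.castSucc) (Z.pt m.succ)
  else Set.Ico (Z.pt m.castSucc) (Z.pt m.succ)

/-- All cells have length less than `δ`. -/
def FinerThan (Z : TaggedPartition a b) (δ : ℝ) : Prop :=
  ∀ m : Fin (Z.n + 1), Z.pt m.succ - Z.pt m.castSucc < δ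

end TaggedPartition

variable {H H₁ : Type*} [NormedAddCommGroup H] [InnerProductSpace ℂ H]
  [NormedAddCommGroup H₁] [InnerProductSpace ℂ H₁]

/-- `∫_{[a,b]} Ω(λ) F(dλ) = G`: the Riemann-Stieltjes sums `∑ Ω(x_m) F(Δ_m)` converge to `G` in
operator norm as the mesh of the partition tends to zero. -/
def HasIntegralRight (a b : ℝ) (Ω : ℝ → H →L[ℂ] H₁) (F : Set ℝ → H →L[ℂ] H)
    (G : H →L[ℂ] H₁) : Prop :=
  ∀ ε > 0, ∃ δ > 0, ∀ Z : TaggedPartition a b, Z.FinerThan δ →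
    ‖∑ m, (Ω (Z.tag m)).comp (F (Z.cell m)) - G‖ < ε

/-- `∫_{[a,b]} F(dλ) Ω(λ) = G`: the Riemann-Stieltjes sums `∑ F(Δ_m) Ω(x_m)` converge to `G` in
operator norm as the mesh of the partition tends to zero. -/
def HasIntegralLeft (a b : ℝ) (F : Set ℝ → H →L[ℂ] H) (Ω : ℝ → H₁ →L[ℂ] H)
    (G : H₁ →L[ℂ] H) : Prop :=
  ∀ ε > 0, ∃ δ > 0, ∀ Z : TaggedPartition a b, Z.FinerThan δ →
    ‖∑ m, (F (Z.cell m)).comp (Ω (Z.tag m)) - G‖ < ε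

end Integral

/-! ## Ingredients of the formulas -/

section Ingredients

variable {𝓗 : Type*} [NormedAddCommGroup 𝓗] [InnerProductSpace ℂ 𝓗] [CompleteSpace 𝓗]

/-- `Re M = (M + M*) / 2`. -/
def reOp (M : 𝓗 →L[ℂ] 𝓗) : 𝓗 →L[ℂ] 𝓗 := (realPart M : 𝓗 →L[ℂ] 𝓗)

/-- `Im M = (M - M*) / (2i)`. -/
def imOp (M : 𝓗 →L[ℂ] 𝓗) : 𝓗 →L[ℂ] 𝓗 := (imaginaryPart M : 𝓗 →L[ℂ] 𝓗)

/-- `√(Im M)`. -/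
def sqrtIm (M : 𝓗 →L[ℂ] 𝓗) : 𝓗 →L[ℂ] 𝓗 := CFC.sqrt (imOp M)

/-- `1 / √(Im M)`. -/
def invSqrtIm (M : 𝓗 →L[ℂ] 𝓗) : 𝓗 →L[ℂ] 𝓗 := Ring.inverse (sqrtIm M)

/-- `L(z, ζ) = (Im M(ζ))^(-1/2) (M(z) - Re M(ζ)) (Im M(ζ))^(-1/2)`. -/
def Lfun (M : ℂ → 𝓗 →L[ℂ] 𝓗) (z ζ : ℂ) : 𝓗 →L[ℂ] 𝓗 :=
  invSqrtIm (M ζ) * (M z - reOp (M ζ)) * invSqrtIm (M ζ)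

/-- Scalar Nevanlinna functions (the class `R[ℂ]`). -/
structure IsNevanlinna (m : ℂ → ℂ) : Prop where
  holo : DifferentiableOn ℂ m {z | z.im ≠ 0}
  conj : ∀ z : ℂ, z.im ≠ 0 → m (starRingEnd ℂ z) = starRingEnd ℂ (m z)
  nonneg : ∀ z : ℂ, z.im ≠ 0 → 0 ≤ (m z).im / z.im

/-- `M(z) = m(z) I` off the real axis, with a scalar Nevanlinna function `m`. -/
def IsScalarType (M : ℂ → 𝓗 →L[ℂ] 𝓗) (m : ℂ → ℂ) : Prop :=
  IsNevanlinna m ∧ ∀ z : ℂ, z.im ≠ 0 → M z = m z • ContinuousLinearMap.id ℂ 𝓗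

end Ingredients

end BT

end

/-!
The proof rests on a calculus for the operator-spectral integrals
`∫ Ω(λ) ⊗ E_T(dλ) = lim ∑ Ω(x_m) ⊗ E_T(Δ_m)` (`specInt`). For continuous `Ω` the limit exists in
operator norm (`tendsto_stepSum`): the projections `E_T(Δ_m)` form a resolution of the identity, so
the difference of two such sums has norm at most the oscillation of `Ω` on the cells. Since
`(I ⊗ E_T(δ)) (Ω(λ) ⊗ I) = Ω(λ) ⊗ E_T(δ) = (Ω(λ) ⊗ I) (I ⊗ E_T(δ))`, the left and right integrals
agree. The map `Ω ↦ ∫ Ω(λ) ⊗ E_T(dλ)` is linear and multiplicative and respects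
adjoints, because the `E_T(Δ_m)` are mutually orthogonal projections; it therefore respects real and
imaginary parts, positivity, positive square roots and inverses. Moreover
`∫ F(λ) B ⊗ E_T(dλ) = B ⊗ F(T)`.

The spectral projections are only given through the continuous functional calculus of `T`. The facts
needed about them are orthogonality for disjoint sets, commutation, additivity over the half-open
cells, and the estimate `‖f(T) x - c x‖ ≤ ε ‖x‖` on the range of `E_T(δ)` if `|f - c| ≤ ε` on `δ`.
They follow from Urysohn functions and truncation.

The graph of `S*` is parametrized by `𝔥₊(A*) ⊗ 𝔗`: it consists of the pairs
`((J ⊗ I) q, (V ⊗ I) q + (I ⊗ T) (J ⊗ I) q)`, where `J` and `V` are the two coordinates of the graph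
of `A*` (`mem_graph_adjoint_tensorSum`). The reason is that a pair orthogonal to all pairs
`(-A g ⊗ h, g ⊗ h)` is fixed by `p ⊗ I`, with `p` the orthogonal projection of `E ⊕ E` onto the
graph of `A*`. Since the contributions of the bounded self-adjoint operator `I ⊗ T` cancel in
Green's identity, `Π_A ⊗̂ I` is a boundary triplet for `S*`; surjectivity and the description of
`ker (Γ₀ ⊗̂ I)` use a bounded right inverse of `(Γ₀, Γ₁)` from `𝓗 ⊕ 𝓗` to `𝔥₊(A*)`.

For fixed `λ`, the vector `γ(z - λ) k` solves `A* f = (z - λ) f`. Hence `∫ γ(z - λ) ⊗ E_T(dλ)` maps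
into the defect subspace of `S` at `z`, and it is the gamma field of `Π_S`, with the Weyl function
`∫ M(z - λ) ⊗ E_T(dλ)` (`tensor_gammaField_weyl`). The gamma field and the Weyl function of the
triplet with the maps `R Γ₀` and `R⁻¹ (Γ₁ - Q Γ₀)` are `γ(z) R⁻¹` and `R⁻¹ (M(z) - Q) R⁻¹`; the
integral calculus turns these into the stated formulas.
-/

open scoped TensorProduct InnerProductSpace

noncomputable section

namespace BT

/-! ### Calculus of the operators `f ⊗ g` -/

section TensorCalculus

variable {E F G H K L : Type*}
  [NormedAddCommGroup E] [InnerProductSpace ℂ E] [NormedAddCommGroup F] [InnerProductSpace ℂ F]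
  [NormedAddCommGroup G] [InnerProductSpace ℂ G] [NormedAddCommGroup H] [InnerProductSpace ℂ H]
  [NormedAddCommGroup K] [InnerProductSpace ℂ K] [NormedAddCommGroup L] [InnerProductSpace ℂ L]

theorem elem_add_left (x x' : E) (y : F) : elem (x + x') y = elem x y + elem x' y := by
  simp [elem, TensorProduct.add_tmul, UniformSpace.Completion.coe_add]

theorem elem_add_right (x : E) (y y' : F) : elem x (y + y') = elem x y + elem x y' := by
  simp [elem, TensorProduct.tmul_add, UniformSpace.Completion.coe_add]

theorem elem_smul_left (c : ℂ) (x : E) (y : F) : elem (c • x) y = c • elem x y := by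
  simp only [elem, ← TensorProduct.smul_tmul', UniformSpace.Completion.coe_smul]

theorem elem_smul_right (c : ℂ) (x : E) (y : F) : elem x (c • y) = c • elem x y := by
  simp only [elem, TensorProduct.tmul_smul, UniformSpace.Completion.coe_smul]

theorem continuous_elem : Continuous fun p : E × F => elem p.1 p.2 :=
  (UniformSpace.Completion.continuous_coe _).comp (TensorProduct.continuous_tmul (𝕜 := ℂ))

/-- A closed property of vectors of the tensor product that is stable under sums holds for all
vectors once it holds for the elementary tensors. -/
theorem HTensor.induction {p : HTensor E F → Prop} (hc : IsClosed {u | p u})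
    (helem : ∀ x y, p (elem x y)) (hadd : ∀ u v, p u → p v → p (u + v)) (u : HTensor E F) :
    p u := by
  induction u using UniformSpace.Completion.induction_on with
  | hp => exact hc
  | ih a =>
    induction a with
    | zero => simpa [elem] using helem 0 0
    | tmul x y => exact helem x y
    | add a b ha hb => rw [UniformSpace.Completion.coe_add]; exact hadd _ _ ha hb

theorem HTensor.clm_ext {X : Type*} [NormedAddCommGroup X] [NormedSpace ℂ X]
    {f g : HTensor E F →L[ℂ] X} (h : ∀ x y, f (elem x y) = g (elem x y)) : f = g := by
  ext u
  refine HTensor.induction (p := fun u => f u = g u)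
    (isClosed_eq f.continuous g.continuous) h (fun u v hu hv => ?_) u
  rw [map_add, map_add, hu, hv]

theorem tmap_comp (f : F →L[ℂ] K) (f' : E →L[ℂ] F) (g : H →L[ℂ] L) (g' : G →L[ℂ] H) :
    (tmap f g).comp (tmap f' g') = tmap (f.comp f') (g.comp g') :=
  HTensor.clm_ext fun x y => by simp [tmap_elem]

theorem tmap_tmap (f : F →L[ℂ] K) (f' : E →L[ℂ] F) (g : H →L[ℂ] L) (g' : G →L[ℂ] H)
    (u : HTensor E G) : tmap f g (tmap f' g' u) = tmap (f.comp f') (g.comp g') u := by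
  rw [← tmap_comp]; rfl

theorem tmap_id_id : tmap (.id ℂ E) (.id ℂ F) = .id ℂ (HTensor E F) :=
  HTensor.clm_ext fun x y => by simp [tmap_elem]

theorem tmap_add_left (f f' : E →L[ℂ] F) (g : G →L[ℂ] H) :
    tmap (f + f') g = tmap f g + tmap f' g :=
  HTensor.clm_ext fun x y => by simp [tmap_elem, elem_add_left]

theorem tmap_add_right (f : E →L[ℂ] F) (g g' : G →L[ℂ] H) :
    tmap f (g + g') = tmap f g + tmap f g' :=
  HTensor.clm_ext fun x y => by simp [tmap_elem, elem_add_right]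

theorem tmap_smul_left (c : ℂ) (f : E →L[ℂ] F) (g : G →L[ℂ] H) :
    tmap (c • f) g = c • tmap f g :=
  HTensor.clm_ext fun x y => by simp [tmap_elem, elem_smul_left]

theorem tmap_smul_right (c : ℂ) (f : E →L[ℂ] F) (g : G →L[ℂ] H) :
    tmap f (c • g) = c • tmap f g :=
  HTensor.clm_ext fun x y => by simp [tmap_elem, elem_smul_right]

/-- `f ⊗ g` as a linear function of `f`. -/
def tmapLeft (g : G →L[ℂ] H) : (E →L[ℂ] F) →ₗ[ℂ] (HTensor E G →L[ℂ] HTensor F H) where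
  toFun f := tmap f g
  map_add' f f' := tmap_add_left f f' g
  map_smul' c f := tmap_smul_left c f g

/-- `f ⊗ g` as a linear function of `g`. -/
def tmapRight (f : E →L[ℂ] F) : (G →L[ℂ] H) →ₗ[ℂ] (HTensor E G →L[ℂ] HTensor F H) where
  toFun g := tmap f g
  map_add' g g' := tmap_add_right f g g'
  map_smul' c g := tmap_smul_right c f g

theorem tmap_zero_left (g : G →L[ℂ] H) : tmap (0 : E →L[ℂ] F) g = 0 := map_zero (tmapLeft g)

theorem tmap_zero_right (f : E →L[ℂ] F) : tmap f (0 : G →L[ℂ] H) = 0 := map_zero (tmapRight f)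

theorem tmap_sub_left (f f' : E →L[ℂ] F) (g : G →L[ℂ] H) :
    tmap (f - f') g = tmap f g - tmap f' g := map_sub (tmapLeft g) f f'

theorem tmap_sum_right {ι : Type*} (s : Finset ι) (f : E →L[ℂ] F) (g : ι → G →L[ℂ] H) :
    tmap f (∑ i ∈ s, g i) = ∑ i ∈ s, tmap f (g i) := map_sum (tmapRight f) g s

theorem norm_tmap_le (f : E →L[ℂ] F) (g : G →L[ℂ] H) : ‖tmap f g‖ ≤ ‖f‖ * ‖g‖ := by
  refine ContinuousLinearMap.opNorm_le_bound _ (by positivity) fun u => ?_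
  induction u using UniformSpace.Completion.induction_on with
  | hp => exact isClosed_le (by fun_prop) (by fun_prop)
  | ih a =>
    have h : tmap f g (a : HTensor E G)
        = ((TensorProduct.mapL f g a : F ⊗[ℂ] H) : HTensor F H) := by
      simp [tmap]
    rw [h, UniformSpace.Completion.norm_coe, UniformSpace.Completion.norm_coe]
    exact ContinuousLinearMap.le_of_opNorm_le _ (TensorProduct.norm_mapL_le f g) a

theorem norm_tmap_id_le (f : E →L[ℂ] F) : ‖tmap f (.id ℂ G)‖ ≤ ‖f‖ :=
  (norm_tmap_le _ _).trans
    (mul_le_of_le_one_right (norm_nonneg _) ContinuousLinearMap.norm_id_le)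

theorem adjoint_id [CompleteSpace E] : ContinuousLinearMap.adjoint (.id ℂ E) = .id ℂ E := by
  ext1 w
  refine ext_inner_left ℂ fun v => ?_
  rw [ContinuousLinearMap.adjoint_inner_right]; rfl

theorem adjoint_tmap [CompleteSpace E] [CompleteSpace F] [CompleteSpace G] [CompleteSpace H]
    (f : E →L[ℂ] F) (g : G →L[ℂ] H) :
    ContinuousLinearMap.adjoint (tmap f g)
      = tmap (ContinuousLinearMap.adjoint f) (ContinuousLinearMap.adjoint g) := by
  refine HTensor.clm_ext fun x y => ?_
  refine ext_inner_left ℂ fun u => ?_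
  rw [ContinuousLinearMap.adjoint_inner_right, inner_tmap_elem, tmap_elem]

theorem inner_tmap_left [CompleteSpace E] [CompleteSpace F] [CompleteSpace G] [CompleteSpace H]
    (f : E →L[ℂ] F) (g : G →L[ℂ] H) (u : HTensor E G) (v : HTensor F H) :
    ⟪tmap f g u, v⟫_ℂ
      = ⟪u, tmap (ContinuousLinearMap.adjoint f) (ContinuousLinearMap.adjoint g) v⟫_ℂ := by
  rw [← adjoint_tmap, ContinuousLinearMap.adjoint_inner_right]

/-- A tensor `u` is annihilated by `f ⊗ I` as soon as `u` is orthogonal to a set of elementary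
tensors whose left factors span a dense subspace of the range of `f*`. -/
theorem tmap_eq_zero_of_inner [CompleteSpace E] [CompleteSpace F] [CompleteSpace G]
    (f : E →L[ℂ] F) (u : HTensor E G) (V : Submodule ℂ E)
    (hV : ∀ x, ContinuousLinearMap.adjoint f x ∈ V.topologicalClosure)
    (h : ∀ x ∈ V, ∀ y, ⟪u, elem x y⟫_ℂ = 0) : tmap f (.id ℂ G) u = 0 := by
  refine eq_zero_of_inner_elem fun x y => ?_
  rw [inner_tmap_elem, adjoint_id]
  have hcl : IsClosed {x : E | ⟪u, elem x y⟫_ℂ = 0} :=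
    isClosed_eq (continuous_const.inner
      (continuous_elem.comp (continuous_id.prodMk continuous_const))) continuous_const
  exact (hcl.closure_subset_iff.2 fun x hx => h x hx y) (hV x)

end TensorCalculus

/-! ### The spectral measure of a bounded self-adjoint operator -/

section SpectralMeasure

variable {𝔗 : Type*} [NormedAddCommGroup 𝔗] [InnerProductSpace ℂ 𝔗] [CompleteSpace 𝔗]
  {T : 𝔗 →L[ℂ] 𝔗}

/-- Truncation of a real number to `[-ε, ε]`. -/
def clamp (ε t : ℝ) : ℝ := max (-ε) (min t ε)

theorem continuous_clamp (ε : ℝ) : Continuous (clamp ε) := by unfold clamp; fun_prop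

theorem abs_clamp_le {ε : ℝ} (hε : 0 ≤ ε) (t : ℝ) : |clamp ε t| ≤ ε :=
  abs_le.2 ⟨le_max_left _ _, max_le (by linarith) (min_le_right _ _)⟩

theorem clamp_of_abs_le {ε t : ℝ} (h : |t| ≤ ε) : clamp ε t = t := by
  rw [clamp, min_eq_left (abs_le.1 h).2, max_eq_right (abs_le.1 h).1]

theorem norm_cfc_clamp_le {ε : ℝ} (hε : 0 ≤ ε) (f : ℝ → ℝ) (x : 𝔗) :
    ‖cfc (fun t => clamp ε (f t)) T x‖ ≤ ε * ‖x‖ :=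
  ContinuousLinearMap.le_of_opNorm_le _ (norm_cfc_le hε fun t _ => abs_clamp_le hε (f t)) x

theorem isSelfAdjoint_cfc (f : ℝ → ℝ) : IsSelfAdjoint (cfc f T) := cfc_predicate f T

theorem inner_cfc (f : ℝ → ℝ) (x y : 𝔗) : ⟪cfc f T x, y⟫_ℂ = ⟪x, cfc f T y⟫_ℂ := by
  rw [← ContinuousLinearMap.adjoint_inner_right, (isSelfAdjoint_cfc f).adjoint_eq]

theorem cfc_mul_apply {f g : ℝ → ℝ} (hf : Continuous f) (hg : Continuous g) (x : 𝔗) :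
    cfc f T (cfc g T x) = cfc (fun t => f t * g t) T x := by
  rw [cfc_mul f g T hf.continuousOn hg.continuousOn]; rfl

theorem cfc_add_apply {f g : ℝ → ℝ} (hf : Continuous f) (hg : Continuous g) (x : 𝔗) :
    cfc (fun t => f t + g t) T x = cfc f T x + cfc g T x := by
  rw [cfc_add T f g hf.continuousOn hg.continuousOn]; rfl

theorem cfc_sub_apply {f g : ℝ → ℝ} (hf : Continuous f) (hg : Continuous g) (x : 𝔗) :
    cfc (fun t => f t - g t) T x = cfc f T x - cfc g T x := by
  rw [cfc_sub f g T hf.continuousOn hg.continuousOn]; rfl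

theorem cfc_const_apply (hT : IsSelfAdjoint T) (c : ℝ) (x : 𝔗) :
    cfc (fun _ => c) T x = c • x := by
  rw [cfc_const c T, Algebra.algebraMap_eq_smul_one]; rfl

theorem mem_spectralVectors {K : Set ℝ} {x : 𝔗} : x ∈ spectralVectors T K ↔
    ∀ f : ℝ → ℝ, Continuous f → (∀ t ∈ K, f t = 0) → cfc f T x = 0 := by
  simp only [spectralVectors, Submodule.mem_iInf, Set.mem_ofPred_eq, LinearMap.mem_ker]
  exact ⟨fun h f hf h0 => h f ⟨hf, h0⟩, fun h f hf => h f hf.1 hf.2⟩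

theorem spectralVectors_mono {K L : Set ℝ} (h : K ⊆ L) :
    spectralVectors T K ≤ spectralVectors T L := fun _ hx =>
  mem_spectralVectors.2 fun f hf h0 => mem_spectralVectors.1 hx f hf fun t ht => h0 t (h ht)

theorem cfc_mem_spectralVectors {K : Set ℝ} {f : ℝ → ℝ} (hf : Continuous f)
    (h0 : ∀ t ∉ K, f t = 0) (x : 𝔗) : cfc f T x ∈ spectralVectors T K := by
  refine mem_spectralVectors.2 fun g hg hg0 => ?_
  have : (fun t => g t * f t) = fun _ => 0 := by
    funext t
    by_cases ht : t ∈ K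
    · rw [hg0 t ht, zero_mul]
    · rw [h0 t ht, mul_zero]
  rw [cfc_mul_apply hg hf, this, cfc_const_zero]
  rfl

theorem spectralVectors_eq_top (hσ : K ⊇ spectrum ℝ T) : spectralVectors T K = ⊤ := by
  refine Submodule.eq_top_iff'.2 fun x => mem_spectralVectors.2 fun f _ h0 => ?_
  rw [cfc_congr (g := fun _ => 0) fun t ht => h0 t (hσ ht), cfc_const_zero]
  rfl

theorem eq_zero_of_forall_norm_le {X : Type*} [NormedAddCommGroup X] {y : X} {C : ℝ}
    (h : ∀ ε > 0, ‖y‖ ≤ ε * C) : y = 0 := by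
  refine norm_le_zero_iff.1 (le_of_forall_pos_le_add fun δ hδ => ?_)
  have hC : 0 < |C| + 1 := by positivity
  refine (h (δ / (|C| + 1)) (by positivity)).trans ?_
  rw [zero_add, div_mul_eq_mul_div, div_le_iff₀ hC]
  nlinarith [le_abs_self C]

/-- If `f` vanishes on `K ∩ L`, then up to a uniformly small error it is a sum of a function
vanishing on `K` and of one vanishing on `L`. -/
theorem inf_spectralVectors_le {K L : Set ℝ} (hK : IsClosed K) (hL : IsClosed L) :
    spectralVectors T K ⊓ spectralVectors T L ≤ spectralVectors T (K ∩ L) := by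
  rintro x ⟨hxK, hxL⟩
  refine mem_spectralVectors.2 fun f hf h0 => eq_zero_of_forall_norm_le (C := ‖x‖) fun ε hε => ?_
  have hC : IsClosed (K ∩ {t | ε ≤ |f t|}) :=
    hK.inter (isClosed_le continuous_const hf.abs)
  obtain ⟨h, hh0, hh1, -⟩ := exists_continuous_zero_one_of_isClosed hL hC <| by
    refine Set.disjoint_left.2 fun t htL ⟨htK, ht⟩ => ?_
    rw [Set.mem_ofPred_eq, h0 t ⟨htK, htL⟩, abs_zero] at ht
    exact hε.not_ge ht
  have hs : Continuous fun t => f t - clamp ε (f t) := hf.sub ((continuous_clamp ε).comp hf)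
  have hs1 : Continuous fun t => (f t - clamp ε (f t)) * h t := hs.mul h.continuous
  have hs2 : Continuous fun t => (f t - clamp ε (f t)) * (1 - h t) :=
    hs.mul (continuous_const.sub h.continuous)
  have hs3 : Continuous fun t => (f t - clamp ε (f t)) * h t + (f t - clamp ε (f t)) * (1 - h t) :=
    hs1.add hs2
  have hcl : Continuous fun t => clamp ε (f t) := (continuous_clamp ε).comp hf
  have e1 : cfc (fun t => (f t - clamp ε (f t)) * h t) T x = 0 :=
    mem_spectralVectors.1 hxL _ hs1 fun t ht => by
      rw [hh0 ht]; exact mul_zero _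
  have e2 : cfc (fun t => (f t - clamp ε (f t)) * (1 - h t)) T x = 0 :=
    mem_spectralVectors.1 hxK _ hs2 fun t ht => by
      by_cases hft : ε ≤ |f t|
      · rw [hh1 ⟨ht, hft⟩]; simp
      · rw [clamp_of_abs_le (not_le.1 hft).le, sub_self, zero_mul]
  have hdec : f = fun t => ((f t - clamp ε (f t)) * h t + (f t - clamp ε (f t)) * (1 - h t))
      + clamp ε (f t) := by funext t; ring
  have : cfc f T x = cfc (fun t => clamp ε (f t)) T x := by
    conv_lhs => rw [hdec]
    rw [cfc_add_apply hs3 hcl, cfc_add_apply hs1 hs2, e1, e2, zero_add, zero_add]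
  rw [this]
  exact norm_cfc_clamp_le hε.le f x

theorem spectralVectors_le_spectralSubspace {K δ : Set ℝ} (hK : IsClosed K) (h : K ⊆ δ) :
    spectralVectors T K ≤ spectralSubspace T δ :=
  (le_biSup (spectralVectors T) (show K ∈ {K : Set ℝ | IsClosed K ∧ K ⊆ δ} from ⟨hK, h⟩)).trans
    (Submodule.le_topologicalClosure _)

/-- The closed sets contained in `δ` being directed, the span in the definition of the spectral
subspace of `δ` is a union. -/
theorem mem_iSup_spectralVectors {δ : Set ℝ} {x : 𝔗} :
    x ∈ ⨆ K ∈ {K : Set ℝ | IsClosed K ∧ K ⊆ δ}, spectralVectors T K ↔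
      ∃ K, IsClosed K ∧ K ⊆ δ ∧ x ∈ spectralVectors T K := by
  have : Nonempty {K : Set ℝ | IsClosed K ∧ K ⊆ δ} := ⟨⟨∅, isClosed_empty, Set.empty_subset _⟩⟩
  rw [iSup_subtype', Submodule.mem_iSup_of_directed]
  · exact ⟨fun ⟨K, hx⟩ => ⟨K, K.2.1, K.2.2, hx⟩, fun ⟨K, h1, h2, hx⟩ => ⟨⟨K, h1, h2⟩, hx⟩⟩
  · exact fun K L => ⟨⟨K.1 ∪ L.1, K.2.1.union L.2.1, Set.union_subset K.2.2 L.2.2⟩,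
      spectralVectors_mono Set.subset_union_left, spectralVectors_mono Set.subset_union_right⟩

/-- A closed property holds on a spectral subspace if it holds for the vectors whose spectral
support is a closed subset. -/
theorem spectralSubspace_induction {δ : Set ℝ} {p : 𝔗 → Prop} (hp : IsClosed {x | p x})
    (h : ∀ K, IsClosed K → K ⊆ δ → ∀ x ∈ spectralVectors T K, p x) {x : 𝔗}
    (hx : x ∈ spectralSubspace T δ) : p x := by
  refine (hp.closure_subset_iff.2 fun y hy => ?_) hx
  obtain ⟨K, hK, hKδ, hy⟩ := mem_iSup_spectralVectors.1 hy
  exact h K hK hKδ y hy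

theorem isClosed_spectralSubspace (T : 𝔗 →L[ℂ] 𝔗) (δ : Set ℝ) :
    IsClosed (spectralSubspace T δ : Set 𝔗) := Submodule.isClosed_topologicalClosure _

theorem spectralSubspace_mono {δ δ' : Set ℝ} (h : δ ⊆ δ') :
    spectralSubspace T δ ≤ spectralSubspace T δ' := fun _ hx =>
  spectralSubspace_induction (isClosed_spectralSubspace T δ')
    (fun _ hK hKδ _ hx => spectralVectors_le_spectralSubspace hK (hKδ.trans h) hx) hx

/-- The functions `f - clamp ε f` are supported in closed subsets of `δ` and converge to `f`
uniformly. -/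
theorem cfc_mem_spectralSubspace {δ : Set ℝ} {f : ℝ → ℝ} (hf : Continuous f)
    (h0 : ∀ t ∉ δ, f t = 0) (x : 𝔗) : cfc f T x ∈ spectralSubspace T δ := by
  change cfc f T x ∈ (spectralSubspace T δ : Set 𝔗)
  rw [← (isClosed_spectralSubspace T δ).closure_eq, Metric.mem_closure_iff]
  intro r hr
  set ε := r / (‖x‖ + 1)
  have hx : 0 < ‖x‖ + 1 := by positivity
  have hε : 0 < ε := by positivity
  have hc : Continuous fun t => clamp ε (f t) := (continuous_clamp ε).comp hf
  refine ⟨cfc (fun t => f t - clamp ε (f t)) T x,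
    spectralVectors_le_spectralSubspace (K := {t | ε ≤ |f t|})
      (isClosed_le continuous_const hf.abs) (fun t ht => ?_)
      (cfc_mem_spectralVectors (f := fun t => f t - clamp ε (f t)) (hf.sub hc)
        (fun t ht => ?_) x), ?_⟩
  · by_contra h
    rw [Set.mem_ofPred_eq, h0 t h, abs_zero] at ht
    exact hε.not_ge ht
  · rw [clamp_of_abs_le (not_le.1 ht).le, sub_self]
  · rw [cfc_sub_apply hf hc, dist_eq_norm, sub_sub_cancel]
    refine (norm_cfc_clamp_le hε.le f x).trans_lt ?_
    rw [div_mul_eq_mul_div, div_lt_iff₀ hx]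
    nlinarith

theorem isOrtho_spectralVectors (hT : IsSelfAdjoint T) {K L : Set ℝ} (hK : IsClosed K)
    (hL : IsClosed L) (h : Disjoint K L) {x y : 𝔗} (hx : x ∈ spectralVectors T K)
    (hy : y ∈ spectralVectors T L) : ⟪x, y⟫_ℂ = 0 := by
  obtain ⟨f, hf0, hf1, -⟩ := exists_continuous_zero_one_of_isClosed hK hL h
  have h1 : cfc f T x = 0 := mem_spectralVectors.1 hx f f.continuous hf0
  have h2 : cfc (fun t => 1 - f t) T y = 0 :=
    mem_spectralVectors.1 hy _ (continuous_const.sub f.continuous)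
      fun t ht => by rw [hf1 ht]; simp
  rw [cfc_sub_apply continuous_const f.continuous, cfc_const_apply hT, one_smul, sub_eq_zero] at h2
  rw [h2, ← inner_cfc, h1, inner_zero_left]

theorem isOrtho_spectralSubspace (hT : IsSelfAdjoint T) {δ δ' : Set ℝ} (h : Disjoint δ δ') {x y : 𝔗}
    (hx : x ∈ spectralSubspace T δ) (hy : y ∈ spectralSubspace T δ') : ⟪x, y⟫_ℂ = 0 := by
  refine spectralSubspace_induction (p := fun x => ⟪x, y⟫_ℂ = 0)
    (isClosed_eq (by fun_prop) continuous_const) (fun K hK hKδ x hx => ?_) hx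
  refine spectralSubspace_induction (p := fun y => ⟪x, y⟫_ℂ = 0)
    (isClosed_eq (by fun_prop) continuous_const) (fun L hL hLδ y hy => ?_) hy
  exact isOrtho_spectralVectors hT hK hL (h.mono hKδ hLδ) hx hy

theorem map_mem_spectralSubspace {B : 𝔗 →L[ℂ] 𝔗} (hB : ∀ f : ℝ → ℝ, Commute B (cfc f T))
    {δ : Set ℝ} {x : 𝔗} (hx : x ∈ spectralSubspace T δ) : B x ∈ spectralSubspace T δ := by
  refine spectralSubspace_induction (p := fun x => B x ∈ spectralSubspace T δ)
    ((isClosed_spectralSubspace T δ).preimage B.continuous) (fun K hK hKδ x hx => ?_) hx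
  refine spectralVectors_le_spectralSubspace hK hKδ (mem_spectralVectors.2 fun f hf h0 => ?_)
  rw [← mul_apply_eq_comp, ← (hB f).eq, mul_apply_eq_comp,
    mem_spectralVectors.1 hx f hf h0, map_zero]

/-- On the spectral subspace of `δ`, the operator `f(T)` differs from the constant `c` by at most
the oscillation `ε` of `f` about `c` on `δ`. -/
theorem norm_cfc_sub_smul_le {δ : Set ℝ} {f : ℝ → ℝ} (hT : IsSelfAdjoint T) (hf : Continuous f)
    {c ε : ℝ} (hε : 0 ≤ ε) (h : ∀ t ∈ δ, |f t - c| ≤ ε) {x : 𝔗}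
    (hx : x ∈ spectralSubspace T δ) : ‖cfc f T x - c • x‖ ≤ ε * ‖x‖ := by
  refine spectralSubspace_induction (p := fun x => ‖cfc f T x - c • x‖ ≤ ε * ‖x‖)
    (isClosed_le (by fun_prop) (by fun_prop)) (fun K hK hKδ x hx => ?_) hx
  have hfc : Continuous fun t => f t - c := hf.sub continuous_const
  have hc : Continuous fun t => clamp ε (f t - c) := (continuous_clamp ε).comp hfc
  have h0 := mem_spectralVectors.1 hx (fun t => f t - c - clamp ε (f t - c))
    (hfc.sub hc) fun t ht => by rw [clamp_of_abs_le (h t (hKδ ht)), sub_self]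
  rw [cfc_sub_apply hfc hc, sub_eq_zero,
    cfc_sub_apply hf continuous_const, cfc_const_apply hT] at h0
  rw [h0]
  exact norm_cfc_clamp_le hε _ x

theorem spectralMeasure_mem (T : 𝔗 →L[ℂ] 𝔗) (δ : Set ℝ) (x : 𝔗) :
    spectralMeasure T δ x ∈ spectralSubspace T δ := by
  have : CompleteSpace (spectralSubspace T δ) := (isClosed_spectralSubspace T δ).completeSpace_coe
  exact Submodule.starProjection_apply_mem _ x

theorem spectralMeasure_eq_self {δ : Set ℝ} {x : 𝔗} (hx : x ∈ spectralSubspace T δ) :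
    spectralMeasure T δ x = x := by
  have : CompleteSpace (spectralSubspace T δ) := (isClosed_spectralSubspace T δ).completeSpace_coe
  exact Submodule.starProjection_eq_self_iff.2 hx

theorem inner_spectralMeasure (δ : Set ℝ) (x y : 𝔗) :
    ⟪spectralMeasure T δ x, y⟫_ℂ = ⟪x, spectralMeasure T δ y⟫_ℂ := by
  have : CompleteSpace (spectralSubspace T δ) := (isClosed_spectralSubspace T δ).completeSpace_coe
  exact Submodule.inner_starProjection_left_eq_right _ x y

theorem isSelfAdjoint_spectralMeasure (δ : Set ℝ) : IsSelfAdjoint (spectralMeasure T δ) := by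
  refine ContinuousLinearMap.ext fun x => ext_inner_left ℂ fun y => ?_
  rw [ContinuousLinearMap.star_eq_adjoint, ContinuousLinearMap.adjoint_inner_right,
    inner_spectralMeasure]

theorem spectralMeasure_mul_of_forall_mem {B : 𝔗 →L[ℂ] 𝔗} {δ : Set ℝ}
    (h : ∀ x, B x ∈ spectralSubspace T δ) : spectralMeasure T δ * B = B :=
  ContinuousLinearMap.ext fun x => spectralMeasure_eq_self (h x)

theorem spectralMeasure_mul_self (δ : Set ℝ) :
    spectralMeasure T δ * spectralMeasure T δ = spectralMeasure T δ :=
  spectralMeasure_mul_of_forall_mem (spectralMeasure_mem T δ)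

theorem spectralMeasure_mul_of_disjoint (hT : IsSelfAdjoint T) {δ δ' : Set ℝ} (h : Disjoint δ δ') :
    spectralMeasure T δ * spectralMeasure T δ' = 0 :=
  ContinuousLinearMap.ext fun x => ext_inner_left ℂ fun y => by
    rw [mul_apply_eq_comp, ← inner_spectralMeasure]
    simpa using
      isOrtho_spectralSubspace hT h (spectralMeasure_mem T δ y) (spectralMeasure_mem T δ' x)

theorem spectralMeasure_mul_of_subset {δ δ' : Set ℝ} (h : δ ⊆ δ') :
    spectralMeasure T δ' * spectralMeasure T δ = spectralMeasure T δ :=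
  spectralMeasure_mul_of_forall_mem fun x => spectralSubspace_mono h (spectralMeasure_mem T δ x)

theorem spectralMeasure_mul_of_subset' {δ δ' : Set ℝ} (h : δ ⊆ δ') :
    spectralMeasure T δ * spectralMeasure T δ' = spectralMeasure T δ := by
  have := congrArg star (spectralMeasure_mul_of_subset (T := T) h)
  rwa [star_mul, (isSelfAdjoint_spectralMeasure δ).star_eq,
    (isSelfAdjoint_spectralMeasure δ').star_eq] at this

theorem commute_spectralMeasure {B : 𝔗 →L[ℂ] 𝔗} (hB : ∀ f : ℝ → ℝ, Commute B (cfc f T))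
    (hs : IsSelfAdjoint B) (δ : Set ℝ) : Commute B (spectralMeasure T δ) := by
  have h : spectralMeasure T δ * (B * spectralMeasure T δ) = B * spectralMeasure T δ :=
    spectralMeasure_mul_of_forall_mem fun x =>
      map_mem_spectralSubspace hB (spectralMeasure_mem T δ x)
  have h' := congrArg star h
  rw [star_mul, star_mul, hs.star_eq, (isSelfAdjoint_spectralMeasure δ).star_eq, mul_assoc, h] at h'
  exact h'

theorem commute_cfc_spectralMeasure (f : ℝ → ℝ) (δ : Set ℝ) :
    Commute (cfc f T) (spectralMeasure T δ) :=
  commute_spectralMeasure (fun g => cfc_commute_cfc f g T) (isSelfAdjoint_cfc f) δ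

theorem commute_spectralMeasure_spectralMeasure (δ δ' : Set ℝ) :
    Commute (spectralMeasure T δ) (spectralMeasure T δ') :=
  commute_spectralMeasure (fun g => (commute_cfc_spectralMeasure g δ).symm)
    (isSelfAdjoint_spectralMeasure δ) δ'

/-- `1 - E(-∞, c)` maps into the range of `E[c, ∞)`. -/
theorem one_sub_spectralMeasure_Iio_mem (c : ℝ) (x : 𝔗) :
    (1 - spectralMeasure T (Set.Iio c)) x ∈ spectralVectors T (Set.Ici c) := by
  refine mem_spectralVectors.2 fun f hf h0 => ?_
  have h : ∀ y, ⟪y, cfc f T ((1 - spectralMeasure T (Set.Iio c)) x)⟫_ℂ = 0 := by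
    intro y
    have hmem : cfc f T y ∈ spectralSubspace T (Set.Iio c) :=
      cfc_mem_spectralSubspace hf (fun t ht => h0 t (not_lt.1 (show ¬t < c from ht))) y
    have h1 := inner_spectralMeasure (T := T) (Set.Iio c) (cfc f T y) x
    have h2 : (1 - spectralMeasure T (Set.Iio c)) x = x - spectralMeasure T (Set.Iio c) x := rfl
    rw [spectralMeasure_eq_self (δ := Set.Iio c) (x := cfc f T y) hmem] at h1
    rw [← inner_cfc, h2, inner_sub_right, ← h1, sub_self]
  exact inner_self_eq_zero.1 (h _)

/-- Additivity `E(-∞, d) = E(-∞, c) + E[c, d)`. The point is that `1 - E(-∞, c)` maps the vectors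
with spectral support in a closed `K ⊆ (-∞, d)` to vectors with spectral support in `K ∩ [c, ∞)`. -/
theorem spectralMeasure_Ico (hT : IsSelfAdjoint T) {c d : ℝ} (h : c ≤ d) :
    spectralMeasure T (Set.Ico c d)
      = spectralMeasure T (Set.Iio d) - spectralMeasure T (Set.Iio c) := by
  have hmem : ∀ x ∈ spectralSubspace T (Set.Iio d),
      (1 - spectralMeasure T (Set.Iio c)) x ∈ spectralSubspace T (Set.Ico c d) := by
    intro x hx
    refine spectralSubspace_induction
      (p := fun x => (1 - spectralMeasure T (Set.Iio c)) x ∈ spectralSubspace T (Set.Ico c d))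
      ((isClosed_spectralSubspace T _).preimage (ContinuousLinearMap.continuous _))
      (fun K hK hKd x hx => ?_) hx
    refine spectralVectors_le_spectralSubspace (hK.inter isClosed_Ici) ?_
      (inf_spectralVectors_le hK isClosed_Ici ⟨?_, one_sub_spectralMeasure_Iio_mem c x⟩)
    · exact fun t ht => ⟨ht.2, hKd ht.1⟩
    · refine mem_spectralVectors.2 fun f hf h0 => ?_
      rw [← mul_apply_eq_comp,
        ((Commute.one_right _).sub_right (commute_cfc_spectralMeasure f _)).eq,
        mul_apply_eq_comp, mem_spectralVectors.1 hx f hf h0, map_zero]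
  have h1 : spectralMeasure T (Set.Ico c d) *
      ((1 - spectralMeasure T (Set.Iio c)) * spectralMeasure T (Set.Iio d))
      = (1 - spectralMeasure T (Set.Iio c)) * spectralMeasure T (Set.Iio d) :=
    spectralMeasure_mul_of_forall_mem fun x => hmem _ (spectralMeasure_mem T _ x)
  have h2 : spectralMeasure T (Set.Iio c) * spectralMeasure T (Set.Iio d)
      = spectralMeasure T (Set.Iio c) := spectralMeasure_mul_of_subset' (Set.Iio_subset_Iio h)
  have h3 : spectralMeasure T (Set.Ico c d) * spectralMeasure T (Set.Iio d)
      = spectralMeasure T (Set.Ico c d) := spectralMeasure_mul_of_subset' fun t ht => ht.2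
  have h4 : spectralMeasure T (Set.Ico c d) * spectralMeasure T (Set.Iio c) = 0 :=
    spectralMeasure_mul_of_disjoint hT <| Set.disjoint_left.2 fun t ht ht' => ht'.not_ge ht.1
  rw [sub_mul, one_mul, h2, mul_sub, h3, h4, sub_zero] at h1
  exact h1

theorem spectralMeasure_Icc (hT : IsSelfAdjoint T) {a b c : ℝ}
    (hσ : spectrum ℝ T ⊆ Set.Icc a b) :
    spectralMeasure T (Set.Icc c b) = 1 - spectralMeasure T (Set.Iio c) := by
  have hmem : ∀ x, (1 - spectralMeasure T (Set.Iio c)) x ∈ spectralSubspace T (Set.Icc c b) := by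
    intro x
    refine spectralVectors_le_spectralSubspace (isClosed_Ici.inter isClosed_Icc) ?_
      (inf_spectralVectors_le isClosed_Ici (isClosed_Icc (a := a) (b := b))
        ⟨one_sub_spectralMeasure_Iio_mem c x, ?_⟩)
    · exact fun t ht => ⟨ht.1, ht.2.2⟩
    · rw [spectralVectors_eq_top hσ]; trivial
  have h1 := spectralMeasure_mul_of_forall_mem hmem
  rw [mul_sub, mul_one, spectralMeasure_mul_of_disjoint hT, sub_zero] at h1
  · exact h1
  · exact Set.disjoint_left.2 fun t ht ht' => ht'.not_ge ht.1

theorem spectralMeasure_Iio_eq_zero (hT : IsSelfAdjoint T) {a b : ℝ}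
    (hσ : spectrum ℝ T ⊆ Set.Icc a b) :
    spectralMeasure T (Set.Iio a) = 0 := by
  have h1 : spectralMeasure T (Set.Icc a b) * 1 = 1 := spectralMeasure_mul_of_forall_mem fun x =>
    spectralVectors_le_spectralSubspace isClosed_Icc subset_rfl
      (by rw [spectralVectors_eq_top hσ]; trivial)
  have h2 := spectralMeasure_Icc (c := a) hT hσ
  rw [mul_one] at h1
  rw [h1] at h2
  exact sub_eq_self.1 h2.symm

end SpectralMeasure

/-! ### Tagged partitions -/

section Partitions

open Filter Topology

variable {a b : ℝ}

namespace TaggedPartition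

theorem tag_mem_cell (Z : TaggedPartition a b) (m : Fin (Z.n + 1)) : Z.tag m ∈ Z.cell m :=
  Z.tag_mem m

theorem cell_subset_Icc (Z : TaggedPartition a b) (m : Fin (Z.n + 1)) :
    Z.cell m ⊆ Set.Icc (Z.pt m.castSucc) (Z.pt m.succ) := by
  rw [cell]
  split_ifs
  exacts [subset_rfl, Set.Ico_subset_Icc_self]

theorem cell_subset (Z : TaggedPartition a b) (m : Fin (Z.n + 1)) : Z.cell m ⊆ Set.Icc a b := by
  refine (Z.cell_subset_Icc m).trans (Set.Icc_subset_Icc ?_ ?_)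
  · exact Z.first.symm.trans_le (Z.mono (Fin.zero_le _))
  · exact (Z.mono (Fin.le_last _)).trans_eq Z.last

theorem disjoint_cell_of_lt (Z : TaggedPartition a b) {m k : Fin (Z.n + 1)} (h : m < k) :
    Disjoint (Z.cell m) (Z.cell k) := by
  refine Set.disjoint_left.2 fun t hm hk => ?_
  have hk' := (Z.cell_subset_Icc k hk).1
  rw [cell, if_neg (h.trans_le (Fin.le_last k)).ne] at hm
  have : Z.pt m.succ ≤ Z.pt k.castSucc := Z.mono (by
    rw [Fin.le_def]; simp only [Fin.val_succ, Fin.val_castSucc]; exact h)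
  linarith [hm.2]

theorem disjoint_cell (Z : TaggedPartition a b) {m k : Fin (Z.n + 1)} (h : m ≠ k) :
    Disjoint (Z.cell m) (Z.cell k) := by
  rcases h.lt_or_gt with h | h
  exacts [Z.disjoint_cell_of_lt h, (Z.disjoint_cell_of_lt h).symm]

theorem FinerThan.abs_sub_lt {Z : TaggedPartition a b} {δ : ℝ} (hZ : Z.FinerThan δ)
    {m : Fin (Z.n + 1)} {s t : ℝ} (hs : s ∈ Z.cell m) (ht : t ∈ Z.cell m) : |s - t| < δ := by
  have h1 := Z.cell_subset_Icc m hs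
  have h2 := Z.cell_subset_Icc m ht
  have h3 := hZ m
  rw [abs_lt]
  constructor <;> linarith [h1.1, h1.2, h2.1, h2.2]

theorem exists_finerThan (hab : a ≤ b) {δ : ℝ} (hδ : 0 < δ) :
    ∃ Z : TaggedPartition a b, Z.FinerThan δ := by
  set η := δ / 2
  have hη : 0 < η := half_pos hδ
  set n := ⌊(b - a) / η⌋₊
  have hn : a + n * η ≤ b := by
    have := Nat.floor_le (div_nonneg (sub_nonneg.2 hab) hη.le)
    rw [le_div_iff₀ hη] at this
    linarith
  have hn' : b < a + (n + 1) * η := by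
    have := Nat.lt_floor_add_one ((b - a) / η)
    rw [div_lt_iff₀ hη] at this
    linarith
  have hlt : ∀ m : Fin (n + 1), m ≠ Fin.last n → a + ((m : ℕ) + 1) * η ≤ b := by
    intro m hm
    have h1 : (m : ℕ) + 1 ≤ n := by
      have := Fin.val_lt_last hm
      omega
    have h2 : ((m : ℕ) + 1 : ℝ) ≤ n := by exact_mod_cast h1
    nlinarith
  refine ⟨.mk n (fun k => min (a + (k : ℕ) * η) b) ?_ ?_ ?_ (fun m => a + (m : ℕ) * η) ?_, ?_⟩
  · intro k l hkl
    have : ((k : ℕ) : ℝ) ≤ (l : ℕ) := by exact_mod_cast hkl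
    exact min_le_min_right _ (by nlinarith)
  · simpa using hab
  · simp only [Fin.val_last]
    push_cast
    exact min_eq_right hn'.le
  · intro m
    have hm : a + (m : ℕ) * η ≤ b := by
      have h1 : ((m : ℕ) : ℝ) ≤ n := by exact_mod_cast Fin.is_le m
      nlinarith
    have hm' : a + (m : ℕ) * η < a + ((m : ℕ) + 1) * η := by linarith
    split_ifs with h
    · simp only [Fin.val_castSucc, Fin.val_succ]
      push_cast
      exact ⟨min_le_left _ _, le_min hm'.le hm⟩
    · simp only [Fin.val_castSucc, Fin.val_succ]
      push_cast
      exact ⟨min_le_left _ _, lt_min hm' (hm'.trans_le (hlt m h))⟩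
  · intro m
    simp only [Fin.val_castSucc, Fin.val_succ]
    push_cast
    have hm : a + (m : ℕ) * η ≤ b := by
      have h1 : ((m : ℕ) : ℝ) ≤ n := by exact_mod_cast Fin.is_le m
      nlinarith
    rw [min_eq_left hm]
    have := min_le_left (a + ((m : ℕ) + 1) * η) b
    have h2 : η < δ := half_lt_self hδ
    linarith

end TaggedPartition

variable (a b) in
/-- The filter on the tagged partitions of `[a, b]` along which the mesh tends to zero. -/
def mesh : Filter (TaggedPartition a b) := ⨅ δ ∈ Set.Ioi (0 : ℝ), 𝓟 {Z | Z.FinerThan δ}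

theorem hasBasis_mesh :
    (mesh a b).HasBasis (fun δ : ℝ => 0 < δ) fun δ => {Z | Z.FinerThan δ} := by
  refine Filter.hasBasis_biInf_principal (fun δ hδ δ' hδ' =>
    ⟨min δ δ', Set.mem_Ioi.2 (lt_min hδ hδ'), ?_, ?_⟩)
    ⟨1, Set.mem_Ioi.2 one_pos⟩
  · exact fun Z hZ m => (hZ m).trans_le (min_le_left _ _)
  · exact fun Z hZ m => (hZ m).trans_le (min_le_right _ _)

theorem mesh_neBot (hab : a ≤ b) : (mesh a b).NeBot :=
  hasBasis_mesh.neBot_iff.2 fun hδ => TaggedPartition.exists_finerThan hab hδ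

theorem tendsto_mesh_iff {X : Type*} [SeminormedAddCommGroup X] {s : TaggedPartition a b → X}
    {G : X} : Tendsto s (mesh a b) (𝓝 G) ↔
      ∀ ε > 0, ∃ δ > 0, ∀ Z : TaggedPartition a b, Z.FinerThan δ → ‖s Z - G‖ < ε := by
  rw [hasBasis_mesh.tendsto_iff Metric.nhds_basis_ball]
  simp only [Metric.mem_ball, dist_eq_norm]
  rfl

end Partitions

/-! ### Resolutions of the identity -/

section Resolution

variable {ι κ 𝔗 : Type*} [Fintype ι] [Fintype κ]
  [NormedAddCommGroup 𝔗] [InnerProductSpace ℂ 𝔗] [CompleteSpace 𝔗]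

/-- A finite family of mutually orthogonal projections whose sum is the identity. -/
structure IsResolution (P : ι → 𝔗 →L[ℂ] 𝔗) : Prop where
  sa : ∀ i, IsSelfAdjoint (P i)
  idem : ∀ i, P i * P i = P i
  orth : ∀ i j, i ≠ j → P i * P j = 0
  sum : ∑ i, P i = 1

theorem norm_sum_sq_of_orthogonal {Y : Type*} [NormedAddCommGroup Y] [InnerProductSpace ℂ Y]
    (v : ι → Y) (h : ∀ i j, i ≠ j → ⟪v i, v j⟫_ℂ = 0) : ‖∑ i, v i‖ ^ 2 = ∑ i, ‖v i‖ ^ 2 := by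
  classical
  have key : ∀ s : Finset ι, ‖∑ i ∈ s, v i‖ ^ 2 = ∑ i ∈ s, ‖v i‖ ^ 2 := by
    intro s
    induction s using Finset.induction_on with
    | empty => simp
    | insert i s hi ih =>
      rw [Finset.sum_insert hi, Finset.sum_insert hi, ← ih, sq, sq, sq]
      refine norm_add_sq_eq_norm_sq_add_norm_sq_of_inner_eq_zero (𝕜 := ℂ) _ _ ?_
      rw [inner_sum]
      exact Finset.sum_eq_zero fun j hj => h i j fun hij => hi (hij ▸ hj)
  exact key _

theorem IsResolution.inner_eq_zero {P : ι → 𝔗 →L[ℂ] 𝔗} (hP : IsResolution P) {i j : ι}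
    (h : i ≠ j) (x y : 𝔗) : ⟪P i x, P j y⟫_ℂ = 0 := by
  have h1 : ⟪P i x, P j y⟫_ℂ = ⟪x, (P i * P j) y⟫_ℂ := by
    rw [mul_apply_eq_comp, ← ContinuousLinearMap.adjoint_inner_right, (hP.sa i).adjoint_eq]
  rw [h1, hP.orth i j h]
  simp

theorem IsResolution.sum_norm_sq {P : ι → 𝔗 →L[ℂ] 𝔗} (hP : IsResolution P) (x : 𝔗) :
    ∑ i, ‖P i x‖ ^ 2 = ‖x‖ ^ 2 := by
  rw [← norm_sum_sq_of_orthogonal (fun i => P i x) fun i j h => hP.inner_eq_zero h x x,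
    ← sum_apply, hP.sum]
  rfl

/-- Operators `D i` with mutually orthogonal ranges, each controlled by a projection of a
resolution of the identity, have a sum of norm at most the common bound. -/
theorem IsResolution.norm_sum_le {P : ι → 𝔗 →L[ℂ] 𝔗} (hP : IsResolution P)
    {Y : Type*} [NormedAddCommGroup Y] [InnerProductSpace ℂ Y] {D : ι → 𝔗 →L[ℂ] Y} {c : ℝ}
    (hc : 0 ≤ c) (hD : ∀ i x, ‖D i x‖ ≤ c * ‖P i x‖)
    (horth : ∀ i j, i ≠ j → ∀ x, ⟪D i x, D j x⟫_ℂ = 0) : ‖∑ i, D i‖ ≤ c := by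
  refine ContinuousLinearMap.opNorm_le_bound _ hc fun x => ?_
  refine le_of_sq_le_sq ?_ (by positivity)
  rw [sum_apply, norm_sum_sq_of_orthogonal _ fun i j h => horth i j h x,
    mul_pow, ← hP.sum_norm_sq, Finset.mul_sum]
  exact Finset.sum_le_sum fun i _ => by
    rw [← mul_pow]; exact pow_le_pow_left₀ (norm_nonneg _) (hD i x) 2

theorem IsResolution.mul {P : ι → 𝔗 →L[ℂ] 𝔗} {P' : κ → 𝔗 →L[ℂ] 𝔗} (hP : IsResolution P)
    (hP' : IsResolution P') (h : ∀ i k, Commute (P i) (P' k)) :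
    IsResolution fun p : ι × κ => P p.1 * P' p.2 where
  sa p := by
    rw [isSelfAdjoint_iff, star_mul, (hP.sa _).star_eq, (hP'.sa _).star_eq, (h _ _).eq]
  idem p := by
    rw [mul_assoc, ← mul_assoc (P' p.2), ← (h _ _).eq, mul_assoc, hP'.idem, ← mul_assoc, hP.idem]
  orth p q hpq := by
    rw [mul_assoc, ← mul_assoc (P' p.2), ← (h _ _).eq, mul_assoc, ← mul_assoc]
    by_cases h1 : p.1 = q.1
    · rw [hP'.orth _ _ fun h2 => hpq (Prod.ext h1 h2), mul_zero]
    · rw [hP.orth _ _ h1, zero_mul]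
  sum := by
    rw [Fintype.sum_prod_type, ← Fintype.sum_mul_sum, hP.sum, hP'.sum, one_mul]

variable {H H₁ : Type*} [NormedAddCommGroup H] [InnerProductSpace ℂ H] [CompleteSpace H]
  [NormedAddCommGroup H₁] [InnerProductSpace ℂ H₁] [CompleteSpace H₁]

theorem IsResolution.tmap {P : ι → 𝔗 →L[ℂ] 𝔗} (hP : IsResolution P) :
    IsResolution fun i => tmap (.id ℂ H) (P i) where
  sa i := by
    rw [isSelfAdjoint_iff, ContinuousLinearMap.star_eq_adjoint, adjoint_tmap, adjoint_id,
      (hP.sa i).adjoint_eq]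
  idem i := by
    conv_rhs => rw [← hP.idem i]
    exact tmap_comp _ _ _ _
  orth i j h := by
    rw [← tmap_zero_right (.id ℂ H), ← hP.orth i j h]
    exact tmap_comp _ _ _ _
  sum := by
    rw [← tmap_sum_right, hP.sum]
    exact tmap_id_id

theorem IsResolution.norm_sum_tmap_le {P : ι → 𝔗 →L[ℂ] 𝔗} (hP : IsResolution P)
    {C : ι → H →L[ℂ] H₁} {c : ℝ} (hc : 0 ≤ c) (h : ∀ i, P i ≠ 0 → ‖C i‖ ≤ c) :
    ‖∑ i, BT.tmap (C i) (P i)‖ ≤ c := by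
  refine (hP.tmap (H := H)).norm_sum_le hc (fun i x => ?_) fun i j hij x => ?_
  · by_cases h0 : P i = 0
    · rw [h0, tmap_zero_right, tmap_zero_right]
      simp
    · have : BT.tmap (C i) (P i) x = BT.tmap (C i) (.id ℂ 𝔗) (BT.tmap (.id ℂ H) (P i) x) := by
        rw [tmap_tmap]; rfl
      rw [this]
      exact ContinuousLinearMap.le_of_opNorm_le _ ((norm_tmap_id_le _).trans (h i h0)) _
  · have h1 : (P i).comp (P j) = 0 := hP.orth i j hij
    rw [inner_tmap_left, tmap_tmap, (hP.sa i).adjoint_eq, h1, tmap_zero_right]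
    simp

end Resolution

/-! ### Operator-spectral integrals -/

section Integrals

open Filter Topology

variable {𝔗 : Type*} [NormedAddCommGroup 𝔗] [InnerProductSpace ℂ 𝔗] [CompleteSpace 𝔗]
  {T : 𝔗 →L[ℂ] 𝔗} {a b : ℝ}

/-- `T` is self-adjoint and `[a, b]` is a compact interval containing its spectrum. -/
structure SpectralInterval (T : 𝔗 →L[ℂ] 𝔗) (a b : ℝ) : Prop where
  sa : IsSelfAdjoint T
  le : a ≤ b
  subset : spectrum ℝ T ⊆ Set.Icc a b

theorem SpectralInterval.isResolution (h : SpectralInterval T a b) (Z : TaggedPartition a b) :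
    IsResolution fun m => spectralMeasure T (Z.cell m) where
  sa m := isSelfAdjoint_spectralMeasure _
  idem m := spectralMeasure_mul_self _
  orth m k hmk := spectralMeasure_mul_of_disjoint h.sa (Z.disjoint_cell hmk)
  sum := by
    set g : Fin (Z.n + 1) → 𝔗 →L[ℂ] 𝔗 := fun k => spectralMeasure T (Set.Iio (Z.pt k.castSucc))
    have h1 : ∀ m : Fin Z.n, spectralMeasure T (Z.cell m.castSucc) = g m.succ - g m.castSucc := by
      intro m
      rw [TaggedPartition.cell, if_neg (Fin.castSucc_lt_last m).ne,
        spectralMeasure_Ico h.sa (Z.mono (Fin.castSucc_lt_succ).le)]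
      rfl
    have h2 : spectralMeasure T (Z.cell (Fin.last _)) = 1 - g (Fin.last _) := by
      rw [TaggedPartition.cell, if_pos rfl, Fin.succ_last, Z.last,
        spectralMeasure_Icc h.sa h.subset]
    have h3 : g 0 = 0 := by
      change spectralMeasure T (Set.Iio (Z.pt 0)) = 0
      rw [Z.first, spectralMeasure_Iio_eq_zero h.sa h.subset]
    -- telescoping: both sums of `g` over `Fin n` are the sum over `Fin (n + 1)` minus an end term
    have h4 := (Fin.sum_univ_succ g).symm.trans (Fin.sum_univ_castSucc g)
    rw [Fin.sum_univ_castSucc, h2]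
    simp_rw [h1]
    rw [Finset.sum_sub_distrib]
    rw [h3, zero_add] at h4
    rw [h4]
    abel

variable {H H₁ H₂ : Type*} [NormedAddCommGroup H] [InnerProductSpace ℂ H]
  [NormedAddCommGroup H₁] [InnerProductSpace ℂ H₁]
  [NormedAddCommGroup H₂] [InnerProductSpace ℂ H₂]

/-- The Riemann-Stieltjes sum `∑ Ω(x_m) ⊗ E_T(Δ_m)`, to which both kinds of sums in the definition
of the operator-spectral integrals are equal. -/
def stepSum (T : 𝔗 →L[ℂ] 𝔗) (Ω : ℝ → H →L[ℂ] H₁) (Z : TaggedPartition a b) :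
    HTensor H 𝔗 →L[ℂ] HTensor H₁ 𝔗 :=
  ∑ m, tmap (Ω (Z.tag m)) (spectralMeasure T (Z.cell m))

theorem hasIntegralRight_iff {Ω : ℝ → H →L[ℂ] H₁} {G : HTensor H 𝔗 →L[ℂ] HTensor H₁ 𝔗} :
    HasIntegralRight a b (fun t => tmap (Ω t) (.id ℂ 𝔗))
      (fun δ => tmap (.id ℂ H) (spectralMeasure T δ)) G ↔
      Tendsto (stepSum T Ω) (mesh a b) (𝓝 G) := by
  refine Iff.trans ?_ (tendsto_mesh_iff (s := stepSum T Ω) (G := G)).symm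
  rw [HasIntegralRight]
  simp only [tmap_comp, ContinuousLinearMap.id_comp, ContinuousLinearMap.comp_id]
  rfl

theorem hasIntegralLeft_iff {Ω : ℝ → H →L[ℂ] H₁} {G : HTensor H 𝔗 →L[ℂ] HTensor H₁ 𝔗} :
    HasIntegralLeft a b (fun δ => tmap (.id ℂ H₁) (spectralMeasure T δ))
      (fun t => tmap (Ω t) (.id ℂ 𝔗)) G ↔
      Tendsto (stepSum T Ω) (mesh a b) (𝓝 G) := by
  refine Iff.trans ?_ (tendsto_mesh_iff (s := stepSum T Ω) (G := G)).symm
  rw [HasIntegralLeft]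
  simp only [tmap_comp, ContinuousLinearMap.id_comp, ContinuousLinearMap.comp_id]
  rfl

theorem stepSum_add (Ω Ω' : ℝ → H →L[ℂ] H₁) (Z : TaggedPartition a b) :
    stepSum T (fun t => Ω t + Ω' t) Z = stepSum T Ω Z + stepSum T Ω' Z := by
  simp only [stepSum, tmap_add_left, Finset.sum_add_distrib]

theorem stepSum_smul (c : ℂ) (Ω : ℝ → H →L[ℂ] H₁) (Z : TaggedPartition a b) :
    stepSum T (fun t => c • Ω t) Z = c • stepSum T Ω Z := by
  simp only [stepSum, tmap_smul_left, Finset.smul_sum]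

theorem adjoint_stepSum [CompleteSpace H] [CompleteSpace H₁] (Ω : ℝ → H →L[ℂ] H₁)
    (Z : TaggedPartition a b) : ContinuousLinearMap.adjoint (stepSum T Ω Z)
      = stepSum T (fun t => ContinuousLinearMap.adjoint (Ω t)) Z := by
  simp only [stepSum, map_sum, adjoint_tmap, (isSelfAdjoint_spectralMeasure _).adjoint_eq]

theorem stepSum_comp (h : SpectralInterval T a b) (Ω : ℝ → H₁ →L[ℂ] H₂) (Ω' : ℝ → H →L[ℂ] H₁)
    (Z : TaggedPartition a b) : stepSum T (fun t => (Ω t).comp (Ω' t)) Z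
      = (stepSum T Ω Z).comp (stepSum T Ω' Z) := by
  have hE := h.isResolution Z
  simp only [stepSum]
  rw [ContinuousLinearMap.finsetSum_comp]
  refine Finset.sum_congr rfl fun m _ => ?_
  rw [ContinuousLinearMap.comp_finsetSum, Finset.sum_eq_single m]
  · rw [tmap_comp]
    congr 1
    exact (hE.idem m).symm
  · intro k _ hk
    have h0 : (spectralMeasure T (Z.cell m)).comp (spectralMeasure T (Z.cell k)) = 0 :=
      hE.orth m k hk.symm
    rw [tmap_comp, h0, tmap_zero_right]
  · simp

theorem stepSum_const (h : SpectralInterval T a b) (B : H →L[ℂ] H₁) (Z : TaggedPartition a b) :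
    stepSum T (fun _ => B) Z = tmap B (.id ℂ 𝔗) := by
  rw [stepSum, ← tmap_sum_right, (h.isResolution Z).sum]
  rfl

/-- Riemann-Stieltjes sums of two fine partitions are close: compare them on the products
`E(Δ_m) E(Δ'_k)`, which vanish unless `Δ_m` and `Δ'_k` meet. -/
theorem norm_stepSum_sub_le [CompleteSpace H] [CompleteSpace H₁] (h : SpectralInterval T a b)
    {Ω : ℝ → H →L[ℂ] H₁} {δ ε : ℝ} (hε : 0 ≤ ε)
    (hΩ : ∀ s ∈ Set.Icc a b, ∀ t ∈ Set.Icc a b, |s - t| < δ + δ → ‖Ω s - Ω t‖ ≤ ε)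
    {Z Z' : TaggedPartition a b} (hZ : Z.FinerThan δ) (hZ' : Z'.FinerThan δ) :
    ‖stepSum T Ω Z - stepSum T Ω Z'‖ ≤ ε := by
  have hE := h.isResolution Z
  have hE' := h.isResolution Z'
  have hP := hE.mul hE' fun m k => commute_spectralMeasure_spectralMeasure _ _
  have h1 : stepSum T Ω Z = ∑ p : Fin (Z.n + 1) × Fin (Z'.n + 1), tmap (Ω (Z.tag p.1))
      (spectralMeasure T (Z.cell p.1) * spectralMeasure T (Z'.cell p.2)) := by
    rw [stepSum, Fintype.sum_prod_type]
    refine Finset.sum_congr rfl fun m _ => ?_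
    dsimp only
    rw [← tmap_sum_right, ← Finset.mul_sum, hE'.sum, mul_one]
  have h2 : stepSum T Ω Z' = ∑ p : Fin (Z.n + 1) × Fin (Z'.n + 1), tmap (Ω (Z'.tag p.2))
      (spectralMeasure T (Z.cell p.1) * spectralMeasure T (Z'.cell p.2)) := by
    rw [stepSum, Fintype.sum_prod_type_right]
    refine Finset.sum_congr rfl fun k _ => ?_
    dsimp only
    rw [← tmap_sum_right, ← Finset.sum_mul, hE.sum, one_mul]
  rw [h1, h2, ← Finset.sum_sub_distrib]
  simp_rw [← tmap_sub_left]
  refine hP.norm_sum_tmap_le hε fun p hp => ?_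
  have hnd : ¬Disjoint (Z.cell p.1) (Z'.cell p.2) := fun hd =>
    hp (spectralMeasure_mul_of_disjoint h.sa hd)
  obtain ⟨r, hr, hr'⟩ := Set.not_disjoint_iff.1 hnd
  refine hΩ _ (Z.cell_subset _ (Z.tag_mem_cell _)) _ (Z'.cell_subset _ (Z'.tag_mem_cell _)) ?_
  calc |Z.tag p.1 - Z'.tag p.2| ≤ |Z.tag p.1 - r| + |r - Z'.tag p.2| := abs_sub_le _ _ _
    _ < δ + δ := add_lt_add (hZ.abs_sub_lt (Z.tag_mem_cell _) hr)
      (hZ'.abs_sub_lt hr' (Z'.tag_mem_cell _))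

variable (T a b) in
/-- The operator-spectral integral `∫ Ω(λ) ⊗ E_T(dλ)` over `[a, b]`, the limit of the sums
`∑ Ω(x_m) ⊗ E_T(Δ_m)`. -/
def specInt (Ω : ℝ → H →L[ℂ] H₁) : HTensor H 𝔗 →L[ℂ] HTensor H₁ 𝔗 :=
  limUnder (mesh a b) (stepSum T Ω)

theorem exists_delta_of_continuous {X : Type*} [SeminormedAddCommGroup X] {Ω : ℝ → X}
    (hΩ : Continuous Ω) {ε : ℝ} (hε : 0 < ε) : ∃ δ > 0, ∀ s ∈ Set.Icc a b, ∀ t ∈ Set.Icc a b,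
      |s - t| < δ → ‖Ω s - Ω t‖ ≤ ε := by
  have := isCompact_Icc.uniformContinuousOn_of_continuous (hΩ.continuousOn (s := Set.Icc a b))
  obtain ⟨δ, hδ, h⟩ := Metric.uniformContinuousOn_iff.1 this ε hε
  refine ⟨δ, hδ, fun s hs t ht hst => ?_⟩
  rw [← dist_eq_norm]
  exact (h s hs t ht hst).le

theorem tendsto_stepSum [CompleteSpace H] [CompleteSpace H₁] (h : SpectralInterval T a b)
    {Ω : ℝ → H →L[ℂ] H₁} (hΩ : Continuous Ω) :
    Tendsto (stepSum T Ω) (mesh a b) (𝓝 (specInt T a b Ω)) := by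
  have := mesh_neBot h.le
  refine tendsto_nhds_limUnder (cauchy_map_iff_exists_tendsto.1 ?_)
  refine (Metric.cauchy_iff (α := HTensor H 𝔗 →L[ℂ] HTensor H₁ 𝔗)).2 ⟨this.map _, fun ε hε => ?_⟩
  obtain ⟨δ, hδ, hδΩ⟩ := exists_delta_of_continuous (a := a) (b := b) hΩ (half_pos hε)
  refine ⟨_, image_mem_map (hasBasis_mesh.mem_of_mem (half_pos hδ)), ?_⟩
  rintro _ ⟨Z, hZ, rfl⟩ _ ⟨Z', hZ', rfl⟩
  refine (dist_eq_norm (stepSum T Ω Z) (stepSum T Ω Z')).trans_lt ?_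
  refine (norm_stepSum_sub_le h (half_pos hε).le (fun s hs t ht hst => ?_) hZ hZ').trans_lt
    (half_lt_self hε)
  exact hδΩ s hs t ht (by linarith)

theorem specInt_eq_of_tendsto (h : SpectralInterval T a b) {Ω : ℝ → H →L[ℂ] H₁}
    {G : HTensor H 𝔗 →L[ℂ] HTensor H₁ 𝔗} (hG : Tendsto (stepSum T Ω) (mesh a b) (𝓝 G)) :
    specInt T a b Ω = G :=
  have := mesh_neBot h.le
  hG.limUnder_eq

theorem specInt_const (h : SpectralInterval T a b) (B : H →L[ℂ] H₁) :
    specInt T a b (fun _ => B) = tmap B (.id ℂ 𝔗) := by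
  refine specInt_eq_of_tendsto h ?_
  rw [funext (stepSum_const h B)]
  exact tendsto_const_nhds

/-- `∫ f(λ) E_T(dλ) = f(T)` for real continuous functions `f`. -/
theorem tendsto_sum_smul_spectralMeasure (h : SpectralInterval T a b) {f : ℝ → ℝ}
    (hf : Continuous f) : Tendsto (fun Z : TaggedPartition a b =>
      ∑ m, ((f (Z.tag m) : ℝ) : ℂ) • spectralMeasure T (Z.cell m)) (mesh a b) (𝓝 (cfc f T)) := by
  rw [tendsto_mesh_iff]
  intro ε hε
  obtain ⟨δ, hδ, hδf⟩ := exists_delta_of_continuous (a := a) (b := b) hf (half_pos hε)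
  refine ⟨δ, hδ, fun Z hZ => ?_⟩
  have hE := h.isResolution Z
  have h1 : cfc f T = ∑ m, cfc f T * spectralMeasure T (Z.cell m) := by
    rw [← Finset.mul_sum, hE.sum, mul_one]
  rw [norm_sub_rev, h1, ← Finset.sum_sub_distrib]
  refine (hE.norm_sum_le (half_pos hε).le (fun m x => ?_) fun m k hmk x => ?_).trans_lt
    (half_lt_self hε)
  · refine norm_cfc_sub_smul_le h.sa hf (half_pos hε).le (fun t ht => ?_)
      (spectralMeasure_mem T (Z.cell m) x)
    exact hδf t (Z.cell_subset m ht) _ (Z.cell_subset m (Z.tag_mem_cell m))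
      (hZ.abs_sub_lt ht (Z.tag_mem_cell m))
  · have key : ∀ m, (cfc f T * spectralMeasure T (Z.cell m)
        - ((f (Z.tag m) : ℝ) : ℂ) • spectralMeasure T (Z.cell m)) x
        = spectralMeasure T (Z.cell m) (cfc f T x - ((f (Z.tag m) : ℝ) : ℂ) • x) := by
      intro m
      rw [(commute_cfc_spectralMeasure f _).eq, map_sub, map_smul]
      rfl
    rw [key, key]
    exact hE.inner_eq_zero hmk _ _

theorem continuous_tmapRight {E F G H : Type*}
    [NormedAddCommGroup E] [InnerProductSpace ℂ E] [NormedAddCommGroup F] [InnerProductSpace ℂ F]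
    [NormedAddCommGroup G] [InnerProductSpace ℂ G] [NormedAddCommGroup H] [InnerProductSpace ℂ H]
    (f : E →L[ℂ] F) : Continuous (tmapRight (G := G) (H := H) f) :=
  continuous_of_linear_of_bound (𝕜 := ℂ) (E := G →L[ℂ] H)
    (G := HTensor E G →L[ℂ] HTensor F H) (f := fun g => tmap f g) (C := ‖f‖)
    (tmap_add_right f) (fun c g => tmap_smul_right c f g) (norm_tmap_le f)

theorem tendsto_stepSum_smul (h : SpectralInterval T a b) {f : ℝ → ℝ} (hf : Continuous f)
    (B : H →L[ℂ] H₁) :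
    Tendsto (stepSum T fun t => ((f t : ℝ) : ℂ) • B) (mesh a b) (𝓝 (tmap B (cfc f T))) := by
  have hc := continuous_tmapRight (G := 𝔗) (H := 𝔗) B
  refine ((hc.tendsto (cfc f T)).comp (tendsto_sum_smul_spectralMeasure h hf)).congr fun Z => ?_
  simp only [Function.comp, map_sum, map_smul]
  refine Finset.sum_congr rfl fun m _ => ?_
  rw [tmap_smul_left]
  rfl

theorem specInt_smul_const (h : SpectralInterval T a b) {f : ℝ → ℝ} (hf : Continuous f)
    (B : H →L[ℂ] H₁) : specInt T a b (fun t => ((f t : ℝ) : ℂ) • B) = tmap B (cfc f T) :=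
  specInt_eq_of_tendsto h (tendsto_stepSum_smul h hf B)

section Algebra

variable [CompleteSpace H] [CompleteSpace H₁] [CompleteSpace H₂]

theorem specInt_add (h : SpectralInterval T a b) {Ω Ω' : ℝ → H →L[ℂ] H₁} (hΩ : Continuous Ω)
    (hΩ' : Continuous Ω') :
    specInt T a b (fun t => Ω t + Ω' t) = specInt T a b Ω + specInt T a b Ω' := by
  refine specInt_eq_of_tendsto h ?_
  rw [funext (stepSum_add Ω Ω')]
  exact (tendsto_stepSum h hΩ).add (tendsto_stepSum h hΩ')

theorem specInt_smul (h : SpectralInterval T a b) (c : ℂ) {Ω : ℝ → H →L[ℂ] H₁}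
    (hΩ : Continuous Ω) : specInt T a b (fun t => c • Ω t) = c • specInt T a b Ω := by
  refine specInt_eq_of_tendsto h ?_
  rw [funext (stepSum_smul c Ω)]
  exact (tendsto_stepSum h hΩ).const_smul c

theorem specInt_sub (h : SpectralInterval T a b) {Ω Ω' : ℝ → H →L[ℂ] H₁} (hΩ : Continuous Ω)
    (hΩ' : Continuous Ω') :
    specInt T a b (fun t => Ω t - Ω' t) = specInt T a b Ω - specInt T a b Ω' := by
  have hc : Continuous fun t => (-1 : ℂ) • Ω' t := hΩ'.const_smul (-1 : ℂ)
  have h1 := specInt_add h hΩ hc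
  rw [specInt_smul h (-1) hΩ'] at h1
  simpa only [neg_smul, one_smul, ← sub_eq_add_neg] using h1

theorem tendsto_clm_comp {α X Y Z : Type*} [NormedAddCommGroup X] [NormedSpace ℂ X]
    [NormedAddCommGroup Y] [NormedSpace ℂ Y] [NormedAddCommGroup Z] [NormedSpace ℂ Z]
    {l : Filter α} {f : α → Y →L[ℂ] Z} {g : α → X →L[ℂ] Y} {F : Y →L[ℂ] Z} {G : X →L[ℂ] Y}
    (hf : Tendsto f l (𝓝 F)) (hg : Tendsto g l (𝓝 G)) :
    Tendsto (fun i => (f i).comp (g i)) l (𝓝 (F.comp G)) :=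
  (isBoundedBilinearMap_comp.continuous.tendsto (F, G)).comp (hf.prodMk_nhds hg)

theorem specInt_comp (h : SpectralInterval T a b) {Ω : ℝ → H₁ →L[ℂ] H₂} {Ω' : ℝ → H →L[ℂ] H₁}
    (hΩ : Continuous Ω) (hΩ' : Continuous Ω') :
    specInt T a b (fun t => (Ω t).comp (Ω' t)) = (specInt T a b Ω).comp (specInt T a b Ω') := by
  refine specInt_eq_of_tendsto h ?_
  rw [funext (stepSum_comp h Ω Ω')]
  exact tendsto_clm_comp (tendsto_stepSum h hΩ) (tendsto_stepSum h hΩ')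

theorem adjoint_specInt (h : SpectralInterval T a b) {Ω : ℝ → H →L[ℂ] H₁} (hΩ : Continuous Ω) :
    ContinuousLinearMap.adjoint (specInt T a b Ω)
      = specInt T a b fun t => ContinuousLinearMap.adjoint (Ω t) := by
  refine (specInt_eq_of_tendsto h ?_).symm
  rw [← funext (adjoint_stepSum Ω)]
  exact ((ContinuousLinearMap.adjoint (𝕜 := ℂ) (E := HTensor H 𝔗)
    (F := HTensor H₁ 𝔗)).continuous.tendsto _).comp (tendsto_stepSum h hΩ)

theorem tmap_comp_specInt (h : SpectralInterval T a b) (B : H₁ →L[ℂ] H₂) {Ω : ℝ → H →L[ℂ] H₁}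
    (hΩ : Continuous Ω) :
    (tmap B (.id ℂ 𝔗)).comp (specInt T a b Ω) = specInt T a b fun t => B.comp (Ω t) := by
  rw [specInt_comp h continuous_const hΩ, specInt_const h]

/-- Only the values of `F` on the real axis matter, so `F` may be replaced by the everywhere
continuous function `w ↦ F (Re w)`. -/
theorem cfc_eq_re_add_im (hT : IsSelfAdjoint T) {F : ℂ → ℂ}
    (hF : Continuous fun t : ℝ => F t) :
    cfc F T = cfc (fun t : ℝ => (F t).re) T + Complex.I • cfc (fun t : ℝ => (F t).im) T := by
  have hre : Continuous fun t : ℝ => (F t).re := Complex.continuous_re.comp hF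
  have him : Continuous fun t : ℝ => (F t).im := Complex.continuous_im.comp hF
  have hre' : Continuous fun w : ℂ => (((F (w.re : ℂ)).re : ℝ) : ℂ) :=
    Complex.continuous_ofReal.comp (hre.comp Complex.continuous_re)
  have him' : Continuous fun w : ℂ => (((F (w.re : ℂ)).im : ℝ) : ℂ) :=
    Complex.continuous_ofReal.comp (him.comp Complex.continuous_re)
  have hIm : Continuous fun w : ℂ => Complex.I * (((F (w.re : ℂ)).im : ℝ) : ℂ) :=
    continuous_const.mul him'
  rw [cfc_real_eq_complex _ hT, cfc_real_eq_complex _ hT,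
    ← cfc_const_mul Complex.I _ T him'.continuousOn,
    ← cfc_add T _ _ hre'.continuousOn hIm.continuousOn]
  refine cfc_congr fun w hw => ?_
  have hw' : w = (w.re : ℂ) := hT.mem_spectrum_eq_re hw
  conv_lhs => rw [hw', ← Complex.re_add_im (F (w.re : ℂ)), mul_comm]

/-- `∫ F(λ) B ⊗ E_T(dλ) = B ⊗ F(T)` for complex functions `F` continuous on the real axis. -/
theorem specInt_smul_const_complex (h : SpectralInterval T a b) {F : ℂ → ℂ}
    (hF : Continuous fun t : ℝ => F t) (B : H →L[ℂ] H₁) :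
    specInt T a b (fun t => F t • B) = tmap B (cfc F T) := by
  have hre : Continuous fun t : ℝ => (F t).re := Complex.continuous_re.comp hF
  have him : Continuous fun t : ℝ => (F t).im := Complex.continuous_im.comp hF
  have h1 : (fun t : ℝ => F t • B)
      = fun t : ℝ => (((F t).re : ℝ) : ℂ) • B + Complex.I • (((F t).im : ℝ) : ℂ) • B := by
    funext t
    rw [smul_smul, ← add_smul, mul_comm, Complex.re_add_im]
  have hc : ∀ {f : ℝ → ℝ}, Continuous f → Continuous fun t => ((f t : ℝ) : ℂ) • B := fun hf =>
    (Complex.continuous_ofReal.comp hf).smul continuous_const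
  have hI : Continuous fun t : ℝ => Complex.I • (((F t).im : ℝ) : ℂ) • B :=
    (hc him).const_smul Complex.I
  rw [h1, specInt_add h (hc hre) hI, specInt_smul h _ (hc him),
    specInt_smul_const h hre, specInt_smul_const h him, cfc_eq_re_add_im h.sa hF, tmap_add_right,
    tmap_smul_right]

end Algebra

end Integrals

/-! ### Real and imaginary parts and their square roots -/

section Parts

variable {𝓗 : Type*} [NormedAddCommGroup 𝓗] [InnerProductSpace ℂ 𝓗] [CompleteSpace 𝓗]

theorem reOp_eq (M : 𝓗 →L[ℂ] 𝓗) :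
    reOp M = (2⁻¹ : ℂ) • (M + ContinuousLinearMap.adjoint M) := by
  rw [reOp, realPart_apply_coe, ← Complex.coe_smul]
  norm_num
  rfl

theorem imOp_eq (M : 𝓗 →L[ℂ] 𝓗) :
    imOp M = (-Complex.I * 2⁻¹ : ℂ) • (M - ContinuousLinearMap.adjoint M) := by
  rw [imOp, imaginaryPart_apply_coe, ← Complex.coe_smul, mul_smul]
  norm_num
  rfl

theorem reOp_add_I_smul_imOp (M : 𝓗 →L[ℂ] 𝓗) : reOp M + Complex.I • imOp M = M :=
  realPart_add_I_smul_imaginaryPart M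

theorem isSelfAdjoint_reOp (M : 𝓗 →L[ℂ] 𝓗) : IsSelfAdjoint (reOp M) := (realPart M).2

theorem isSelfAdjoint_sqrtIm (M : 𝓗 →L[ℂ] 𝓗) : IsSelfAdjoint (sqrtIm M) :=
  IsSelfAdjoint.of_nonneg (CFC.sqrt_nonneg _)

theorem sqrtIm_mul_self {M : 𝓗 →L[ℂ] 𝓗} (h0 : 0 ≤ imOp M) : sqrtIm M * sqrtIm M = imOp M :=
  CFC.sqrt_mul_sqrt_self _ h0

theorem isUnit_sqrtIm {M : 𝓗 →L[ℂ] 𝓗} (h0 : 0 ≤ imOp M) (hu : IsUnit (imOp M)) :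
    IsUnit (sqrtIm M) := (CFC.isUnit_sqrt_iff _ h0).2 hu

theorem sqrtIm_mul_invSqrtIm {M : 𝓗 →L[ℂ] 𝓗} (h0 : 0 ≤ imOp M) (hu : IsUnit (imOp M)) :
    sqrtIm M * invSqrtIm M = 1 :=
  Ring.mul_inverse_cancel _ (isUnit_sqrtIm h0 hu)

theorem invSqrtIm_mul_sqrtIm {M : 𝓗 →L[ℂ] 𝓗} (h0 : 0 ≤ imOp M) (hu : IsUnit (imOp M)) :
    invSqrtIm M * sqrtIm M = 1 :=
  Ring.inverse_mul_cancel _ (isUnit_sqrtIm h0 hu)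

theorem invSqrtIm_eq_of_mul_eq_one {M R' : 𝓗 →L[ℂ] 𝓗} (h : sqrtIm M * R' = 1)
    (h' : R' * sqrtIm M = 1) : invSqrtIm M = R' :=
  Ring.inverse_unit ⟨sqrtIm M, R', h, h'⟩

section Continuity

variable {X : Type*} [TopologicalSpace X] {M : X → 𝓗 →L[ℂ] 𝓗}

theorem continuous_adjoint {E F : Type*} [NormedAddCommGroup E] [InnerProductSpace ℂ E]
    [CompleteSpace E] [NormedAddCommGroup F] [InnerProductSpace ℂ F] [CompleteSpace F]
    {M : X → E →L[ℂ] F} (hM : Continuous M) :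
    Continuous fun x => ContinuousLinearMap.adjoint (M x) :=
  (ContinuousLinearMap.adjoint (𝕜 := ℂ) (E := E) (F := F)).continuous.comp hM

theorem continuous_reOp (hM : Continuous M) : Continuous fun x => reOp (M x) := by
  simp only [reOp_eq]
  exact (hM.add (continuous_adjoint hM)).const_smul (2⁻¹ : ℂ)

theorem continuous_imOp (hM : Continuous M) : Continuous fun x => imOp (M x) := by
  simp only [imOp_eq]
  exact (hM.sub (continuous_adjoint hM)).const_smul (-Complex.I * 2⁻¹ : ℂ)

theorem continuous_sqrt {B : X → 𝓗 →L[ℂ] 𝓗} (hB : Continuous B) (h0 : ∀ x, 0 ≤ B x) :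
    Continuous fun x => CFC.sqrt (B x) :=
  CFC.continuousOn_sqrt.comp_continuous hB h0

theorem continuous_sqrtIm (hM : Continuous M) (h0 : ∀ x, 0 ≤ imOp (M x)) :
    Continuous fun x => sqrtIm (M x) :=
  continuous_sqrt (continuous_imOp hM) h0

theorem continuous_invSqrtIm (hM : Continuous M) (h0 : ∀ x, 0 ≤ imOp (M x))
    (hu : ∀ x, IsUnit (imOp (M x))) : Continuous fun x => invSqrtIm (M x) := by
  refine continuous_iff_continuousAt.2 fun x => ?_
  obtain ⟨u, hux⟩ := isUnit_sqrtIm (h0 x) (hu x)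
  refine ContinuousAt.comp (g := Ring.inverse) ?_ (continuous_sqrtIm hM h0).continuousAt
  rw [← hux]
  exact NormedRing.inverse_continuousAt u

end Continuity

end Parts

/-! ### Gamma fields and Weyl functions -/

section PartialMaps

variable {E F G : Type*} [AddCommGroup E] [Module ℂ E] [AddCommGroup F] [Module ℂ F]
  [AddCommGroup G] [Module ℂ G]

theorem mem_graph_compPMap (g : F →ₗ[ℂ] G) {f : E →ₗ.[ℂ] F} {x : E} {y : F}
    (h : (x, y) ∈ f.graph) : (x, g y) ∈ (g.compPMap f).graph := by
  obtain ⟨x', hx, hy⟩ := f.mem_graph_iff.1 h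
  exact (g.compPMap f).mem_graph_iff.2 ⟨x', hx, congrArg g hy⟩

theorem mem_graph_sub {f g : E →ₗ.[ℂ] F} {x : E} {y y' : F} (h : (x, y) ∈ f.graph)
    (h' : (x, y') ∈ g.graph) : (x, y - y') ∈ (f - g).graph := by
  obtain ⟨⟨u, h1⟩, rfl, hy⟩ := f.mem_graph_iff.1 h
  obtain ⟨⟨u', h2⟩, rfl, hy'⟩ := g.mem_graph_iff.1 h'
  exact (f - g).mem_graph_iff.2 ⟨⟨u', h1, h2⟩, rfl, congrArg₂ (· - ·) hy hy'⟩

end PartialMaps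

set_option linter.unusedSectionVars false

namespace BoundaryTriplet

variable {E 𝓗 : Type*} [NormedAddCommGroup E] [InnerProductSpace ℂ E] [CompleteSpace E]
  [NormedAddCommGroup 𝓗] [InnerProductSpace ℂ 𝓗] [CompleteSpace 𝓗]
  {S : E →ₗ.[ℂ] E} (P : BoundaryTriplet S 𝓗)

theorem gammaField_apply_eq {z : ℂ} (hz : z.im ≠ 0) {h : 𝓗} {f : E} (hf : f ∈ defect S z)
    (h0 : (f, h) ∈ P.Γ₀.graph) : P.gammaField z h = f :=
  (P.isGamma_gammaField hz h f).2 ⟨hf, h0⟩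

theorem weyl_apply_eq {z : ℂ} (hz : z.im ≠ 0) {h k : 𝓗}
    (hk : (P.gammaField z h, k) ∈ P.Γ₁.graph) : P.weyl z h = k :=
  LinearPMap.mem_graph_snd_inj P.Γ₁ (P.isWeyl_weyl hz h) hk rfl

theorem gammaField_mem_defect (z : ℂ) (h : 𝓗) : P.gammaField z h ∈ defect S z := by
  rw [gammaField]
  split_ifs with hG
  · exact ((hG.choose_spec h _).1 rfl).1
  · exact zero_mem (defect S z)

/-- The gamma field as an operator from `𝓗` to `𝔥₊(S*)`. -/
def gammaLift (z : ℂ) : 𝓗 →L[ℂ] graphSpace S.adjoint :=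
  ((WithLp.prodContinuousLinearEquiv 2 ℂ E E).symm.toContinuousLinearMap.comp
    ((P.gammaField z).prod (z • P.gammaField z))).codRestrict _
      (fun h => P.gammaField_mem_defect z h)

theorem gammaLift_fst (z : ℂ) (h : 𝓗) : (P.gammaLift z h).1.fst = P.gammaField z h := rfl

theorem gammaLift_snd (z : ℂ) (h : 𝓗) : (P.gammaLift z h).1.snd = z • P.gammaField z h := rfl

theorem pre₀_gammaLift {z : ℂ} (hz : z.im ≠ 0) (h : 𝓗) : P.pre₀ (P.gammaLift z h) = h :=
  LinearPMap.mem_graph_snd_inj P.Γ₀ (hatMap_mem P.dom₀ (P.gammaLift z h))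
    ((P.isGamma_gammaField hz h _).1 rfl).2 rfl

theorem pre₁_gammaLift {z : ℂ} (hz : z.im ≠ 0) (h : 𝓗) :
    P.pre₁ (P.gammaLift z h) = P.weyl z h :=
  (P.weyl_apply_eq hz (hatMap_mem P.dom₁ (P.gammaLift z h))).symm

theorem norm_graphSpace_le {B : E →ₗ.[ℂ] E} (p : graphSpace B) :
    ‖p‖ ≤ ‖p.1.fst‖ + ‖p.1.snd‖ := by
  change ‖p.1‖ ≤ _
  rw [WithLp.prod_norm_eq_of_L2]
  refine Real.sqrt_le_iff.2 ⟨by positivity, ?_⟩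
  nlinarith [norm_nonneg p.1.fst, norm_nonneg p.1.snd]

/-- The difference `f = γ(z) h - γ(w) h` lies in the kernel of `Γ₀`, on which `S*` is symmetric, and
`(S* - z) f = (z - w) γ(w) h`. -/
theorem norm_gammaField_sub_le {z w : ℂ} (hz : z.im ≠ 0) (hw : w.im ≠ 0) :
    ‖P.gammaField z - P.gammaField w‖ ≤ ‖z - w‖ / |z.im| * ‖P.gammaField w‖ := by
  refine ContinuousLinearMap.opNorm_le_bound _ (by positivity) fun h => ?_
  set p := P.gammaLift z h - P.gammaLift w h with hp
  have h0 : P.pre₀ p = 0 := by rw [map_sub, P.pre₀_gammaLift hz, P.pre₀_gammaLift hw, sub_self]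
  have hfst : p.1.fst = P.gammaField z h - P.gammaField w h := rfl
  have hsnd : p.1.snd = z • p.1.fst + (z - w) • P.gammaField w h := by
    change z • P.gammaField z h - w • P.gammaField w h = _
    rw [hfst, smul_sub, sub_smul]
    abel
  have hs := P.green_pre p p
  rw [h0, inner_zero_left, inner_zero_right, sub_zero, sub_eq_zero] at hs
  have him : (⟪p.1.fst, p.1.snd⟫_ℂ).im = 0 :=
    Complex.conj_eq_iff_im.1 (by rw [inner_conj_symm]; exact hs)
  have h1 : ⟪p.1.fst, z • p.1.fst⟫_ℂ = z * ((‖p.1.fst‖ ^ 2 : ℝ) : ℂ) := by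
    rw [inner_smul_right, inner_self_eq_norm_sq_to_K]
    norm_cast
  rw [hsnd, inner_add_right, h1, Complex.add_im, Complex.im_mul_ofReal] at him
  have h2 : |z.im| * ‖p.1.fst‖ ^ 2 ≤ ‖p.1.fst‖ * (‖z - w‖ * ‖P.gammaField w h‖) := by
    have h3 := (Complex.abs_im_le_norm _).trans
      (norm_inner_le_norm (𝕜 := ℂ) p.1.fst ((z - w) • P.gammaField w h))
    rw [norm_smul] at h3
    have h4 : z.im * ‖p.1.fst‖ ^ 2 = -(⟪p.1.fst, (z - w) • P.gammaField w h⟫_ℂ).im := by linarith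
    have h5 := congrArg abs h4
    rw [abs_neg, abs_mul, abs_of_nonneg (sq_nonneg ‖p.1.fst‖)] at h5
    rw [h5]
    exact h3
  have hzpos : 0 < |z.im| := abs_pos.2 hz
  have h6 : |z.im| * ‖p.1.fst‖ ≤ ‖z - w‖ * ‖P.gammaField w h‖ := by
    rcases (norm_nonneg p.1.fst).eq_or_lt with h0 | h0
    · rw [← h0, mul_zero]; positivity
    · nlinarith
  have h7 := (P.gammaField w).le_opNorm h
  rw [sub_apply, ← hfst, div_mul_eq_mul_div, div_mul_eq_mul_div, le_div_iff₀ hzpos]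
  calc ‖p.1.fst‖ * |z.im| ≤ ‖z - w‖ * ‖P.gammaField w h‖ := by linarith
    _ ≤ ‖z - w‖ * (‖P.gammaField w‖ * ‖h‖) := by gcongr
    _ = _ := by ring

theorem eventually_im_ne_zero {w : ℂ} (hw : w.im ≠ 0) : ∀ᶠ z in nhds w, z.im ≠ 0 :=
  Complex.continuous_im.continuousAt.eventually_ne hw

theorem continuousAt_gammaField {w : ℂ} (hw : w.im ≠ 0) : ContinuousAt P.gammaField w := by
  refine tendsto_iff_norm_sub_tendsto_zero.2 ?_
  refine squeeze_zero' (.of_forall fun _ => norm_nonneg _)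
    ((eventually_im_ne_zero hw).mono fun z hz => P.norm_gammaField_sub_le hz hw) ?_
  have hc : ContinuousAt (fun z : ℂ => ‖z - w‖ / |z.im| * ‖P.gammaField w‖) w :=
    ((by fun_prop : ContinuousAt (fun z : ℂ => ‖z - w‖) w).div
      (by fun_prop) (abs_ne_zero.2 hw)).mul continuousAt_const
  simpa [ContinuousAt] using hc

theorem continuousAt_gammaLift {w : ℂ} (hw : w.im ≠ 0) : ContinuousAt P.gammaLift w := by
  have hG := P.continuousAt_gammaField hw
  refine (tendsto_iff_norm_sub_tendsto_zero (E := 𝓗 →L[ℂ] graphSpace S.adjoint)).2 ?_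
  refine squeeze_zero' (.of_forall fun z => norm_nonneg (P.gammaLift z - P.gammaLift w))
    (.of_forall fun z => (P.gammaLift z - P.gammaLift w).opNorm_le_bound
      (M := ‖P.gammaField z - P.gammaField w‖ + ‖z • P.gammaField z - w • P.gammaField w‖)
      (by positivity) fun h => ?_) ?_
  · refine (norm_graphSpace_le _).trans ?_
    rw [add_mul]
    exact add_le_add ((P.gammaField z - P.gammaField w).le_opNorm h)
      ((z • P.gammaField z - w • P.gammaField w).le_opNorm h)
  · have hc : ContinuousAt (fun z : ℂ => ‖P.gammaField z - P.gammaField w‖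
        + ‖z • P.gammaField z - w • P.gammaField w‖) w :=
      (hG.sub continuousAt_const).norm.add ((continuousAt_id.smul hG).sub continuousAt_const).norm
    simpa [ContinuousAt] using hc

theorem im_sub_ofReal_ne {z : ℂ} (hz : z.im ≠ 0) (t : ℝ) : (z - t).im ≠ 0 := by simpa using hz

theorem continuous_sub_ofReal_comp {X : Type*} [TopologicalSpace X] {f : ℂ → X}
    (hf : ∀ w : ℂ, w.im ≠ 0 → ContinuousAt f w) {z : ℂ} (hz : z.im ≠ 0) :
    Continuous fun t : ℝ => f (z - t) :=
  continuous_iff_continuousAt.2 fun t =>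
    (hf _ (im_sub_ofReal_ne hz t)).comp (f := fun t : ℝ => z - t) (by fun_prop)

theorem weyl_eq_comp {z : ℂ} (hz : z.im ≠ 0) : P.weyl z = P.hat₁.comp (P.gammaLift z) :=
  ContinuousLinearMap.ext fun h => (P.pre₁_gammaLift hz h).symm

theorem continuousAt_weyl {w : ℂ} (hw : w.im ≠ 0) : ContinuousAt P.weyl w := by
  have h1 : ContinuousAt (fun z => P.hat₁.comp (P.gammaLift z)) w :=
    tendsto_clm_comp tendsto_const_nhds (P.continuousAt_gammaLift hw)
  exact h1.congr ((eventually_im_ne_zero hw).mono fun z hz => (P.weyl_eq_comp hz).symm)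

/-- Green's identity for the vectors `γ(w) k` and `γ(z) h`. -/
theorem inner_weyl_sub {z w : ℂ} (hz : z.im ≠ 0) (hw : w.im ≠ 0) (k h : 𝓗) :
    ⟪k, P.weyl z h⟫_ℂ - ⟪P.weyl w k, h⟫_ℂ
      = (z - starRingEnd ℂ w) * ⟪P.gammaField w k, P.gammaField z h⟫_ℂ := by
  have := P.green_pre (P.gammaLift w k) (P.gammaLift z h)
  rw [P.pre₀_gammaLift hw, P.pre₀_gammaLift hz, P.pre₁_gammaLift hw, P.pre₁_gammaLift hz,
    gammaLift_fst, gammaLift_snd, gammaLift_fst, gammaLift_snd, inner_smul_left,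
    inner_smul_right] at this
  linear_combination this

theorem inner_weyl_conj {z : ℂ} (hz : z.im ≠ 0) (k h : 𝓗) :
    ⟪P.weyl (starRingEnd ℂ z) k, h⟫_ℂ = ⟪k, P.weyl z h⟫_ℂ := by
  have := P.inner_weyl_sub hz (w := starRingEnd ℂ z) (by simpa using hz) k h
  rw [Complex.conj_conj, sub_self, zero_mul, sub_eq_zero] at this
  exact this.symm

/-- `Im M(z) = Im z • γ(z)* γ(z)`. -/
theorem imOp_weyl {z : ℂ} (hz : z.im ≠ 0) : imOp (P.weyl z)
    = (z.im : ℂ) • (ContinuousLinearMap.adjoint (P.gammaField z)).comp (P.gammaField z) := by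
  refine ContinuousLinearMap.ext fun h => ext_inner_left ℂ fun k => ?_
  have h1 := P.inner_weyl_sub hz hz k h
  have h2 : z - starRingEnd ℂ z = 2 * z.im * Complex.I := by
    rw [Complex.sub_conj]; push_cast; ring
  rw [imOp_eq, smul_apply, smul_apply, sub_apply, inner_smul_right, inner_smul_right,
    inner_sub_right, ContinuousLinearMap.adjoint_inner_right, h1, h2,
    ContinuousLinearMap.comp_apply, ContinuousLinearMap.adjoint_inner_right]
  linear_combination (-(z.im : ℂ) * ⟪P.gammaField z k, P.gammaField z h⟫_ℂ) * Complex.I_sq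

theorem imOp_weyl_nonneg {z : ℂ} (hz : 0 < z.im) : 0 ≤ imOp (P.weyl z) := by
  rw [P.imOp_weyl hz.ne']
  have h1 : 0 ≤ (ContinuousLinearMap.adjoint (P.gammaField z)).comp (P.gammaField z) :=
    (ContinuousLinearMap.nonneg_iff_isPositive _).2
      (ContinuousLinearMap.isPositive_adjoint_comp_self _)
  rw [Complex.coe_smul]
  exact smul_nonneg hz.le h1

/-- `γ(z)` is bounded below, because `Γ̂₀` is bounded and the graph norm on the defect subspace is
equivalent to the norm. -/
theorem exists_le_norm_gammaField {z : ℂ} (hz : z.im ≠ 0) :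
    ∃ c > 0, ∀ h, c * ‖h‖ ≤ ‖P.gammaField z h‖ := by
  set C := ‖P.hat₀‖ * (1 + ‖z‖) + 1 with hC
  have hCpos : 0 < C := by positivity
  refine ⟨C⁻¹, inv_pos.2 hCpos, fun h => ?_⟩
  rw [inv_mul_le_iff₀ hCpos]
  have h1 : ‖h‖ ≤ ‖P.hat₀‖ * ‖P.gammaLift z h‖ := by
    conv_lhs => rw [← P.pre₀_gammaLift hz h]
    exact P.hat₀.le_opNorm _
  have h2 := norm_graphSpace_le (P.gammaLift z h)
  rw [gammaLift_fst, gammaLift_snd, norm_smul] at h2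
  calc ‖h‖ ≤ ‖P.hat₀‖ * (‖P.gammaField z h‖ + ‖z‖ * ‖P.gammaField z h‖) := by
        refine h1.trans ?_
        gcongr
    _ ≤ C * ‖P.gammaField z h‖ := by
        rw [hC]
        nlinarith [norm_nonneg (P.gammaField z h)]

theorem isUnit_imOp_weyl {z : ℂ} (hz : z.im ≠ 0) : IsUnit (imOp (P.weyl z)) := by
  obtain ⟨c, hc, hb⟩ := P.exists_le_norm_gammaField hz
  have hpos : 0 < |z.im| * c ^ 2 := mul_pos (abs_pos.2 hz) (pow_pos hc 2)
  refine ContinuousLinearMap.isUnit_of_forall_le_norm_inner_map _ (c := ⟨_, hpos.le⟩) hpos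
    fun h => ?_
  rw [P.imOp_weyl hz, smul_apply, inner_smul_left, ContinuousLinearMap.comp_apply,
    ContinuousLinearMap.adjoint_inner_left, inner_self_eq_norm_sq_to_K, norm_mul]
  simp only [Complex.conj_ofReal, Complex.norm_real, Real.norm_eq_abs, norm_pow, abs_norm,
    Complex.coe_algebraMap]
  change ‖h‖ ^ 2 * (|z.im| * c ^ 2) ≤ _
  have h1 := pow_le_pow_left₀ (by positivity) (hb h) 2
  rw [mul_pow] at h1
  nlinarith [abs_pos.2 hz]

/-! ### Scalar type -/

/-- The quadratic form of the Weyl function is a Nevanlinna function. -/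
theorem isNevanlinna_inner_weyl (e : 𝓗) : IsNevanlinna fun z => ⟪e, P.weyl z e⟫_ℂ where
  holo := by
    intro w hw
    have hw' : w.im ≠ 0 := hw
    refine DifferentiableAt.differentiableWithinAt (HasDerivAt.differentiableAt
      (f' := ⟪P.gammaField (starRingEnd ℂ w) e, P.gammaField w e⟫_ℂ) ?_)
    rw [hasDerivAt_iff_tendsto_slope]
    have hc : ContinuousAt
        (fun z => ⟪P.gammaField (starRingEnd ℂ w) e, P.gammaField z e⟫_ℂ) w :=
      ContinuousAt.inner continuousAt_const
        ((P.continuousAt_gammaField hw').clm_apply continuousAt_const)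
    refine (hc.tendsto.mono_left nhdsWithin_le_nhds).congr' ?_
    filter_upwards [self_mem_nhdsWithin,
      nhdsWithin_le_nhds (eventually_im_ne_zero hw')] with z h1 h2
    have h3 : z - w ≠ 0 := sub_ne_zero.2 h1
    have h4 := P.inner_weyl_sub h2 (w := starRingEnd ℂ w) (by simpa using hw') e e
    rw [P.inner_weyl_conj hw', Complex.conj_conj] at h4
    rw [slope_def_field, h4]
    field_simp
  conj z hz := by rw [inner_conj_symm, ← P.inner_weyl_conj (by simpa using hz), Complex.conj_conj]
  nonneg z hz := by
    have h1 := P.inner_weyl_sub hz hz e e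
    rw [Complex.sub_conj, inner_self_eq_norm_sq_to_K, ← inner_conj_symm (P.weyl z e),
      Complex.sub_conj] at h1
    have h2 := congrArg Complex.im h1
    have h3 : (⟪e, P.weyl z e⟫_ℂ).im = z.im * ‖P.gammaField z e‖ ^ 2 := by
      have h4 : ((2 * z.im : ℝ) : ℂ) * Complex.I * (‖P.gammaField z e‖ : ℂ) ^ 2
          = ((2 * (z.im * ‖P.gammaField z e‖ ^ 2) : ℝ) : ℂ) * Complex.I := by
        push_cast; ring
      simp only [Complex.coe_algebraMap] at h2
      rw [h4, Complex.im_ofReal_mul, Complex.im_ofReal_mul, Complex.I_im] at h2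
      linarith
    rw [h3, mul_div_assoc, mul_comm, div_mul_cancel₀ _ hz]
    positivity

/-- `γ(i)` maps `𝓗` bijectively onto the defect subspace at `i`, so that `𝓗` is one-dimensional. -/
theorem exists_isScalarType (h1 : Module.finrank ℂ (defect S Complex.I) = 1) :
    ∃ m : ℂ → ℂ, IsScalarType P.weyl m := by
  have hI : Complex.I.im ≠ 0 := by simp
  have hG := P.isGamma_gammaField hI
  let L : 𝓗 →ₗ[ℂ] defect S Complex.I :=
    (P.gammaField Complex.I).toLinearMap.codRestrict _ fun h => P.gammaField_mem_defect _ h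
  have hL : Function.Bijective L := by
    constructor
    · intro h h' hh
      have h2 : P.gammaField Complex.I h = P.gammaField Complex.I h' := congrArg Subtype.val hh
      rw [← P.pre₀_gammaLift hI h, ← P.pre₀_gammaLift hI h']
      congr 1
      refine graphEmb_injective _ ?_
      exact h2
    · intro f
      have hf : (f : E) ∈ P.Γ₀.domain := P.dom₀.ge (LinearPMap.mem_domain_of_mem_graph f.2)
      exact ⟨P.Γ₀ ⟨f, hf⟩, Subtype.ext
        (P.gammaField_apply_eq hI f.2 (P.Γ₀.mem_graph ⟨(f : E), hf⟩))⟩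
  rw [← (LinearEquiv.ofBijective L hL).finrank_eq, finrank_eq_one_iff'] at h1
  obtain ⟨e, he, hspan⟩ := h1
  have hne : (‖e‖ : ℂ) ≠ 0 := by simpa using he
  set u : 𝓗 := ((‖e‖ : ℂ)⁻¹) • e with hu
  have huu : ⟪u, u⟫_ℂ = 1 := by
    rw [hu, inner_smul_left, inner_smul_right, inner_self_eq_norm_sq_to_K]
    simp only [map_inv₀, Complex.conj_ofReal, Complex.coe_algebraMap]
    field_simp
  have hspan' : ∀ w, ∃ c : ℂ, c • u = w := by
    intro w
    obtain ⟨c, rfl⟩ := hspan w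
    exact ⟨c * ‖e‖, by rw [hu, smul_smul, mul_assoc, mul_inv_cancel₀ hne, mul_one]⟩
  refine ⟨_, P.isNevanlinna_inner_weyl u, fun z _ => ContinuousLinearMap.ext fun w => ?_⟩
  obtain ⟨c, rfl⟩ := hspan' w
  obtain ⟨d, hd⟩ := hspan' (P.weyl z u)
  rw [map_smul, ← hd, inner_smul_right, huu, mul_one, smul_apply]
  exact smul_comm c d u

/-! ### Restriction to the kernel of `Γ₀` -/

theorem mem_graph_kerRestrict {B : E →ₗ.[ℂ] E} {Γ : E →ₗ.[ℂ] 𝓗} {f v : E} :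
    (f, v) ∈ (kerRestrict B Γ).graph ↔ (f, v) ∈ B.graph ∧ (f, (0 : 𝓗)) ∈ Γ.graph := by
  constructor
  · intro h
    refine ⟨LinearPMap.le_graph_of_le LinearPMap.domRestrict_le h, ?_⟩
    obtain ⟨y, hy, hyf⟩ := (LinearPMap.mem_domain_of_mem_graph h).1
    have hy0 : Γ y = 0 := hy
    rw [LinearPMap.mem_graph_iff]
    exact ⟨y, hyf, hy0⟩
  · rintro ⟨h1, h2⟩
    obtain ⟨y, hy, hy0⟩ := Γ.mem_graph_iff.1 h2
    obtain ⟨x, hx, hxv⟩ := B.mem_graph_iff.1 h1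
    have hf : f ∈ (kerRestrict B Γ).domain := by
      refine ⟨⟨y, hy0, hy⟩, ?_⟩
      have := x.2
      rwa [hx] at this
    refine (kerRestrict B Γ).mem_graph_iff.2 ⟨⟨f, hf⟩, rfl, ?_⟩
    rw [← hxv]
    exact LinearPMap.domRestrict_apply hx.symm

/-- By Green's identity, the condition `Γ₀ f = 0` is the closed condition that the boundary form of
`f` with every element of the kernel of `Γ₀` vanishes. -/
theorem isClosed_kerRestrict : (kerRestrict S.adjoint P.Γ₀).IsClosed := by
  have h : ((kerRestrict S.adjoint P.Γ₀).graph : Set (E × E)) = (S.adjoint.graph : Set (E × E)) ∩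
      ⋂ q : {q : graphSpace S.adjoint // P.pre₀ q = 0},
        {x : E × E | ⟪x.2, q.1.1.fst⟫_ℂ - ⟪x.1, q.1.1.snd⟫_ℂ = 0} := by
    ext ⟨f, v⟩
    rw [SetLike.mem_coe, mem_graph_kerRestrict, Set.mem_inter_iff, Set.mem_iInter, SetLike.mem_coe]
    refine and_congr_right fun hfv => ?_
    set p : graphSpace S.adjoint := ⟨WithLp.toLp 2 (f, v), hfv⟩
    have hp : (f, P.pre₀ p) ∈ P.Γ₀.graph := hatMap_mem P.dom₀ p
    have hgreen : ∀ q : graphSpace S.adjoint, P.pre₀ q = 0 →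
        ⟪v, q.1.fst⟫_ℂ - ⟪f, q.1.snd⟫_ℂ = -⟪P.pre₀ p, P.pre₁ q⟫_ℂ := by
      intro q hq
      have := P.green_pre p q
      rw [hq, inner_zero_right, zero_sub] at this
      exact this
    constructor
    · intro h0 q
      have hp0 : P.pre₀ p = 0 := LinearPMap.mem_graph_snd_inj P.Γ₀ hp h0 rfl
      rw [Set.mem_ofPred_eq, hgreen q.1 q.2, hp0, inner_zero_left, neg_zero]
    · intro hq
      obtain ⟨q, hq0, hq1⟩ := P.surj_pre 0 (P.pre₀ p)
      have := hq ⟨q, hq0⟩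
      rw [Set.mem_ofPred_eq, hgreen q hq0, hq1, neg_eq_zero] at this
      rw [inner_self_eq_zero.1 this] at hp
      exact hp
  rw [LinearPMap.IsClosed, h]
  refine (LinearPMap.adjoint_isClosed P.dense).inter (isClosed_iInter fun q => ?_)
  exact isClosed_eq (by fun_prop) continuous_const

/-! ### Linear transformations of boundary triplets -/

section Transform

variable (R R' Q : 𝓗 →L[ℂ] 𝓗) (hR : IsSelfAdjoint R) (hQ : IsSelfAdjoint Q) (hRR' : R * R' = 1)
  (hR'R : R' * R = 1)

/-- The boundary triplet with the maps `R Γ₀` and `R⁻¹ (Γ₁ - Q Γ₀)`, for self-adjoint `R` and `Q`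
with `R` invertible; `R'` is the inverse of `R`. -/
def transform : BoundaryTriplet S 𝓗 where
  dense := P.dense
  symm := P.symm
  Γ₀ := R.toLinearMap.compPMap P.Γ₀
  Γ₁ := R'.toLinearMap.compPMap (P.Γ₁ - Q.toLinearMap.compPMap P.Γ₀)
  dom₀ := P.dom₀
  dom₁ := by
    change P.Γ₁.domain ⊓ P.Γ₀.domain = _
    rw [P.dom₀, P.dom₁, inf_idem]
  green f g := by
    have h1 : ∀ x y : 𝓗, ⟪R' x, R y⟫_ℂ = ⟪x, y⟫_ℂ := fun x y => by
      rw [← ContinuousLinearMap.adjoint_inner_left, hR.adjoint_eq, ← mul_apply_eq_comp, hRR']; rfl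
    have h2 : ∀ x y : 𝓗, ⟪R x, R' y⟫_ℂ = ⟪x, y⟫_ℂ := fun x y => by
      rw [← ContinuousLinearMap.adjoint_inner_right, hR.adjoint_eq, ← mul_apply_eq_comp, hRR']; rfl
    have h3 : ∀ x y : 𝓗, ⟪Q x, y⟫_ℂ = ⟪x, Q y⟫_ℂ := fun x y => by
      rw [← ContinuousLinearMap.adjoint_inner_right, hQ.adjoint_eq]
    rw [P.green f g]
    symm
    refine (congrArg₂ (· - ·) (h1 _ _) (h2 _ _)).trans ?_
    refine (congrArg₂ (· - ·) (inner_sub_left _ _ _) (inner_sub_right _ _ _)).trans ?_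
    have h4 := h3 (P.Γ₀ ⟨f, P.dom₀.ge f.2⟩) (P.Γ₀ ⟨g, P.dom₀.ge g.2⟩)
    refine (congrArg₂ (· - ·) (congrArg₂ (· - ·) rfl h4) rfl).trans ?_
    exact sub_sub_sub_cancel_right _ _ _
  surj h₀ h₁ := by
    have h1 : ∀ x : 𝓗, R (R' x) = x := fun x => by rw [← mul_apply_eq_comp, hRR']; rfl
    have h2 : ∀ x : 𝓗, R' (R x) = x := fun x => by rw [← mul_apply_eq_comp, hR'R]; rfl
    obtain ⟨f, hf0, hf1⟩ := P.surj (R' h₀) (R h₁ + Q (R' h₀))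
    refine ⟨f, (congrArg R hf0).trans (h1 _), ?_⟩
    refine (congrArg R' (congrArg₂ (· - ·) hf1 (congrArg Q hf0))).trans ?_
    rw [add_sub_cancel_right, h2]

theorem transform_gammaField {z : ℂ} (hz : z.im ≠ 0) :
    (P.transform R R' Q hR hQ hRR' hR'R).gammaField z = (P.gammaField z).comp R' := by
  refine ContinuousLinearMap.ext fun h => gammaField_apply_eq _ hz (P.gammaField_mem_defect z _) ?_
  have := mem_graph_compPMap R.toLinearMap ((P.isGamma_gammaField hz (R' h) _).1 rfl).2
  have h1 : R.toLinearMap (R' h) = h := congrArg (fun B : 𝓗 →L[ℂ] 𝓗 => B h) hRR'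
  rw [h1] at this
  exact this

theorem transform_weyl {z : ℂ} (hz : z.im ≠ 0) :
    (P.transform R R' Q hR hQ hRR' hR'R).weyl z = R' * (P.weyl z - Q) * R' := by
  refine ContinuousLinearMap.ext fun h => weyl_apply_eq _ hz ?_
  rw [transform_gammaField _ _ _ _ _ _ _ _ hz]
  exact mem_graph_compPMap R'.toLinearMap (mem_graph_sub (P.isWeyl_weyl hz (R' h))
    (mem_graph_compPMap Q.toLinearMap ((P.isGamma_gammaField hz (R' h) _).1 rfl).2))

end Transform

theorem kerRestrict_compPMap {R R' : 𝓗 →L[ℂ] 𝓗} (hR'R : R' * R = 1) (B : E →ₗ.[ℂ] E)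
    (Γ : E →ₗ.[ℂ] 𝓗) :
    kerRestrict B (R.toLinearMap.compPMap Γ) = kerRestrict B Γ := by
  have hinj : Function.Injective R := Function.LeftInverse.injective (g := R') fun x =>
    congrArg (fun B : 𝓗 →L[ℂ] 𝓗 => B x) hR'R
  have : LinearMap.ker (R.toLinearMap.compPMap Γ).toFun = LinearMap.ker Γ.toFun :=
    LinearMap.ker_comp_of_ker_eq_bot _ (LinearMap.ker_eq_bot.2 hinj)
  unfold kerRestrict
  rw [this]
  rfl

end BoundaryTriplet

/-! ### The adjoint of `A ⊗ I + I ⊗ T` -/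

section Pairing

variable {X : Type*} [NormedAddCommGroup X] [InnerProductSpace ℂ X]

/-- The functional `(x, y) ↦ ⟪u, y⟫ - ⟪v, x⟫`. A pair `(u, v)` belongs to the graph of `S*` if and
only if this functional vanishes on the graph of `S`. -/
def graphPairing (u v : X) : X × X →L[ℂ] ℂ :=
  (innerSL ℂ u).comp (.snd ℂ X X) - (innerSL ℂ v).comp (.fst ℂ X X)

theorem graphPairing_apply (u v x y : X) : graphPairing u v (x, y) = ⟪u, y⟫_ℂ - ⟪v, x⟫_ℂ := rfl

theorem mem_graph_adjoint_iff [CompleteSpace X] {S : X →ₗ.[ℂ] X} (hS : Dense (S.domain : Set X))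
    {u v : X} : (u, v) ∈ S.adjoint.graph ↔
      S.graph ≤ LinearMap.ker (graphPairing u v).toLinearMap := by
  rw [LinearPMap.adjoint_graph_eq_graph_adjoint hS, Submodule.mem_adjoint_iff]
  have key : ∀ x y, ⟪y, u⟫_ℂ - ⟪x, v⟫_ℂ = 0 ↔ graphPairing u v (x, y) = 0 := by
    intro x y
    rw [graphPairing_apply, ← inner_conj_symm, ← inner_conj_symm x, ← map_sub, map_eq_zero]
  exact ⟨fun h p hp => (key _ _).1 (h p.1 p.2 hp), fun h x y hxy => (key _ _).2 (h hxy)⟩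

end Pairing

section AlgTensorSum

variable {E 𝔗 : Type*} [NormedAddCommGroup E] [InnerProductSpace ℂ E]
  [NormedAddCommGroup 𝔗] [InnerProductSpace ℂ 𝔗]

/-- The values of `B ⊙ I + I ⊙ T` on `dom B ⊙ 𝔗`. -/
def domTensorVal (B : E →ₗ.[ℂ] E) (T : 𝔗 →L[ℂ] 𝔗) : B.domain ⊗[ℂ] 𝔗 →ₗ[ℂ] HTensor E 𝔗 :=
  UniformSpace.Completion.toComplL.toLinearMap ∘ₗ
    (B.toFun.rTensor 𝔗 + TensorProduct.map B.domain.subtype T.toLinearMap)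

theorem algTensorSum_apply (B : E →ₗ.[ℂ] E) (T : 𝔗 →L[ℂ] 𝔗) (x : B.domain ⊗[ℂ] 𝔗) :
    algTensorSum B T ⟨domTensorIncl B x, ⟨x, rfl⟩⟩ = domTensorVal B T x := by
  have h1 : (LinearEquiv.ofInjective (domTensorIncl (𝔗 := 𝔗) B) (domTensorIncl_injective B)).symm
      ⟨domTensorIncl B x, ⟨x, rfl⟩⟩ = x := by
    rw [LinearEquiv.symm_apply_eq]; rfl
  exact congrArg (domTensorVal B T) h1

theorem elem_zero_left (h : 𝔗) : elem (0 : E) h = 0 := by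
  simpa using elem_smul_left 0 (0 : E) h

theorem domTensorVal_tmul (B : E →ₗ.[ℂ] E) (T : 𝔗 →L[ℂ] 𝔗) (g : B.domain) (h : 𝔗) :
    domTensorVal B T (g ⊗ₜ[ℂ] h) = elem (B g) h + elem (g : E) (T h) :=
  UniformSpace.Completion.coe_add (B g ⊗ₜ[ℂ] h : E ⊗[ℂ] 𝔗) ((g : E) ⊗ₜ[ℂ] T h)

theorem elem_mem_graph_algTensorSum (B : E →ₗ.[ℂ] E) (T : 𝔗 →L[ℂ] 𝔗) (g : B.domain) (h : 𝔗) :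
    (elem (g : E) h, elem (B g) h + elem (g : E) (T h)) ∈ (algTensorSum B T).graph := by
  rw [← domTensorVal_tmul, ← algTensorSum_apply]
  exact (algTensorSum B T).mem_graph ⟨domTensorIncl B (g ⊗ₜ[ℂ] h), ⟨_, rfl⟩⟩

/-- The graph of `B ⊙ I + I ⊙ T` is spanned by the pairs `(g ⊗ h, B g ⊗ h + g ⊗ T h)`. -/
theorem graph_algTensorSum_le {B : E →ₗ.[ℂ] E} {T : 𝔗 →L[ℂ] 𝔗}
    {N : Submodule ℂ (HTensor E 𝔗 × HTensor E 𝔗)}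
    (hN : ∀ (g : B.domain) (h : 𝔗), (elem (g : E) h, elem (B g) h + elem (g : E) (T h)) ∈ N) :
    (algTensorSum B T).graph ≤ N := by
  have key : ∀ x : B.domain ⊗[ℂ] 𝔗, (domTensorIncl B).prod (domTensorVal B T) x ∈ N := by
    intro x
    induction x with
    | zero => rw [map_zero]; exact N.zero_mem
    | tmul g h =>
      have := hN g h
      rw [← domTensorVal_tmul] at this
      exact this
    | add x y hx hy => rw [map_add]; exact N.add_mem hx hy
  rintro ⟨u, v⟩ huv
  obtain ⟨⟨_, x, rfl⟩, hu, hv⟩ := (algTensorSum B T).mem_graph_iff.1 huv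
  rw [algTensorSum_apply] at hv
  have h1 : (domTensorIncl B x, domTensorVal B T x) ∈ N := key x
  rw [hv] at h1
  dsimp only at hu h1
  rwa [hu] at h1

variable [CompleteSpace E] [CompleteSpace 𝔗]

theorem dense_algTensorSum {B : E →ₗ.[ℂ] E} (hB : Dense (B.domain : Set E)) (T : 𝔗 →L[ℂ] 𝔗) :
    Dense ((algTensorSum B T).domain : Set (HTensor E 𝔗)) := by
  rw [Submodule.dense_iff_topologicalClosure_eq_top, Submodule.topologicalClosure_eq_top_iff,
    Submodule.eq_bot_iff]
  intro u hu
  have h := tmap_eq_zero_of_inner (.id ℂ E) u B.domain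
    (fun x => by rw [(Submodule.dense_iff_topologicalClosure_eq_top).1 hB]; trivial)
    fun x hx y => (Submodule.mem_orthogonal' _ _).1 hu _
      (LinearPMap.mem_domain_of_mem_graph (elem_mem_graph_algTensorSum B T ⟨x, hx⟩ y))
  rwa [tmap_id_id] at h

theorem mem_graph_adjoint_algTensorSum {B : E →ₗ.[ℂ] E} (hB : Dense (B.domain : Set E))
    {T : 𝔗 →L[ℂ] 𝔗} {u v : HTensor E 𝔗} : (u, v) ∈ (algTensorSum B T).adjoint.graph ↔
      ∀ (g : B.domain) (h : 𝔗),
        ⟪u, elem (B g) h + elem (g : E) (T h)⟫_ℂ = ⟪v, elem (g : E) h⟫_ℂ := by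
  rw [mem_graph_adjoint_iff (dense_algTensorSum hB T)]
  constructor
  · intro H g h
    have h1 := H (elem_mem_graph_algTensorSum B T g h)
    rw [LinearMap.mem_ker, ContinuousLinearMap.coe_coe, graphPairing_apply, sub_eq_zero] at h1
    exact h1
  · refine fun H => graph_algTensorSum_le fun g h => ?_
    rw [LinearMap.mem_ker, ContinuousLinearMap.coe_coe, graphPairing_apply, sub_eq_zero]
    exact H g h

theorem inner_map_of_isSelfAdjoint {T : 𝔗 →L[ℂ] 𝔗} (hT : IsSelfAdjoint T) (x y : 𝔗) :
    ⟪T x, y⟫_ℂ = ⟪x, T y⟫_ℂ := by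
  rw [← ContinuousLinearMap.adjoint_inner_right, hT.adjoint_eq]

theorem algTensorSum_le_adjoint {A : E →ₗ.[ℂ] E} {T : 𝔗 →L[ℂ] 𝔗}
    (hA : Dense (A.domain : Set E)) (hsym : A.IsFormalAdjoint A) (hT : IsSelfAdjoint T) :
    algTensorSum A T ≤ (algTensorSum A T).adjoint := by
  refine LinearPMap.le_of_le_graph (graph_algTensorSum_le fun g h => ?_)
  refine (mem_graph_adjoint_algTensorSum hA).2 fun g' h' => ?_
  simp only [inner_add_right, inner_add_left, inner_elem, hsym g g',
    inner_map_of_isSelfAdjoint hT]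

theorem isClosable_algTensorSum {A : E →ₗ.[ℂ] E} {T : 𝔗 →L[ℂ] 𝔗}
    (hA : Dense (A.domain : Set E)) (hsym : A.IsFormalAdjoint A) (hT : IsSelfAdjoint T) :
    (algTensorSum A T).IsClosable :=
  (LinearPMap.adjoint_isClosed (dense_algTensorSum hA T)).isClosable.leIsClosable
    (algTensorSum_le_adjoint hA hsym hT)

theorem graph_tensorSum {A : E →ₗ.[ℂ] E} {T : 𝔗 →L[ℂ] 𝔗}
    (hA : Dense (A.domain : Set E)) (hsym : A.IsFormalAdjoint A) (hT : IsSelfAdjoint T) :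
    (tensorSum A T).graph = (algTensorSum A T).graph.topologicalClosure :=
  (isClosable_algTensorSum hA hsym hT).graph_closure_eq_closure_graph.symm

theorem dense_tensorSum {A : E →ₗ.[ℂ] E} (hA : Dense (A.domain : Set E)) (T : 𝔗 →L[ℂ] 𝔗) :
    Dense ((tensorSum A T).domain : Set (HTensor E 𝔗)) :=
  (dense_algTensorSum hA T).mono (LinearPMap.le_closure (algTensorSum A T)).1

/-- An operator and its closure have the same adjoint. -/
theorem adjoint_tensorSum {A : E →ₗ.[ℂ] E} {T : 𝔗 →L[ℂ] 𝔗}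
    (hA : Dense (A.domain : Set E)) (hsym : A.IsFormalAdjoint A) (hT : IsSelfAdjoint T) :
    (tensorSum A T).adjoint = (algTensorSum A T).adjoint := by
  refine LinearPMap.eq_of_eq_graph (Submodule.ext fun ⟨u, v⟩ => ?_)
  rw [mem_graph_adjoint_iff (dense_tensorSum hA T),
    mem_graph_adjoint_iff (dense_algTensorSum hA T), graph_tensorSum hA hsym hT]
  exact ⟨fun H => (Submodule.le_topologicalClosure _).trans H,
    fun H => Submodule.topologicalClosure_minimal _ H (graphPairing u v).isClosed_ker⟩

theorem isFormalAdjoint_tensorSum {A : E →ₗ.[ℂ] E} {T : 𝔗 →L[ℂ] 𝔗}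
    (hA : Dense (A.domain : Set E)) (hsym : A.IsFormalAdjoint A) (hT : IsSelfAdjoint T) :
    (tensorSum A T).IsFormalAdjoint (tensorSum A T) := by
  have hle : (tensorSum A T).graph ≤ (tensorSum A T).adjoint.graph := by
    rw [adjoint_tensorSum hA hsym hT, graph_tensorSum hA hsym hT]
    exact Submodule.topologicalClosure_minimal _
      (LinearPMap.le_graph_of_le (algTensorSum_le_adjoint hA hsym hT))
      (LinearPMap.adjoint_isClosed (dense_algTensorSum hA T))
  intro x y
  have h := (mem_graph_adjoint_iff (dense_tensorSum hA T)).1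
    (hle ((tensorSum A T).mem_graph x)) ((tensorSum A T).mem_graph y)
  exact (sub_eq_zero.1 h).symm

end AlgTensorSum

section AdjointGraph

variable {E 𝔗 : Type*} [NormedAddCommGroup E] [InnerProductSpace ℂ E] [CompleteSpace E]
  [NormedAddCommGroup 𝔗] [InnerProductSpace ℂ 𝔗] [CompleteSpace 𝔗]

/-- The operator `B`, regarded as a bounded operator from `𝔥₊(B)`. -/
def graphVal (B : E →ₗ.[ℂ] E) : graphSpace B →L[ℂ] E :=
  (WithLp.sndL 2 ℂ E E).comp (graphSpace B).subtypeL

variable (E) in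
/-- The embedding of the first summand in `E ⊕ E`. -/
def inclFst : E →L[ℂ] WithLp 2 (E × E) :=
  (WithLp.prodContinuousLinearEquiv 2 ℂ E E).symm.toContinuousLinearMap.comp (.inl ℂ E E)

variable (E) in
/-- The embedding of the second summand in `E ⊕ E`. -/
def inclSnd : E →L[ℂ] WithLp 2 (E × E) :=
  (WithLp.prodContinuousLinearEquiv 2 ℂ E E).symm.toContinuousLinearMap.comp (.inr ℂ E E)

theorem adjoint_inclFst :
    ContinuousLinearMap.adjoint (inclFst E) = WithLp.fstL 2 ℂ E E := by
  symm
  rw [ContinuousLinearMap.eq_adjoint_iff]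
  intro p x
  rw [WithLp.prod_inner_apply]
  change _ = ⟪p.fst, x⟫_ℂ + ⟪p.snd, (0 : E)⟫_ℂ
  rw [inner_zero_right, add_zero]
  rfl

theorem adjoint_inclSnd :
    ContinuousLinearMap.adjoint (inclSnd E) = WithLp.sndL 2 ℂ E E := by
  symm
  rw [ContinuousLinearMap.eq_adjoint_iff]
  intro p x
  rw [WithLp.prod_inner_apply]
  change _ = ⟪p.fst, (0 : E)⟫_ℂ + ⟪p.snd, x⟫_ℂ
  rw [inner_zero_right, zero_add]
  rfl

/-- The pairs `(-A g, g)`, whose orthogonal complement in `E ⊕ E` is the graph of `A*`. -/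
def rotatedGraph (A : E →ₗ.[ℂ] E) : Submodule ℂ (WithLp 2 (E × E)) :=
  LinearMap.range ((inclSnd E).toLinearMap ∘ₗ A.domain.subtype - (inclFst E).toLinearMap ∘ₗ A.toFun)

theorem orthogonal_rotatedGraph {A : E →ₗ.[ℂ] E} (hA : Dense (A.domain : Set E)) :
    (rotatedGraph A)ᗮ ≤ graphSpace A.adjoint := by
  intro p hp
  rw [mem_graphSpace, mem_graph_adjoint_iff hA]
  rintro ⟨x, y⟩ hxy
  obtain ⟨g, rfl, rfl⟩ := A.mem_graph_iff.1 hxy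
  have h := (Submodule.mem_orthogonal' _ _).1 hp _ ⟨g, rfl⟩
  have h1 : ⟪p, inclSnd E g - inclFst E (A g)⟫_ℂ = 0 := h
  rw [inner_sub_right, ← ContinuousLinearMap.adjoint_inner_left, adjoint_inclSnd,
    ← ContinuousLinearMap.adjoint_inner_left, adjoint_inclFst] at h1
  change ⟪p.fst, A g⟫_ℂ - ⟪p.snd, (g : E)⟫_ℂ = 0
  change ⟪p.snd, (g : E)⟫_ℂ - ⟪p.fst, A g⟫_ℂ = 0 at h1
  rw [← neg_sub, h1, neg_zero]

theorem inner_adjoint_of_mem {A : E →ₗ.[ℂ] E} (hA : Dense (A.domain : Set E))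
    (p : graphSpace A.adjoint) (g : A.domain) : ⟪p.1.fst, A g⟫_ℂ = ⟪p.1.snd, (g : E)⟫_ℂ :=
  sub_eq_zero.1 ((mem_graph_adjoint_iff hA).1 (mem_graphSpace.1 p.2) (A.mem_graph g))

/-- If `⟪u, A g ⊗ h⟫ = ⟪v, g ⊗ h⟫` for all `g ∈ dom A` and `h`, then `(u, v)`, regarded as an
element of `(E ⊕ E) ⊗ 𝔗`, belongs to the tensor product of the graph of `A*` with `𝔗`. -/
theorem exists_graphSpace_tensor {A : E →ₗ.[ℂ] E} (hA : Dense (A.domain : Set E))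
    {u v : HTensor E 𝔗}
    (huv : ∀ (g : A.domain) (h : 𝔗), ⟪u, elem (A g) h⟫_ℂ = ⟪v, elem (g : E) h⟫_ℂ) :
    ∃ q : HTensor (graphSpace A.adjoint) 𝔗, tmap (graphEmb A.adjoint) (.id ℂ 𝔗) q = u ∧
      tmap (graphVal A.adjoint) (.id ℂ 𝔗) q = v := by
  have : CompleteSpace (graphSpace A.adjoint) := (isClosed_graphSpace_adjoint hA).completeSpace_coe
  set K := graphSpace A.adjoint
  set w : HTensor (WithLp 2 (E × E)) 𝔗 :=
    tmap (inclFst E) (.id ℂ 𝔗) u + tmap (inclSnd E) (.id ℂ 𝔗) v with hw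
  have hadj : ContinuousLinearMap.adjoint (.id ℂ _ - K.starProjection)
      = .id ℂ _ - K.starProjection := by
    rw [map_sub, adjoint_id, (isSelfAdjoint_starProjection K).adjoint_eq]
  have h0 : tmap (.id ℂ _ - K.starProjection) (.id ℂ 𝔗) w = 0 := by
    refine tmap_eq_zero_of_inner _ w (rotatedGraph A) (fun x => ?_) ?_
    · rw [hadj, ← Submodule.orthogonal_orthogonal_eq_closure]
      exact Submodule.orthogonal_le (orthogonal_rotatedGraph hA)
        (Submodule.sub_starProjection_mem_orthogonal x)
    · rintro _ ⟨g, rfl⟩ h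
      have h1 : ∀ x : E, ⟪w, elem (inclFst E x) h⟫_ℂ = ⟪u, elem x h⟫_ℂ := by
        intro x
        rw [hw, inner_add_left, inner_tmap_elem, inner_tmap_elem, adjoint_id, adjoint_inclFst,
          adjoint_inclSnd]
        have e1 : WithLp.fstL 2 ℂ E E (inclFst E x) = x := rfl
        have e2 : WithLp.sndL 2 ℂ E E (inclFst E x) = 0 := rfl
        rw [e1, e2, elem_zero_left, inner_zero_right, add_zero, ContinuousLinearMap.id_apply]
      have h2 : ∀ x : E, ⟪w, elem (inclSnd E x) h⟫_ℂ = ⟪v, elem x h⟫_ℂ := by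
        intro x
        rw [hw, inner_add_left, inner_tmap_elem, inner_tmap_elem, adjoint_id, adjoint_inclFst,
          adjoint_inclSnd]
        have e1 : WithLp.fstL 2 ℂ E E (inclSnd E x) = 0 := rfl
        have e2 : WithLp.sndL 2 ℂ E E (inclSnd E x) = x := rfl
        rw [e1, e2, elem_zero_left, inner_zero_right, zero_add, ContinuousLinearMap.id_apply]
      change ⟪w, elem (inclSnd E g - inclFst E (A g)) h⟫_ℂ = 0
      have h3 : elem (inclSnd E g - inclFst E (A g)) h
          = elem (inclSnd E g) h - elem (inclFst E (A g)) h := by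
        rw [eq_sub_iff_add_eq, ← elem_add_left, sub_add_cancel]
      rw [h3, inner_sub_right, h1, h2, huv, sub_self]
  rw [tmap_sub_left, tmap_id_id, sub_apply, sub_eq_zero] at h0
  have h0' : tmap K.starProjection (.id ℂ 𝔗) w = w := h0.symm
  refine ⟨tmap K.orthogonalProjectionOnto (.id ℂ 𝔗) w, ?_, ?_⟩
  · have e : (graphEmb A.adjoint).comp K.orthogonalProjectionOnto
        = (WithLp.fstL 2 ℂ E E).comp K.starProjection := rfl
    rw [tmap_tmap, e, ← tmap_tmap _ _ (.id ℂ 𝔗) (.id ℂ 𝔗), h0', hw, map_add, tmap_tmap, tmap_tmap]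
    have e1 : (WithLp.fstL 2 ℂ E E).comp (inclFst E) = .id ℂ E := rfl
    have e2 : (WithLp.fstL 2 ℂ E E).comp (inclSnd E) = 0 := rfl
    rw [e1, e2, tmap_zero_left]
    change tmap (.id ℂ E) (.id ℂ 𝔗) u + 0 = u
    rw [tmap_id_id, add_zero]
    rfl
  · have e : (graphVal A.adjoint).comp K.orthogonalProjectionOnto
        = (WithLp.sndL 2 ℂ E E).comp K.starProjection := rfl
    rw [tmap_tmap, e, ← tmap_tmap _ _ (.id ℂ 𝔗) (.id ℂ 𝔗), h0', hw, map_add, tmap_tmap, tmap_tmap]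
    have e1 : (WithLp.sndL 2 ℂ E E).comp (inclFst E) = 0 := rfl
    have e2 : (WithLp.sndL 2 ℂ E E).comp (inclSnd E) = .id ℂ E := rfl
    rw [e1, e2, tmap_zero_left]
    change 0 + tmap (.id ℂ E) (.id ℂ 𝔗) v = v
    rw [tmap_id_id, zero_add]
    rfl

/-- The graph of the adjoint of `A ⊗ I + I ⊗ T`, parametrized by `𝔥₊(A*) ⊗ 𝔗`. -/
theorem mem_graph_adjoint_tensorSum {A : E →ₗ.[ℂ] E} {T : 𝔗 →L[ℂ] 𝔗}
    (hA : Dense (A.domain : Set E)) (hsym : A.IsFormalAdjoint A) (hT : IsSelfAdjoint T)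
    {u v : HTensor E 𝔗} : (u, v) ∈ (tensorSum A T).adjoint.graph ↔
      ∃ q : HTensor (graphSpace A.adjoint) 𝔗, tmap (graphEmb A.adjoint) (.id ℂ 𝔗) q = u ∧
        tmap (graphVal A.adjoint) (.id ℂ 𝔗) q + tmap (.id ℂ E) T u = v := by
  rw [adjoint_tensorSum hA hsym hT, mem_graph_adjoint_algTensorSum hA]
  have hTu : ∀ (u : HTensor E 𝔗) (g : E) (h : 𝔗),
      ⟪tmap (.id ℂ E) T u, elem g h⟫_ℂ = ⟪u, elem g (T h)⟫_ℂ := by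
    intro u g h
    rw [inner_tmap_elem, adjoint_id, hT.adjoint_eq]
    rfl
  constructor
  · intro H
    obtain ⟨q, hq1, hq2⟩ := exists_graphSpace_tensor hA (u := u) (v := v - tmap (.id ℂ E) T u)
      fun g h => by rw [inner_sub_left, hTu, ← H, inner_add_right, add_sub_cancel_right]
    exact ⟨q, hq1, by rw [hq2, sub_add_cancel]⟩
  · rintro ⟨q, rfl, rfl⟩ g h
    have hq : ⟪tmap (graphEmb A.adjoint) (.id ℂ 𝔗) q, elem (A g) h⟫_ℂ
        = ⟪tmap (graphVal A.adjoint) (.id ℂ 𝔗) q, elem (g : E) h⟫_ℂ := by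
      refine HTensor.induction (p := fun q =>
        ⟪tmap (graphEmb A.adjoint) (.id ℂ 𝔗) q, elem (A g) h⟫_ℂ
          = ⟪tmap (graphVal A.adjoint) (.id ℂ 𝔗) q, elem (g : E) h⟫_ℂ)
        (isClosed_eq (by fun_prop) (by fun_prop)) (fun p k => ?_) (fun q q' hq hq' => ?_) q
      · rw [tmap_elem, tmap_elem, inner_elem, inner_elem]
        exact congrArg (· * _) (inner_adjoint_of_mem hA p g)
      · rw [map_add, map_add, inner_add_left, inner_add_left, hq, hq']
    rw [inner_add_right, inner_add_left, hq, hTu]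

end AdjointGraph

/-! ### The boundary triplet `Π_A ⊗̂ I` -/

namespace BoundaryTriplet

set_option linter.unusedSectionVars false

variable {E 𝓗 𝔗 : Type*} [NormedAddCommGroup E] [InnerProductSpace ℂ E] [CompleteSpace E]
  [NormedAddCommGroup 𝓗] [InnerProductSpace ℂ 𝓗] [CompleteSpace 𝓗]
  [NormedAddCommGroup 𝔗] [InnerProductSpace ℂ 𝔗] [CompleteSpace 𝔗]
  {A : E →ₗ.[ℂ] E} (P : BoundaryTriplet A 𝓗)

theorem tensorExt_apply {B : E →ₗ.[ℂ] E} (hB : Function.Injective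
    (tmap (graphEmb B) (ContinuousLinearMap.id ℂ 𝔗))) (Γ : graphSpace B →L[ℂ] 𝓗)
    (q : HTensor (graphSpace B) 𝔗) :
    tensorExt hB Γ ⟨tmap (graphEmb B) (.id ℂ 𝔗) q, ⟨q, rfl⟩⟩ = tmap Γ (.id ℂ 𝔗) q := by
  have h1 : (LinearEquiv.ofInjective (tmap (graphEmb B) (.id ℂ 𝔗)).toLinearMap hB).symm
      ⟨tmap (graphEmb B) (.id ℂ 𝔗) q, ⟨q, rfl⟩⟩ = q := by
    rw [LinearEquiv.symm_apply_eq]; rfl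
  exact congrArg (tmap Γ (.id ℂ 𝔗)) h1

theorem mem_graph_tensorExt {B : E →ₗ.[ℂ] E} (hB : Function.Injective
    (tmap (graphEmb B) (ContinuousLinearMap.id ℂ 𝔗))) (Γ : graphSpace B →L[ℂ] 𝓗)
    {u : HTensor E 𝔗} {k : HTensor 𝓗 𝔗} : (u, k) ∈ (tensorExt hB Γ).graph ↔
      ∃ q, tmap (graphEmb B) (.id ℂ 𝔗) q = u ∧ tmap Γ (.id ℂ 𝔗) q = k := by
  rw [LinearPMap.mem_graph_iff]
  constructor
  · rintro ⟨⟨_, q, rfl⟩, rfl, rfl⟩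
    exact ⟨q, rfl, (tensorExt_apply hB Γ q).symm⟩
  · rintro ⟨q, rfl, rfl⟩
    exact ⟨⟨_, q, rfl⟩, rfl, tensorExt_apply hB Γ q⟩

/-- Green's identity on `𝔥₊(A*) ⊗ 𝔗`. -/
theorem green_tensor (p q : HTensor (graphSpace A.adjoint) 𝔗) :
    ⟪tmap (graphVal A.adjoint) (.id ℂ 𝔗) p, tmap (graphEmb A.adjoint) (.id ℂ 𝔗) q⟫_ℂ
        - ⟪tmap (graphEmb A.adjoint) (.id ℂ 𝔗) p, tmap (graphVal A.adjoint) (.id ℂ 𝔗) q⟫_ℂ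
      = ⟪tmap P.hat₁ (.id ℂ 𝔗) p, tmap P.hat₀ (.id ℂ 𝔗) q⟫_ℂ
        - ⟪tmap P.hat₀ (.id ℂ 𝔗) p, tmap P.hat₁ (.id ℂ 𝔗) q⟫_ℂ := by
  set J := tmap (graphEmb A.adjoint) (ContinuousLinearMap.id ℂ 𝔗)
  set V := tmap (graphVal A.adjoint) (ContinuousLinearMap.id ℂ 𝔗)
  set Γ := tmap P.hat₀ (ContinuousLinearMap.id ℂ 𝔗)
  set Γ' := tmap P.hat₁ (ContinuousLinearMap.id ℂ 𝔗)
  refine HTensor.induction (p := fun p => ⟪V p, J q⟫_ℂ - ⟪J p, V q⟫_ℂ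
    = ⟪Γ' p, Γ q⟫_ℂ - ⟪Γ p, Γ' q⟫_ℂ) (isClosed_eq (by fun_prop) (by fun_prop))
    (fun p h => ?_) (fun p p' hp hp' => ?_) p
  · refine HTensor.induction (p := fun q => ⟪V (elem p h), J q⟫_ℂ - ⟪J (elem p h), V q⟫_ℂ
      = ⟪Γ' (elem p h), Γ q⟫_ℂ - ⟪Γ (elem p h), Γ' q⟫_ℂ) (isClosed_eq (by fun_prop) (by fun_prop))
      (fun q k => ?_) (fun q q' hq hq' => ?_) q
    · simp only [J, V, Γ, Γ', tmap_elem, inner_elem]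
      rw [← sub_mul, ← sub_mul]
      exact congrArg (· * _) (P.green_pre p q)
    · simp only [map_add, inner_add_right]
      linear_combination hq + hq'
  · simp only [map_add, inner_add_left]
    linear_combination hp + hp'

/-- The surjection `(Γ₀, Γ₁)` has a bounded right inverse. -/
theorem exists_rightInverse : ∃ G : 𝓗 × 𝓗 →L[ℂ] graphSpace A.adjoint,
    ∀ w, P.hat₀ (G w) = w.1 ∧ P.hat₁ (G w) = w.2 := by
  have := P.completeSpace_graphSpace
  set Q := P.hat₀.prod P.hat₁
  set N := LinearMap.ker Q.toLinearMap with hN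
  have hNc : IsClosed (N : Set (graphSpace A.adjoint)) := Q.isClosed_ker
  have : CompleteSpace N := hNc.completeSpace_coe
  obtain ⟨G, hG⟩ := exists_bounded_inverse (N := Nᗮ) (Submodule.isClosed_orthogonal N) Q
    (fun v hv h0 => by
      have h1 : v ∈ N ⊓ Nᗮ := ⟨h0, hv⟩
      rwa [Submodule.inf_orthogonal_eq_bot] at h1)
    (fun w => by
      obtain ⟨p, h0, h1⟩ := P.surj_pre w.1 w.2
      refine ⟨p - N.starProjection p, Submodule.sub_starProjection_mem_orthogonal p, ?_⟩
      have h2 : Q (N.starProjection p) = 0 := Submodule.starProjection_apply_mem N p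
      rw [map_sub, h2, sub_zero]
      exact Prod.ext h0 h1)
  refine ⟨G, fun w => ?_⟩
  have h := ((hG w _).1 rfl).2
  exact ⟨congrArg Prod.fst h, congrArg Prod.snd h⟩

section Tensor

variable {T : 𝔗 →L[ℂ] 𝔗} (hT : IsSelfAdjoint T)

theorem mem_graph_adjoint {u v : HTensor E 𝔗} (P : BoundaryTriplet A 𝓗) (hT : IsSelfAdjoint T) :
    (u, v) ∈ (tensorSum A T).adjoint.graph ↔
      ∃ q : HTensor (graphSpace A.adjoint) 𝔗, tmap (graphEmb A.adjoint) (.id ℂ 𝔗) q = u ∧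
        tmap (graphVal A.adjoint) (.id ℂ 𝔗) q + tmap (.id ℂ E) T u = v :=
  mem_graph_adjoint_tensorSum P.dense P.symm hT

theorem domain_adjoint_tensorSum (P : BoundaryTriplet A 𝓗) (hT : IsSelfAdjoint T) :
    LinearMap.range (tmap (graphEmb A.adjoint) (ContinuousLinearMap.id ℂ 𝔗)).toLinearMap
      = (tensorSum A T).adjoint.domain := by
  ext u
  constructor
  · rintro ⟨q, rfl⟩
    exact LinearPMap.mem_domain_of_mem_graph ((P.mem_graph_adjoint hT).2 ⟨q, rfl, rfl⟩)
  · intro hu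
    obtain ⟨q, hq, -⟩ := (P.mem_graph_adjoint hT).1 ((tensorSum A T).adjoint.mem_graph ⟨u, hu⟩)
    exact ⟨q, hq⟩

/-- The boundary triplet `Π_A ⊗̂ I` for the adjoint of `A ⊗ I + I ⊗ T`. -/
def tensor : BoundaryTriplet (tensorSum A T) (HTensor 𝓗 𝔗) where
  dense := dense_tensorSum P.dense T
  symm := isFormalAdjoint_tensorSum P.dense P.symm hT
  Γ₀ := P.tensor₀ 𝔗
  Γ₁ := P.tensor₁ 𝔗
  dom₀ := P.domain_adjoint_tensorSum hT
  dom₁ := P.domain_adjoint_tensorSum hT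
  green := by
    have key : ∀ {u v} (q : HTensor (graphSpace A.adjoint) 𝔗),
        tmap (graphEmb A.adjoint) (.id ℂ 𝔗) q = u →
        tmap (graphVal A.adjoint) (.id ℂ 𝔗) q + tmap (.id ℂ E) T u = v →
        ∀ (h₀ : u ∈ (P.tensor₀ 𝔗).domain) (h₁ : u ∈ (P.tensor₁ 𝔗).domain),
          P.tensor₀ 𝔗 ⟨u, h₀⟩ = tmap P.hat₀ (.id ℂ 𝔗) q ∧
          P.tensor₁ 𝔗 ⟨u, h₁⟩ = tmap P.hat₁ (.id ℂ 𝔗) q := by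
      rintro _ _ q rfl rfl h₀ h₁
      exact ⟨tensorExt_apply _ _ q, tensorExt_apply _ _ q⟩
    intro f g
    obtain ⟨p, hp, hp'⟩ := (P.mem_graph_adjoint hT).1 ((tensorSum A T).adjoint.mem_graph f)
    obtain ⟨q, hq, hq'⟩ := (P.mem_graph_adjoint hT).1 ((tensorSum A T).adjoint.mem_graph g)
    have hpΓ := key p hp hp' ((P.domain_adjoint_tensorSum hT).ge f.2)
      ((P.domain_adjoint_tensorSum hT).ge f.2)
    have hqΓ := key q hq hq' ((P.domain_adjoint_tensorSum hT).ge g.2)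
      ((P.domain_adjoint_tensorSum hT).ge g.2)
    rw [hpΓ.1, hpΓ.2, hqΓ.1, hqΓ.2, ← P.green_tensor, hp, hq, ← hp', ← hq', inner_add_left,
      inner_add_right, inner_tmap_left (.id ℂ E) T, adjoint_id, hT.adjoint_eq]
    abel
  surj h₀ h₁ := by
    obtain ⟨G, hG⟩ := P.exists_rightInverse
    set q := tmap (G.comp (.inl ℂ 𝓗 𝓗)) (.id ℂ 𝔗) h₀ + tmap (G.comp (.inr ℂ 𝓗 𝓗)) (.id ℂ 𝔗) h₁
    have e1 : P.hat₀.comp (G.comp (.inl ℂ 𝓗 𝓗)) = .id ℂ 𝓗 :=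
      ContinuousLinearMap.ext fun x => (hG (x, 0)).1
    have e2 : P.hat₀.comp (G.comp (.inr ℂ 𝓗 𝓗)) = 0 :=
      ContinuousLinearMap.ext fun x => (hG (0, x)).1
    have e3 : P.hat₁.comp (G.comp (.inl ℂ 𝓗 𝓗)) = 0 :=
      ContinuousLinearMap.ext fun x => (hG (x, 0)).2
    have e4 : P.hat₁.comp (G.comp (.inr ℂ 𝓗 𝓗)) = .id ℂ 𝓗 :=
      ContinuousLinearMap.ext fun x => (hG (0, x)).2
    refine ⟨⟨tmap (graphEmb A.adjoint) (.id ℂ 𝔗) q,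
      (P.domain_adjoint_tensorSum hT).le ⟨q, rfl⟩⟩, ?_, ?_⟩
    · refine (tensorExt_apply P.tmap_graphEmb_injective P.hat₀ q).trans ?_
      rw [map_add, tmap_tmap, tmap_tmap, e1, e2, tmap_zero_left, ContinuousLinearMap.comp_id,
        tmap_id_id]
      exact add_zero _
    · refine (tensorExt_apply P.tmap_graphEmb_injective P.hat₁ q).trans ?_
      rw [map_add, tmap_tmap, tmap_tmap, e3, e4, tmap_zero_left, ContinuousLinearMap.comp_id,
        tmap_id_id]
      exact zero_add _

/-- If all pairs `(F p, G p)` lie in the graph of `B`, then `(F ⊗ I) r ↦ (G ⊗ I) r + (F ⊗ T) r` lies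
in the closed graph of `B ⊙ I + I ⊙ T`. -/
theorem mem_closure_graph_algTensorSum {V : Type*} [NormedAddCommGroup V] [InnerProductSpace ℂ V]
    {B : E →ₗ.[ℂ] E} {F G : V →L[ℂ] E} (hB : ∀ p, (F p, G p) ∈ B.graph) (T : 𝔗 →L[ℂ] 𝔗)
    (r : HTensor V 𝔗) : (tmap F (.id ℂ 𝔗) r, tmap G (.id ℂ 𝔗) r + tmap F T r)
      ∈ (algTensorSum B T).graph.topologicalClosure := by
  refine HTensor.induction (p := fun r => (tmap F (.id ℂ 𝔗) r, tmap G (.id ℂ 𝔗) r + tmap F T r)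
    ∈ (algTensorSum B T).graph.topologicalClosure)
    ((Submodule.isClosed_topologicalClosure _).preimage (by fun_prop)) (fun p h => ?_)
    (fun r r' hr hr' => ?_) r
  · refine Submodule.le_topologicalClosure _ ?_
    obtain ⟨g, hg, hg'⟩ := B.mem_graph_iff.1 (hB p)
    have h7 := elem_mem_graph_algTensorSum B T g h
    dsimp only at hg hg'
    rw [hg, hg'] at h7
    rw [tmap_elem, tmap_elem, tmap_elem]
    exact h7
  · have h := Submodule.add_mem _ hr hr'
    rw [Prod.mk_add_mk, add_add_add_comm] at h
    rwa [map_add, map_add, map_add]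

/-- In the graph norm, `ker (Γ₀ ⊗̂ I)` is the closure of `ker Γ₀ ⊙ 𝔗`, because a bounded right
inverse of `Γ₀` yields a bounded projection onto `ker Γ₀`. -/
theorem kerRestrict_tensor : kerRestrict (tensorSum A T).adjoint (P.tensor hT).Γ₀
    = tensorSum (kerRestrict A.adjoint P.Γ₀) T := by
  set B := kerRestrict A.adjoint P.Γ₀ with hB
  have hle : (algTensorSum B T).graph
      ≤ (kerRestrict (tensorSum A T).adjoint (P.tensor hT).Γ₀).graph := by
    refine graph_algTensorSum_le fun g h => ?_
    obtain ⟨h1, h2⟩ := mem_graph_kerRestrict.1 (B.mem_graph g)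
    set p : graphSpace A.adjoint := ⟨WithLp.toLp 2 ((g : E), B g), h1⟩
    have hp0 : P.hat₀ p = 0 := LinearPMap.mem_graph_snd_inj P.Γ₀ (hatMap_mem P.dom₀ p) h2 rfl
    refine mem_graph_kerRestrict.2 ⟨(P.mem_graph_adjoint hT).2 ⟨elem p h, tmap_elem _ _ _ _, ?_⟩,
      (mem_graph_tensorExt _ _).2 ⟨elem p h, tmap_elem _ _ _ _, ?_⟩⟩
    · rw [tmap_elem, tmap_elem]
      rfl
    · rw [tmap_elem, hp0, elem_zero_left]
  have hcl := (P.tensor hT).isClosed_kerRestrict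
  have hclos : (algTensorSum B T).IsClosable :=
    hcl.isClosable.leIsClosable (LinearPMap.le_of_le_graph hle)
  have hgr : (tensorSum B T).graph = (algTensorSum B T).graph.topologicalClosure :=
    hclos.graph_closure_eq_closure_graph.symm
  refine LinearPMap.eq_of_eq_graph (le_antisymm ?_ ?_)
  · rintro ⟨u, v⟩ huv
    obtain ⟨h1, h2⟩ := mem_graph_kerRestrict.1 huv
    obtain ⟨q, rfl, rfl⟩ := (P.mem_graph_adjoint hT).1 h1
    obtain ⟨q', hq', hq0⟩ := (mem_graph_tensorExt _ _).1 h2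
    obtain rfl := P.tmap_graphEmb_injective hq'
    clear hq' huv h1 h2
    obtain ⟨G, hG⟩ := P.exists_rightInverse
    -- `C` projects `𝔥₊(A*)` onto `ker Γ₀`
    set C : graphSpace A.adjoint →L[ℂ] graphSpace A.adjoint :=
      .id ℂ _ - (G.comp (.inl ℂ 𝓗 𝓗)).comp P.hat₀ with hC
    have hC0 : ∀ p, P.pre₀ (C p) = 0 := fun p => by
      change P.hat₀ (p - G (P.hat₀ p, 0)) = 0
      rw [map_sub, (hG _).1, sub_self]
    have hCq : tmap C (.id ℂ 𝔗) q' = q' := by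
      have h3 : tmap ((G.comp (.inl ℂ 𝓗 𝓗)).comp P.hat₀) (.id ℂ 𝔗) q'
          = tmap (G.comp (.inl ℂ 𝓗 𝓗)) (.id ℂ 𝔗) (tmap P.hat₀ (.id ℂ 𝔗) q') := by
        rw [tmap_tmap]; rfl
      rw [hC, tmap_sub_left, sub_apply, h3, hq0, map_zero, sub_zero, tmap_id_id]
      rfl
    have hCB : ∀ p, ((graphEmb A.adjoint).comp C p, (graphVal A.adjoint).comp C p) ∈ B.graph := by
      intro p
      refine mem_graph_kerRestrict.2 ⟨(C p).2, ?_⟩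
      have h5 := hatMap_mem P.dom₀ (C p)
      have h6 : hatMap A.adjoint P.Γ₀ P.dom₀ (C p) = 0 := hC0 p
      rwa [h6] at h5
    have h9 := mem_closure_graph_algTensorSum hCB T q'
    have h10 : ∀ (F : graphSpace A.adjoint →L[ℂ] E) (T : 𝔗 →L[ℂ] 𝔗),
        tmap (F.comp C) T q' = tmap F T q' := fun F T => by
      conv_rhs => rw [← hCq, tmap_tmap, ContinuousLinearMap.comp_id]
    rw [h10, h10, h10] at h9
    rw [hgr, tmap_tmap, ContinuousLinearMap.id_comp, ContinuousLinearMap.comp_id]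
    exact h9
  · rw [hgr]
    exact Submodule.topologicalClosure_minimal _ hle hcl

variable {a b : ℝ}

theorem specInt_smul_self {H H₁ : Type*} [NormedAddCommGroup H] [InnerProductSpace ℂ H]
    [CompleteSpace H] [NormedAddCommGroup H₁] [InnerProductSpace ℂ H₁] [CompleteSpace H₁]
    (h : SpectralInterval T a b) {Ω : ℝ → H →L[ℂ] H₁} (hΩ : Continuous Ω) :
    specInt T a b (fun t => (t : ℂ) • Ω t) = (tmap (.id ℂ H₁) T).comp (specInt T a b Ω) := by
  have h1 : specInt T a b (fun t : ℝ => (t : ℂ) • ContinuousLinearMap.id ℂ H₁)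
      = tmap (.id ℂ H₁) T := by
    have h2 := specInt_smul_const h (f := fun t => t) continuous_id (.id ℂ H₁)
    rwa [cfc_id' ℝ T h.sa] at h2
  have hc : Continuous fun t : ℝ => (t : ℂ) • ContinuousLinearMap.id ℂ H₁ :=
    Complex.continuous_ofReal.smul continuous_const
  rw [← h1, ← specInt_comp h hc hΩ]
  rfl

/-- The vectors `q = ∫ γ̂(z - λ) ⊗ E_T(dλ) k` solve `S* u = z u` and have the boundary values `k`
and `∫ M(z - λ) ⊗ E_T(dλ) k`. -/
theorem tensor_gammaField_weyl (h : SpectralInterval T a b) {z : ℂ} (hz : z.im ≠ 0) :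
    (P.tensor h.sa).gammaField z = specInt T a b (fun t => P.gammaField (z - t)) ∧
    (P.tensor h.sa).weyl z = specInt T a b (fun t => P.weyl (z - t)) := by
  have := P.completeSpace_graphSpace
  have hγ : Continuous fun t : ℝ => P.gammaField (z - t) :=
    continuous_sub_ofReal_comp (fun _ hw => P.continuousAt_gammaField hw) hz
  have hL : Continuous fun t : ℝ => P.gammaLift (z - t) :=
    continuous_sub_ofReal_comp (fun _ hw => P.continuousAt_gammaLift hw) hz
  set L := specInt T a b fun t => P.gammaLift (z - t)
  have e0 : (tmap (graphEmb A.adjoint) (.id ℂ 𝔗)).comp L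
      = specInt T a b (fun t => P.gammaField (z - t)) := tmap_comp_specInt h _ hL
  have e1 : (tmap P.hat₀ (.id ℂ 𝔗)).comp L = .id ℂ _ := by
    rw [tmap_comp_specInt h _ hL, ← tmap_id_id, ← specInt_const h]
    congr 1
    funext t
    exact ContinuousLinearMap.ext fun k => P.pre₀_gammaLift (im_sub_ofReal_ne hz t) k
  have e2 : (tmap P.hat₁ (.id ℂ 𝔗)).comp L = specInt T a b (fun t => P.weyl (z - t)) := by
    rw [tmap_comp_specInt h _ hL]
    congr 1
    funext t
    exact (P.weyl_eq_comp (im_sub_ofReal_ne hz t)).symm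
  have e3 : (tmap (graphVal A.adjoint) (.id ℂ 𝔗)).comp L
      = z • specInt T a b (fun t => P.gammaField (z - t))
        - (tmap (.id ℂ E) T).comp (specInt T a b (fun t => P.gammaField (z - t))) := by
    have hs : Continuous fun t : ℝ => (t : ℂ) • P.gammaField (z - t) :=
      Complex.continuous_ofReal.smul hγ
    have hs' : Continuous fun t : ℝ => z • P.gammaField (z - t) := hγ.const_smul z
    rw [tmap_comp_specInt h _ hL, ← specInt_smul_self h hγ, ← specInt_smul h z hγ,
      ← specInt_sub h hs' hs]
    congr 1
    funext t
    refine ContinuousLinearMap.ext fun k => ?_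
    change ((z - t : ℂ) • P.gammaField (z - t) k) = z • _ - (t : ℂ) • _
    rw [sub_smul]
    rfl
  have hG : (P.tensor h.sa).gammaField z = specInt T a b (fun t => P.gammaField (z - t)) := by
    refine ContinuousLinearMap.ext fun k => gammaField_apply_eq _ hz ?_ ?_
    · rw [mem_defect]
      refine (P.mem_graph_adjoint h.sa).2 ⟨L k, ?_, ?_⟩
      · rw [← e0]; rfl
      · have := congrArg (fun B => B k) e3
        refine (congrArg (· + _) this).trans ?_
        exact sub_add_cancel _ _
    · refine (mem_graph_tensorExt _ _).2 ⟨L k, ?_, congrArg (fun B => B k) e1⟩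
      rw [← e0]; rfl
  refine ⟨hG, ContinuousLinearMap.ext fun k => weyl_apply_eq _ hz ?_⟩
  rw [hG]
  refine (mem_graph_tensorExt _ _).2 ⟨L k, ?_, congrArg (fun B => B k) e2⟩
  rw [← e0]; rfl

end Tensor

end BoundaryTriplet

/-! ### Real part, imaginary part and square root under the integral -/

section Calculus

set_option linter.unusedSectionVars false

variable {𝓗 𝔗 : Type*} [NormedAddCommGroup 𝓗] [InnerProductSpace ℂ 𝓗] [CompleteSpace 𝓗]
  [NormedAddCommGroup 𝔗] [InnerProductSpace ℂ 𝔗] [CompleteSpace 𝔗]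
  {T : 𝔗 →L[ℂ] 𝔗} {a b : ℝ} {M : ℝ → 𝓗 →L[ℂ] 𝓗}

theorem sqrtIm_eq_of_mul_self {N B : 𝓗 →L[ℂ] 𝓗} (hB : 0 ≤ B) (h : B * B = imOp N) :
    sqrtIm N = B := CFC.sqrt_unique h hB

theorem mul_self_nonneg_of_adjoint {B : 𝓗 →L[ℂ] 𝓗} (h : ContinuousLinearMap.adjoint B = B) :
    0 ≤ B * B := by
  have h1 : B * B = star B * B := congrArg (· * B) h.symm
  rw [h1]
  exact star_mul_self_nonneg B

theorem specInt_mul (h : SpectralInterval T a b) {Ω Ω' : ℝ → 𝓗 →L[ℂ] 𝓗} (hΩ : Continuous Ω)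
    (hΩ' : Continuous Ω') :
    specInt T a b (fun t => Ω t * Ω' t) = specInt T a b Ω * specInt T a b Ω' :=
  specInt_comp h hΩ hΩ'

theorem specInt_one (h : SpectralInterval T a b) :
    specInt T a b (fun _ => (1 : 𝓗 →L[ℂ] 𝓗)) = 1 :=
  (specInt_const h _).trans tmap_id_id

theorem specInt_reOp (h : SpectralInterval T a b) (hM : Continuous M) :
    specInt T a b (fun t => reOp (M t)) = reOp (specInt T a b M) := by
  have hc : Continuous fun t => M t + ContinuousLinearMap.adjoint (M t) :=
    hM.add (continuous_adjoint hM)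
  simp only [reOp_eq]
  rw [specInt_smul h _ hc, specInt_add h hM (continuous_adjoint hM), adjoint_specInt h hM]

theorem specInt_imOp (h : SpectralInterval T a b) (hM : Continuous M) :
    specInt T a b (fun t => imOp (M t)) = imOp (specInt T a b M) := by
  have hc : Continuous fun t => M t - ContinuousLinearMap.adjoint (M t) :=
    hM.sub (continuous_adjoint hM)
  simp only [imOp_eq]
  rw [specInt_smul h _ hc, specInt_sub h hM (continuous_adjoint hM), adjoint_specInt h hM]

/-- The integral of `M = √M √M` is the square of the self-adjoint integral of `√M`. -/
theorem specInt_nonneg (h : SpectralInterval T a b) (hM : Continuous M) (h0 : ∀ t, 0 ≤ M t) :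
    0 ≤ specInt T a b M := by
  have hc := continuous_sqrt hM h0
  have h1 : M = fun t => CFC.sqrt (M t) * CFC.sqrt (M t) :=
    funext fun t => (CFC.sqrt_mul_sqrt_self _ (h0 t)).symm
  have h2 : ContinuousLinearMap.adjoint (specInt T a b fun t => CFC.sqrt (M t))
      = specInt T a b fun t => CFC.sqrt (M t) :=
    (adjoint_specInt h hc).trans (congrArg (specInt T a b) (funext fun t =>
      (IsSelfAdjoint.of_nonneg (CFC.sqrt_nonneg (M t))).adjoint_eq))
  rw [h1, specInt_mul h hc hc]
  exact mul_self_nonneg_of_adjoint h2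

theorem specInt_sqrtIm (h : SpectralInterval T a b) (hM : Continuous M)
    (h0 : ∀ t, 0 ≤ imOp (M t)) :
    specInt T a b (fun t => sqrtIm (M t)) = sqrtIm (specInt T a b M) := by
  have hc := continuous_sqrtIm hM h0
  refine (sqrtIm_eq_of_mul_self (specInt_nonneg h hc fun t => CFC.sqrt_nonneg _) ?_).symm
  rw [← specInt_mul h hc hc, ← specInt_imOp h hM]
  exact congrArg (specInt T a b) (funext fun t => sqrtIm_mul_self (h0 t))

theorem specInt_sqrtIm_mul_specInt_invSqrtIm (h : SpectralInterval T a b) (hM : Continuous M)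
    (h0 : ∀ t, 0 ≤ imOp (M t)) (hu : ∀ t, IsUnit (imOp (M t))) :
    specInt T a b (fun t => sqrtIm (M t)) * specInt T a b (fun t => invSqrtIm (M t)) = 1 := by
  rw [← specInt_mul h (continuous_sqrtIm hM h0) (continuous_invSqrtIm hM h0 hu)]
  exact (congrArg (specInt T a b) (funext fun t => sqrtIm_mul_invSqrtIm (h0 t) (hu t))).trans
    (specInt_one h)

theorem specInt_invSqrtIm_mul_specInt_sqrtIm (h : SpectralInterval T a b) (hM : Continuous M)
    (h0 : ∀ t, 0 ≤ imOp (M t)) (hu : ∀ t, IsUnit (imOp (M t))) :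
    specInt T a b (fun t => invSqrtIm (M t)) * specInt T a b (fun t => sqrtIm (M t)) = 1 := by
  rw [← specInt_mul h (continuous_invSqrtIm hM h0 hu) (continuous_sqrtIm hM h0)]
  exact (congrArg (specInt T a b) (funext fun t => invSqrtIm_mul_sqrtIm (h0 t) (hu t))).trans
    (specInt_one h)

end Calculus

/-! ### Scalar Weyl functions -/

section Scalar

variable {𝓗 : Type*} [NormedAddCommGroup 𝓗] [InnerProductSpace ℂ 𝓗] [CompleteSpace 𝓗]

theorem adjoint_smul_id (c : ℂ) : ContinuousLinearMap.adjoint (c • ContinuousLinearMap.id ℂ 𝓗)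
    = (starRingEnd ℂ c) • ContinuousLinearMap.id ℂ 𝓗 := by
  rw [map_smulₛₗ, adjoint_id]

theorem reOp_smul_id (c : ℂ) :
    reOp (c • ContinuousLinearMap.id ℂ 𝓗) = (c.re : ℂ) • ContinuousLinearMap.id ℂ 𝓗 := by
  rw [reOp_eq, adjoint_smul_id, ← add_smul, smul_smul, Complex.re_eq_add_conj]
  congr 1
  ring

theorem imOp_smul_id (c : ℂ) :
    imOp (c • ContinuousLinearMap.id ℂ 𝓗) = (c.im : ℂ) • ContinuousLinearMap.id ℂ 𝓗 := by
  rw [imOp_eq, adjoint_smul_id, ← sub_smul, smul_smul, Complex.im_eq_sub_conj]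
  congr 1
  field_simp
  rw [Complex.I_sq]
  ring

theorem im_ne_zero_of_isUnit [Nontrivial 𝓗] {c : ℂ}
    (hu : IsUnit (imOp (c • ContinuousLinearMap.id ℂ 𝓗))) : (c.im : ℂ) ≠ 0 := by
  intro h
  rw [imOp_smul_id, h, zero_smul] at hu
  exact not_isUnit_zero hu

/-- If `M(ζ) = d I`, then `(Im M(ζ))^(-1/2)` squares to `(Im d)⁻¹ I`. -/
theorem Lfun_scalar {M : ℂ → 𝓗 →L[ℂ] 𝓗} {z ζ c d : ℂ} (hz : M z = c • .id ℂ 𝓗)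
    (hζ : M ζ = d • .id ℂ 𝓗) (h0 : 0 ≤ imOp (M ζ)) (hu : IsUnit (imOp (M ζ)))
    (hd : (d.im : ℂ) ≠ 0) :
    Lfun M z ζ = ((c - (d.re : ℂ)) / (d.im : ℂ)) • ContinuousLinearMap.id ℂ 𝓗 := by
  have h1 := sqrtIm_mul_self h0
  have h2 := invSqrtIm_mul_sqrtIm h0 hu
  have h3 := sqrtIm_mul_invSqrtIm h0 hu
  have h4 : imOp (M ζ) = (d.im : ℂ) • (1 : 𝓗 →L[ℂ] 𝓗) := by rw [hζ]; exact imOp_smul_id d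
  have h5 : M z - reOp (M ζ) = (c - (d.re : ℂ)) • (1 : 𝓗 →L[ℂ] 𝓗) := by
    rw [hz, hζ, reOp_smul_id, sub_smul]; rfl
  rw [Lfun, h5]
  set s := sqrtIm (M ζ)
  set s' := invSqrtIm (M ζ)
  have h6 : s' * s' = (d.im : ℂ)⁻¹ • (1 : 𝓗 →L[ℂ] 𝓗) := by
    have h7 : (d.im : ℂ) • (s' * s') = 1 := by
      calc (d.im : ℂ) • (s' * s') = s' * ((d.im : ℂ) • (1 : 𝓗 →L[ℂ] 𝓗)) * s' := by
            rw [mul_smul_comm, mul_one, smul_mul_assoc]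
        _ = (s' * s) * (s * s') := by rw [← h4, ← h1]; noncomm_ring
        _ = 1 := by rw [h2, h3, one_mul]
    rw [← h7, smul_smul, inv_mul_cancel₀ hd, one_smul]
  rw [mul_smul_comm, mul_one, smul_mul_assoc, h6, smul_smul, div_eq_mul_inv]
  rfl

theorem IsNevanlinna.continuousAt {m : ℂ → ℂ} (hm : IsNevanlinna m) {w : ℂ} (hw : w.im ≠ 0) :
    ContinuousAt m w :=
  hm.holo.continuousOn.continuousAt
    ((isOpen_ne.preimage Complex.continuous_im).mem_nhds hw)

end Scalar

end BT

end

open BT in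
/-- `A` is a densely defined symmetric operator in `E`, `P` is a boundary triplet for `A*`,
`T` is a bounded self-adjoint operator in `𝔗`, `[a, b]` is a compact interval containing `σ(T)`
(for example the smallest one), `S = A ⊗ I + I ⊗ T` and `Ê δ = I ⊗ E_T(δ)`. -/
theorem proposition4p3 {E 𝓗 𝔗 : Type*}
    [NormedAddCommGroup E] [InnerProductSpace ℂ E] [CompleteSpace E]
    [NormedAddCommGroup 𝓗] [InnerProductSpace ℂ 𝓗] [CompleteSpace 𝓗]
    [NormedAddCommGroup 𝔗] [InnerProductSpace ℂ 𝔗] [CompleteSpace 𝔗]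
    (A : E →ₗ.[ℂ] E) (P : BoundaryTriplet A 𝓗)
    (T : 𝔗 →L[ℂ] 𝔗) (hT : IsSelfAdjoint T)
    (a b : ℝ) (hab : a ≤ b) (hσ : spectrum ℝ T ⊆ Set.Icc a b) :
    let S : HTensor E 𝔗 →ₗ.[ℂ] HTensor E 𝔗 := tensorSum A T
    let I𝔗 : 𝔗 →L[ℂ] 𝔗 := ContinuousLinearMap.id ℂ 𝔗
    let Ê : Set ℝ → HTensor 𝓗 𝔗 →L[ℂ] HTensor 𝓗 𝔗 :=
      fun δ => tmap (ContinuousLinearMap.id ℂ 𝓗) (spectralMeasure T δ)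
    ∃ (PS PN : BoundaryTriplet S (HTensor 𝓗 𝔗)) (R R' Q : HTensor 𝓗 𝔗 →L[ℂ] HTensor 𝓗 𝔗),
      -- the boundary triplet `Π_A ⊗̂ I` for `S*`
      PS.Γ₀ = P.tensor₀ 𝔗 ∧ PS.Γ₁ = P.tensor₁ 𝔗 ∧
      -- the operator-spectral integrals
      HasIntegralLeft a b Ê (fun t => tmap (sqrtIm (P.weyl (Complex.I - t))) I𝔗) R ∧
      HasIntegralLeft a b Ê (fun t => tmap (invSqrtIm (P.weyl (Complex.I - t))) I𝔗) R' ∧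
      HasIntegralLeft a b Ê (fun t => tmap (reOp (P.weyl (Complex.I - t))) I𝔗) Q ∧
      R = sqrtIm (PS.weyl Complex.I) ∧ R' = invSqrtIm (PS.weyl Complex.I) ∧
      Q = reOp (PS.weyl Complex.I) ∧
      -- (i) the normalized boundary triplet
      PN.Γ₀ = R.toLinearMap.compPMap (P.tensor₀ 𝔗) ∧
      PN.Γ₁ = R'.toLinearMap.compPMap (P.tensor₁ 𝔗 - Q.toLinearMap.compPMap (P.tensor₀ 𝔗)) ∧
      PN.IsNormalized ∧
      kerRestrict S.adjoint PN.Γ₀ = kerRestrict S.adjoint PS.Γ₀ ∧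
      kerRestrict S.adjoint PS.Γ₀ = tensorSum (kerRestrict A.adjoint P.Γ₀) T ∧
      -- (ii) its gamma field and Weyl function
      (∀ z : ℂ, z.im ≠ 0 →
        HasIntegralRight a b
          (fun t => tmap ((P.gammaField (z - t)).comp (invSqrtIm (P.weyl (Complex.I - t)))) I𝔗) Ê
          (PN.gammaField z) ∧
        HasIntegralRight a b
          (fun t => tmap (Lfun P.weyl (z - t) (Complex.I - t)) I𝔗) Ê (PN.weyl z) ∧
        HasIntegralLeft a b
          Ê (fun t => tmap (Lfun P.weyl (z - t) (Complex.I - t)) I𝔗) (PN.weyl z)) ∧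
      -- (iii) the scalar case
      (∀ m : ℂ → ℂ, IsScalarType P.weyl m → ∀ z : ℂ, z.im ≠ 0 →
        PN.weyl z = tmap (ContinuousLinearMap.id ℂ 𝓗)
          (cfc (fun w : ℂ => (m (z - w) - ((m (Complex.I - w)).re : ℂ))
            / ((m (Complex.I - w)).im : ℂ)) T)) ∧
      (Module.finrank ℂ (defect A Complex.I) = 1 → Module.finrank ℂ (defect A (-Complex.I)) = 1 →
        ∃ m : ℂ → ℂ, IsScalarType P.weyl m) := by
  intro S I𝔗 Ê
  have h : SpectralInterval T a b := ⟨hT, hab, hσ⟩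
  have hI : Complex.I.im ≠ 0 := by simp
  have hMc : ∀ {z : ℂ}, z.im ≠ 0 → Continuous fun t : ℝ => P.weyl (z - t) := fun hz =>
    BoundaryTriplet.continuous_sub_ofReal_comp (fun _ hw => P.continuousAt_weyl hw) hz
  have h0 : ∀ t : ℝ, 0 ≤ imOp (P.weyl (Complex.I - t)) := fun t => P.imOp_weyl_nonneg (by simp)
  have hu : ∀ t : ℝ, IsUnit (imOp (P.weyl (Complex.I - t))) := fun t =>
    P.isUnit_imOp_weyl (BoundaryTriplet.im_sub_ofReal_ne hI t)
  have hs := continuous_sqrtIm (hMc hI) h0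
  have hs' := continuous_invSqrtIm (hMc hI) h0 hu
  have hq := continuous_reOp (hMc hI)
  set PS := P.tensor hT with hPS
  have hW : ∀ {z : ℂ}, z.im ≠ 0 → PS.weyl z = specInt T a b fun t => P.weyl (z - t) := fun hz =>
    (P.tensor_gammaField_weyl h hz).2
  set R := specInt T a b fun t => sqrtIm (P.weyl (Complex.I - t)) with hR
  set R' := specInt T a b fun t => invSqrtIm (P.weyl (Complex.I - t)) with hR'
  set Q := specInt T a b fun t => reOp (P.weyl (Complex.I - t)) with hQ
  have hRe : R = sqrtIm (PS.weyl Complex.I) := by rw [hW hI, hR, specInt_sqrtIm h (hMc hI) h0]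
  have hQe : Q = reOp (PS.weyl Complex.I) := by rw [hW hI, hQ, specInt_reOp h (hMc hI)]
  have hRR' : R * R' = 1 := specInt_sqrtIm_mul_specInt_invSqrtIm h (hMc hI) h0 hu
  have hR'R : R' * R = 1 := specInt_invSqrtIm_mul_specInt_sqrtIm h (hMc hI) h0 hu
  have hRR : R * R = imOp (PS.weyl Complex.I) := by
    rw [hRe, sqrtIm_mul_self (PS.imOp_weyl_nonneg (by simp))]
  set PN := PS.transform R R' Q (hRe ▸ isSelfAdjoint_sqrtIm _) (hQe ▸ isSelfAdjoint_reOp _) hRR'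
    hR'R with hPN
  have hWN : ∀ {z : ℂ}, z.im ≠ 0 → PN.weyl z = R' * (PS.weyl z - Q) * R' := fun hz =>
    PS.transform_weyl _ _ _ _ _ _ _ hz
  have hLc : ∀ {z : ℂ}, z.im ≠ 0 → Continuous fun t : ℝ => Lfun P.weyl (z - t) (Complex.I - t) :=
    fun hz => (hs'.mul ((hMc hz).sub hq)).mul hs'
  have hLe : ∀ {z : ℂ}, z.im ≠ 0 →
      specInt T a b (fun t => Lfun P.weyl (z - t) (Complex.I - t)) = PN.weyl z := fun {z} hz => by
    have hc1 : Continuous fun t : ℝ => P.weyl (z - t) - reOp (P.weyl (Complex.I - t)) :=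
      (hMc hz).sub hq
    have hc2 : Continuous fun t : ℝ => invSqrtIm (P.weyl (Complex.I - t))
        * (P.weyl (z - t) - reOp (P.weyl (Complex.I - t))) := hs'.mul hc1
    rw [hWN hz, hW hz, hQ, ← specInt_sub h (hMc hz) hq, hR', ← specInt_mul h hs' hc1,
      ← specInt_mul h hc2 hs']
    rfl
  refine ⟨PS, PN, R, R', Q, rfl, rfl, hasIntegralLeft_iff.2 (tendsto_stepSum h hs),
    hasIntegralLeft_iff.2 (tendsto_stepSum h hs'), hasIntegralLeft_iff.2 (tendsto_stepSum h hq),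
    hRe, (invSqrtIm_eq_of_mul_eq_one (hRe ▸ hRR') (hRe ▸ hR'R)).symm, hQe, rfl, rfl, ?_,
    BoundaryTriplet.kerRestrict_compPMap hR'R _ _, P.kerRestrict_tensor hT,
    fun z hz => ⟨?_, ?_, ?_⟩,
    fun m hm z hz => ?_, fun h1 _ => P.exists_isScalarType h1⟩
  · -- `M(i) - Q = i R²`, so that `R⁻¹ (M(i) - Q) R⁻¹ = i`
    have h1 : PS.weyl Complex.I - Q = Complex.I • (R * R) := by
      rw [hRR, hQe, sub_eq_iff_eq_add']
      exact (reOp_add_I_smul_imOp _).symm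
    rw [BoundaryTriplet.IsNormalized, hWN hI, h1, mul_smul_comm, smul_mul_assoc, ← mul_assoc, hR'R,
      one_mul, hRR']
    rfl
  · have hγ : Continuous fun t : ℝ => P.gammaField (z - t) :=
      BoundaryTriplet.continuous_sub_ofReal_comp (fun _ hw => P.continuousAt_gammaField hw) hz
    have hc : Continuous fun t : ℝ =>
        (P.gammaField (z - t)).comp (invSqrtIm (P.weyl (Complex.I - t))) := hγ.clm_comp hs'
    rw [PS.transform_gammaField _ _ _ _ _ _ _ hz, (P.tensor_gammaField_weyl h hz).1,
      ← specInt_comp h hγ hs']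
    exact hasIntegralRight_iff.2 (tendsto_stepSum h hc)
  · rw [← hLe hz]
    exact hasIntegralRight_iff.2 (tendsto_stepSum h (hLc hz))
  · rw [← hLe hz]
    exact hasIntegralLeft_iff.2 (tendsto_stepSum h (hLc hz))
  · -- if `𝓗 = 0`, then `m` is arbitrary and `Im m(i - t)` may vanish, but `𝓗 ⊗ 𝔗 = 0`
    rcases subsingleton_or_nontrivial 𝓗 with h𝓗 | h𝓗
    · have hsub : ∀ u : HTensor 𝓗 𝔗, u = 0 := fun u => eq_zero_of_inner_elem fun x y => by
        rw [Subsingleton.elim x 0, elem_zero_left, inner_zero_right]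
      exact ContinuousLinearMap.ext fun u => (hsub _).trans (hsub _).symm
    · have hd : ∀ t : ℝ, ((m (Complex.I - t)).im : ℂ) ≠ 0 := fun t =>
        im_ne_zero_of_isUnit (𝓗 := 𝓗) (by
          rw [← hm.2 _ (BoundaryTriplet.im_sub_ofReal_ne hI t)]
          exact hu t)
      have hmc : ∀ {z : ℂ}, z.im ≠ 0 → Continuous fun t : ℝ => m (z - t) := fun hz =>
        BoundaryTriplet.continuous_sub_ofReal_comp (fun _ hw => hm.1.continuousAt hw) hz
      have hF : Continuous fun t : ℝ => (m (z - t) - ((m (Complex.I - t)).re : ℂ))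
          / ((m (Complex.I - t)).im : ℂ) :=
        ((hmc hz).sub (Complex.continuous_ofReal.comp (Complex.continuous_re.comp (hmc hI)))).div
          (Complex.continuous_ofReal.comp (Complex.continuous_im.comp (hmc hI))) hd
      rw [← hLe hz, ← specInt_smul_const_complex h (F := fun w : ℂ =>
        (m (z - w) - ((m (Complex.I - w)).re : ℂ)) / ((m (Complex.I - w)).im : ℂ)) hF]
      exact congrArg (specInt T a b) (funext fun t =>
        Lfun_scalar (hm.2 _ (BoundaryTriplet.im_sub_ofReal_ne hz t))
          (hm.2 _ (BoundaryTriplet.im_sub_ofReal_ne hI t)) (h0 t) (hu t) (hd t))
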